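/- Let $1\le N<M$, $[m]=\{1,\dots,m\}$, and let $\hat A=(\hat A^i_j)$ be a real $N\times M$ matrix with $\hat A^i_j=0$ for $j<i$ or $j>M-N+i$, with $\sum_j\hat A^i_j=1$ for every row $i$, and with all maximal minors positive. $\Delta_{[j_1,\dots,j_m]}$ denotes the minor of $\hat A$ formed by its last $m$ rows and the columns $j_1,\dots,j_m$ (it is $1$ for $m=0$); $\Delta_{[j;p,\dots,q]}$ is the minor with columns $j,p,\dots,q$. Times are real sequences $\vec t=(t_1,t_2,\dots)$ for which $\theta(\lambda,\vec t)=\sum_{i\ge1}\lambda^it_i$ converges for all $\lambda$. For $k_1<\dots<k_M$ put $\theta_j=\theta(k_j,\vec t)$. **Curve.** For $\xi>1$ put $\lambda_1=0$, $\lambda_l=-\xi^{2(l-2)}$ and $\alpha_l=\xi^{2l-5}$ for $l\in[2,M-N+1]$. Let $\Gamma$ be obtained from $N+1$ Riemann spheres $\Gamma_0,\dots,\Gamma_N$ (coordinate $\lambda$; $P_0$, $Q_r$ are the points $\lambda=\infty$ of $\Gamma_0$, $\Gamma_r$) by gluing $\lambda_l\in\Gamma_1$ to $k_{N+l-1}\in\Gamma_0$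 for $l\in[M-N+1]$ and, for $r\in[2,N]$, $\lambda_1\in\Gamma_r$ to $k_{N-r+1}\in\Gamma_0$ and $\lambda_l\in\Gamma_r$ to $\alpha_l\in\Gamma_{r-1}$ for $l\in[2,M-N+1]$. We write $\lambda_l^{(r)},\alpha_l^{(r)}$ for these points on $\Gamma_r$. The real part $\Gamma_{\mathbb R}$ is the fixed set of complex conjugation on the sheets. The real ovals are the closed paths in $\Gamma_{\mathbb R}$ that follow the real circle of a sheet in the direction of increasing $\lambda$ up to the next double point, pass there to the other sheet, and continue in the same way. **Wave function.** Put $\Psi^{(0)}(\lambda,\vec t)=e^{\theta(\lambda,\vec t)}$, and for $r\in[N]$ $$\Psi^{(r)}(\lambda,\vec t)=\sum_{l=1}^{M-N+1}\mathring B^{(r)}_l\,\frac{\prod_{j\ne l}(\lambda-\lambda_j)}{\prod_{n=1}^{M-N}(\lambda-b^{(r)}_n)}\,V^{(r)}_l(\vec t),$$ where $V^{(1)}_l=e^{\theta_{N+l-1}}$ and, for $r\ge2$, $V_1^{(r)}=e^{\theta_{N-r+1}}$, $V^{(r)}_l=\Psi^{(r-1)}(\alpha_l,\vec t)$ ($l\ge2$).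 We require: $\lambda_{n+1}<b_n^{(r)}<\lambda_n$; the values of $\Psi$ at glued points agree for all $\vec t$; and there are $\epsilon^{(r)}_j>0$ ($j\in[r-1]$) such that for all $\vec t$ $$\lim_{\lambda\to\infty}\Psi^{(r)}(\lambda,\vec t)=\frac{\sum_{s=1}^M\bigl(\hat A^{N-r+1}_s+\sum_{j=1}^{r-1}\epsilon^{(r)}_j\hat A^{N-r+1+j}_s\bigr)e^{\theta_s}}{1+\sum_{j=1}^{r-1}\epsilon^{(r)}_j}.$$ Put $\hat B^{(1)}_j=\hat A^N_{N+j-1}$ and, for $r\ge2$, $\hat B^{(r)}_1=\hat A^{N-r+1}_{N-r+1}$ and $$\hat B^{(r)}_j=\frac{\Delta_{[N-r+j,\dots,N+j-1]}\sum_{s=N-r+2}^{N-r+j}\Delta_{[s;N-r+j+1,\dots,N+j-2]}}{\Delta_{[N-r+j+1,\dots,N+j-1]}\,\Delta_{[N-r+j,\dots,N+j-2]}},\qquad j\in[2,M-N+1].$$ **Theorem.** There is $\xi_0>1$, depending only on $\hat A$, such that for all $\xi>\xi_0$ the coefficients $\mathring B^{(r)}_l,b^{(r)}_n,\epsilon^{(r)}_j$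 with these properties exist, are unique, and do not depend on $k_1,\dots,k_M$; moreover $\epsilon^{(r)}_j=O(\xi^{-j})$. For all $k_1<\dots<k_M$ and $\xi>\xi_0$ the following holds. The curve $\Gamma$ is connected, at most two points of the sheets are glued to any given point, and its arithmetic genus (number of double points minus number of components plus one) is $N(M-N)$. $\Gamma_{\mathbb R}$ is the union of exactly $1+N(M-N)$ ovals, each homeomorphic to a circle; thus $\Gamma$ is a rational degeneration of an $\mathtt M$-curve of genus $N(M-N)$. Every double point lies on exactly two ovals, every other point of $\Gamma_{\mathbb R}$ on exactly one. The ovals are $\Omega_0$, which contains $P_0$ and all $Q_r$, $r\in[N]$, and $\Omega_{r,n}$, $r\in[N]$, $n\in[M-N]$, where 1. $\Omega_{1,n}\cap\Gamma_0=[k_{N+n-1},k_{N+n}]$, $\Omega_{1,n}\cap\Gamma_1=[\lambda^{(1)}_{n+1},\lambda^{(1)}_n]$, and $\Omega_{1,n}\cap\Gamma_j=\emptyset$ for $j\in[2,N]$; 2. for $r\in[2,N]$: $\Omega_{r,1}\cap\Gamma_0=[k_{N-r+1},k_{N-r+2}]$, $\Omega_{r,1}\cap\Gamma_{r-1}=[\lambda_1^{(r-1)},\alpha_2^{(r-1)}]$,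 $\Omega_{r,1}\cap\Gamma_r=[\lambda^{(r)}_2,\lambda^{(r)}_1]$, and $\Omega_{r,1}\cap\Gamma_j=\emptyset$ for the other $j$; 3. for $r\in[2,N]$, $n\in[2,M-N]$: $\Omega_{r,n}\cap\Gamma_{r-1}=[\alpha^{(r-1)}_n,\alpha^{(r-1)}_{n+1}]$, $\Omega_{r,n}\cap\Gamma_r=[\lambda^{(r)}_{n+1},\lambda^{(r)}_n]$, and $\Omega_{r,n}\cap\Gamma_j=\emptyset$ for the other $j$. The wave function satisfies: 1. $\Psi(P,\vec 0)=1$ for all $P\in\Gamma$ (removable singularities removed); 2. $\Psi=e^{\theta(\lambda,\vec t)}$ on $\Gamma_0$, with an essential singularity at $P_0$ for $\vec t\ne\vec0$; 3. in each finite oval $\Omega_{r,n}$, $\Psi(\cdot,\vec t)$ has exactly one simple pole $b^{(r)}_n=b^{(r)}_n(\xi)$, independent of $\vec t$, and exactly one simple zero $\chi^{(r)}_n=\chi^{(r)}_n(\xi;\vec t)$, in the sense that for every $\vec t$ the divisor of $\Psi(\cdot,\vec t)$ on $\Omega_{r,n}$ is $\chi^{(r)}_n-b^{(r)}_n$ (the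 two cancel when they coincide), and $b^{(r)}_n$ is a simple pole for some $\vec t$. Moreover $b^{(r)}_n$ and, for all $\vec t$, $\chi^{(r)}_n(\xi;\vec t)$ lie in $]\lambda_{n+1}^{(r)},\lambda_n^{(r)}[\,\subset\Gamma_r\cap\Omega_{r,n}$, and $\chi^{(r)}_n(\xi;\vec0)=b^{(r)}_n(\xi)$; 4. if $t_j=0$ for $j>j_0$ and $(t_1,\dots,t_{j_0})$ ranges in a compact set $K_0$, then as $\xi\to\infty$, uniformly on $K_0$, $$\chi^{(r)}_n(\xi;\vec t)=-\frac{\sum_{l=1}^n\hat B^{(r)}_lV^{(r)}_l(\vec t)}{\sum_{l=1}^{n+1}\hat B^{(r)}_lV^{(r)}_l(\vec t)}\,\xi^{2(n-1)}\bigl(1+O(\xi^{-1})\bigr)$$ $$=-\frac{\displaystyle\sum_{j=N-r+1}^{N-r+n}\frac{\Delta_{[j;N-r+n+1,\dots,N+n-1]}}{\Delta_{[N-r+n+1,\dots,N+n-1]}}e^{\theta_j}}{\displaystyle\sum_{j=N-r+1}^{N-r+n+1}\frac{\Delta_{[j;N-r+n+2,\dots,N+n]}}{\Delta_{[N-r+n+2,\dots,N+n]}}e^{\theta_j}}\,\xi^{2(n-1)}\bigl(1+O(\xi^{-1})\bigr).$$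 -/

import Mathlib

open Filter Topology

noncomputable section

namespace KPVacuum

/-! All indices of the mathematics are kept `1`-based: a matrix entry `A i j`, a phase `k j`, a marked
point `lam ξ l` etc. is only ever used for indices in the range stated with it. -/

/-! ### Times and phases -/

/-- A sequence of real times, `t i` being `t_{i+1}`, for which
`θ(λ, t) = ∑_{i ≥ 1} λ ^ i t_i` converges for all `λ`. -/
def Admissible (t : ℕ → ℝ) : Prop := ∀ x : ℝ, Summable fun i => x ^ (i + 1) * t i

/-- `θ(x, t) = ∑_{i ≥ 1} x ^ i t_i` for real `x`. -/
def theta (x : ℝ) (t : ℕ → ℝ) : ℝ := ∑' i, x ^ (i + 1) * t i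

/-- `θ(λ, t) = ∑_{i ≥ 1} λ ^ i t_i` for complex `λ`. -/
def thetaC (z : ℂ) (t : ℕ → ℝ) : ℂ := ∑' i, z ^ (i + 1) * (t i : ℂ)

/-- The sequence of times `(τ_1, …, τ_{j₀}, 0, 0, …)`. -/
def extendTimes {j₀ : ℕ} (τ : Fin j₀ → ℝ) (i : ℕ) : ℝ := if h : i < j₀ then τ ⟨i, h⟩ else 0

/-! ### Totally positive matrices in normalized banded form -/

/-- The `N × M` matrix `(A i j)`, `i ∈ [N]`, `j ∈ [M]`, is in banded form with row sums `1`, and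
represents a point of the totally positive Grassmannian: all its maximal minors are positive. -/
structure IsNormalizedBandedTP (N M : ℕ) (A : ℕ → ℕ → ℝ) : Prop where
  banded : ∀ i ∈ Finset.Icc 1 N, ∀ j ∈ Finset.Icc 1 M, (j < i ∨ M - N + i < j) → A i j = 0
  row_sum : ∀ i ∈ Finset.Icc 1 N, ∑ j ∈ Finset.Icc 1 M, A i j = 1
  minor_pos : ∀ c : Fin N → ℕ, StrictMono c → (∀ a, c a ∈ Finset.Icc 1 M) →
    0 < (Matrix.of fun a b : Fin N => A (a + 1) (c b)).det

/-- The minor `Δ_{[c 0, …, c (m - 1)]}` of the last `m` rows and the columns `c 0, …, c (m - 1)`. -/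
def lastMinor (N : ℕ) (A : ℕ → ℕ → ℝ) (m : ℕ) (c : ℕ → ℕ) : ℝ :=
  (Matrix.of fun a b : Fin m => A (N - m + 1 + a) (c b)).det

/-- `Δ_{[p, p + 1, …, p + m - 1]}`. -/
def minorFrom (N : ℕ) (A : ℕ → ℕ → ℝ) (m p : ℕ) : ℝ := lastMinor N A m fun b => p + b

/-- `Δ_{[j; p, p + 1, …, p + m - 2]}`. -/
def minorJump (N : ℕ) (A : ℕ → ℕ → ℝ) (m j p : ℕ) : ℝ :=
  lastMinor N A m fun b => if b = 0 then j else p + b - 1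

/-- The coefficients `B̂^{(r)}_j`, `r ∈ [N]`, `j ∈ [M - N + 1]`. -/
def Bhat (N : ℕ) (A : ℕ → ℕ → ℝ) (r j : ℕ) : ℝ :=
  if r = 1 then A N (N + j - 1)
  else if j = 1 then A (N - r + 1) (N - r + 1)
  else
    minorFrom N A r (N - r + j) *
        (∑ s ∈ Finset.Icc (N - r + 2) (N - r + j), minorJump N A (r - 1) s (N - r + j + 1)) /
      (minorFrom N A (r - 1) (N - r + j + 1) * minorFrom N A (r - 1) (N - r + j))

/-- `∑_{j = N - r + 1}^{N - r + n} Δ_{[j; N-r+n+1, …, N+n-1]} / Δ_{[N-r+n+1, …, N+n-1]} e^{θ_j(t)}`. -/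
def minorSum (N : ℕ) (A : ℕ → ℕ → ℝ) (k : ℕ → ℝ) (r n : ℕ) (t : ℕ → ℝ) : ℝ :=
  ∑ j ∈ Finset.Icc (N - r + 1) (N - r + n),
    minorJump N A r j (N - r + n + 1) / minorFrom N A (r - 1) (N - r + n + 1) *
      Real.exp (theta (k j) t)

/-! ### The curve -/

/-- The marked points `λ_1 = 0`, `λ_l = -ξ ^ (2 (l - 2))`, `l ∈ [2, M - N + 1]`. -/
def lam (ξ : ℝ) (l : ℕ) : ℝ := if l = 1 then 0 else -ξ ^ (2 * (l - 2))

/-- The marked points `α_s = ξ ^ (2 s - 5)`, `s ∈ [2, M - N + 1]`. -/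
def alpha (ξ : ℝ) (s : ℕ) : ℝ := ξ ^ (2 * (s : ℤ) - 5)

/-- The gluing rules; the pair `(r, x)` is the real point `x` of the sheet `Γ_r`. -/
inductive Glue (N M : ℕ) (k : ℕ → ℝ) (ξ : ℝ) : ℕ × ℝ → ℕ × ℝ → Prop
  | base (l : ℕ) (h₁ : 1 ≤ l) (h₂ : l ≤ M - N + 1) :
      Glue N M k ξ (1, lam ξ l) (0, k (N + l - 1))
  | first (r : ℕ) (h₁ : 2 ≤ r) (h₂ : r ≤ N) :
      Glue N M k ξ (r, lam ξ 1) (0, k (N - r + 1))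
  | chain (r l : ℕ) (h₁ : 2 ≤ r) (h₂ : r ≤ N) (h₃ : 2 ≤ l) (h₄ : l ≤ M - N + 1) :
      Glue N M k ξ (r, lam ξ l) (r - 1, alpha ξ l)

/-- The disjoint union of the `N + 1` copies `Γ_0, …, Γ_N` of the Riemann sphere. -/
abbrev Sheets (N : ℕ) : Type := Fin (N + 1) × OnePoint ℂ

/-- The identifications made on the disjoint union of the sheets. -/
def Identified (N M : ℕ) (k : ℕ → ℝ) (ξ : ℝ) (x y : Sheets N) : Prop :=
  ∃ a b : ℝ, Glue N M k ξ (x.1, a) (y.1, b) ∧ x.2 = ((a : ℂ) : OnePoint ℂ) ∧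
    y.2 = ((b : ℂ) : OnePoint ℂ)

/-- The rational curve `Γ`: the sheets, glued at pairs of marked real points. -/
def Curve (N M : ℕ) (k : ℕ → ℝ) (ξ : ℝ) : Type := Quot (Identified N M k ξ)

instance (N M : ℕ) (k : ℕ → ℝ) (ξ : ℝ) : TopologicalSpace (Curve N M k ξ) :=
  inferInstanceAs (TopologicalSpace (Quot (Identified N M k ξ)))

section
variable (N M : ℕ) (k : ℕ → ℝ) (ξ : ℝ)

/-- The point of `Γ` given by the point `z` of the sheet `Γ_r`, for `r ≤ N`. -/
def pt (r : ℕ) (z : OnePoint ℂ) : Curve N M k ξ := Quot.mk _ (Fin.ofNat (N + 1) r, z)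

/-- The sheet `Γ_r` as a subset of `Γ`, for `r ≤ N`. -/
def sheet (r : ℕ) : Set (Curve N M k ξ) := Set.range (pt N M k ξ r)

/-- The antiholomorphic involution of `Γ`: complex conjugation on each sheet. -/
def conjCurve : Curve N M k ξ → Curve N M k ξ :=
  Quot.map (fun x => (x.1, OnePoint.map (starRingEnd ℂ) x.2)) (by
    rintro ⟨i, x⟩ ⟨j, y⟩ ⟨a, b, h, hx, hy⟩
    refine ⟨a, b, h, ?_, ?_⟩
    · simp only at hx
      simp [hx]
    · simp only at hy
      simp [hy])

/-- The real part of `Γ`: the fixed points of the involution. -/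
def realPart : Set (Curve N M k ξ) := {P | conjCurve N M k ξ P = P}

/-- The points of the sheets that represent `P`. -/
def fiber (P : Curve N M k ξ) : Set (Sheets N) := {x | Quot.mk _ x = P}

/-- The double points of `Γ`: two distinct points of the sheets are glued there. -/
def doublePoints : Set (Curve N M k ξ) := {P | (fiber N M k ξ P).encard = 2}

/-- The arithmetic genus of a connected curve with only ordinary double points whose `N + 1`
components are rational: the number of double points minus the number of components plus one. -/
def arithmeticGenus : ℤ := ((doublePoints N M k ξ).ncard : ℤ) - (N + 1) + 1

/-- The closed interval `[a, b]` of the real line in the Riemann sphere. -/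
def interval (a b : ℝ) : Set (OnePoint ℂ) := (fun x : ℝ => ((x : ℂ) : OnePoint ℂ)) '' Set.Icc a b

/-- The closed arc of the real circle `ℝ ∪ {∞}` that runs from `a` to `b` in the direction of
increasing `λ`, through `∞` if `b ≤ a`. -/
def arc (a b : ℝ) : Set (OnePoint ℂ) :=
  if a < b then interval a b
  else insert OnePoint.infty
    ((fun x : ℝ => ((x : ℂ) : OnePoint ℂ)) '' (Set.Ici a ∪ Set.Iic b))

/-- The points `p` and `q` of the sheets are glued to each other. -/
def Glued (p q : ℕ × ℝ) : Prop := Glue N M k ξ p q ∨ Glue N M k ξ q p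

/-- The point `p` of the sheets is glued to another one. -/
def Marked (p : ℕ × ℝ) : Prop := ∃ q, Glued N M k ξ p q

/-- `b` is the marked point of `Γ_r` that follows the marked point `a` on the real circle of `Γ_r`,
in the direction of increasing `λ`. -/
def Consecutive (r : ℕ) (a b : ℝ) : Prop :=
  Marked N M k ξ (r, a) ∧ Marked N M k ξ (r, b) ∧ a ≠ b ∧
    ∀ c : ℝ, Marked N M k ξ (r, c) → ((c : ℂ) : OnePoint ℂ) ∈ arc a b → c = a ∨ c = b

/-- One step along an oval: follow the real circle of a sheet, in the positive direction (as the
boundary of the upper half plane), from the marked point `p` to the next one; there pass to the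
other sheet of that double point. (Smoothing each double point `(λ - a) (μ - b) = 0` to
`(λ - a) (μ - b) = -δ ^ 2` joins the upper half planes of the sheets with each other; the ovals are
the limits of the boundary components of the resulting surface.) -/
def Step (p q : ℕ × ℝ) : Prop := ∃ b : ℝ, Consecutive N M k ξ p.1 p.2 b ∧ Glued N M k ξ (p.1, b) q

/-- The union of the arcs that are run through, starting from the marked point `p`. -/
def ovalFrom (p : ℕ × ℝ) : Set (Curve N M k ξ) :=
  {P | ∃ (q : ℕ × ℝ) (b : ℝ), Relation.ReflTransGen (Step N M k ξ) p q ∧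
    Consecutive N M k ξ q.1 q.2 b ∧ P ∈ pt N M k ξ q.1 '' arc q.2 b}

/-- The real ovals of `Γ`. -/
def ovals : Set (Set (Curve N M k ξ)) := {S | ∃ p, Marked N M k ξ p ∧ S = ovalFrom N M k ξ p}

/-- `Γ` is a connected rational curve with at most ordinary double points which is a degeneration of
an `M`-curve of genus `g`: its arithmetic genus is `g`, and its real part is the union of `g + 1`
ovals, each of them homeomorphic to a circle. -/
structure IsRationalMCurve (g : ℕ) : Prop where
  connected : ConnectedSpace (Curve N M k ξ)
  nodal : ∀ P, (fiber N M k ξ P).encard ≤ 2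
  genus : arithmeticGenus N M k ξ = g
  real : ⋃₀ ovals N M k ξ = realPart N M k ξ
  card : (ovals N M k ξ).encard = g + 1
  circle : ∀ S ∈ ovals N M k ξ, Nonempty (S ≃ₜ Circle)

end

/-! ### The vacuum wave function -/

/-- The parameters of the wave function: the coefficients `B̊^{(r)}_l`, the poles `b^{(r)}_n` and
the numbers `ε^{(r)}_j`. -/
structure Data where
  B : ℕ → ℕ → ℝ
  b : ℕ → ℕ → ℝ
  ε : ℕ → ℕ → ℝ

/-- `B_l ∏_{j ∈ [d + 1], j ≠ l} (z - λ_j) / ∏_{n ∈ [d]} (z - b_n)`. -/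
def term {K : Type*} [Field K] (d : ℕ) (B lm b : ℕ → K) (l : ℕ) (z : K) : K :=
  B l * (∏ j ∈ (Finset.Icc 1 (d + 1)).erase l, (z - lm j)) / ∏ n ∈ Finset.Icc 1 d, (z - b n)

section
variable (N M : ℕ) (k : ℕ → ℝ) (ξ : ℝ) (W : Data)

/-- The functions `V^{(r)}_l(t)`, `r ∈ [N]`, `l ∈ [M - N + 1]`: the values of the wave function on
the previous sheets at the points that are glued to `λ_l ∈ Γ_r`. That is,
`V^{(1)}_l = e^{θ_{N + l - 1}}`, and for `r ≥ 2`, `V^{(r)}_1 = e^{θ_{N - r + 1}}` and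
`V^{(r)}_l = Ψ^{(r - 1)}(α_l, t)` for `l ≥ 2`. -/
def V : ℕ → ℕ → (ℕ → ℝ) → ℝ
  | 0, _, _ => 0
  | 1, l, t => Real.exp (theta (k (N + l - 1)) t)
  | r + 2, l, t =>
    if l = 1 then Real.exp (theta (k (N - (r + 2) + 1)) t)
    else ∑ m ∈ Finset.Icc 1 (M - N + 1),
      term (M - N) (W.B (r + 1)) (lam ξ) (W.b (r + 1)) m (alpha ξ l) * V (r + 1) m t

/-- The wave function `Ψ^{(r)}(λ, t)` on the sheet `Γ_r`, in the coordinate `λ ∈ ℂ`. -/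
def psi (r : ℕ) (t : ℕ → ℝ) (z : ℂ) : ℂ :=
  if r = 0 then Complex.exp (thetaC z t)
  else ∑ l ∈ Finset.Icc 1 (M - N + 1),
    term (M - N) (fun j => (W.B r j : ℂ)) (fun j => (lam ξ j : ℂ)) (fun n => (W.b r n : ℂ)) l z *
      (V N M k ξ W r l t : ℂ)

/-- The value prescribed for the wave function at the infinity point `Q_r` of `Γ_r`, namely
`(f^{(r)} + ∑_{j ∈ [r - 1]} ε_j^{(r)} f^{(r - j)}) / (1 + ∑_{j ∈ [r - 1]} ε_j^{(r)})` with
`f^{(i)}(t) = ∑_{s ∈ [M]} A^{N - i + 1}_s e^{θ_s(t)}`. -/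
def valueAtInfty (A : ℕ → ℕ → ℝ) (r : ℕ) (t : ℕ → ℝ) : ℝ :=
  (∑ s ∈ Finset.Icc 1 M,
      (A (N - r + 1) s + ∑ j ∈ Finset.Icc 1 (r - 1), W.ε r j * A (N - r + 1 + j) s) *
        Real.exp (theta (k s) t)) /
    (1 + ∑ j ∈ Finset.Icc 1 (r - 1), W.ε r j)

/-- The parameters `W` define a vacuum wave function on `Γ`: its poles lie in the open intervals
`]λ_{n+1}, λ_n[`, the `ε`'s are positive, its values at glued points agree at all times, and it has
the prescribed values at the points `Q_r`. -/
structure IsVacuum (A : ℕ → ℕ → ℝ) : Prop where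
  pole_mem : ∀ r ∈ Finset.Icc 1 N, ∀ n ∈ Finset.Icc 1 (M - N),
    W.b r n ∈ Set.Ioo (lam ξ (n + 1)) (lam ξ n)
  eps_pos : ∀ r ∈ Finset.Icc 1 N, ∀ j ∈ Finset.Icc 1 (r - 1), 0 < W.ε r j
  glue : ∀ p q : ℕ × ℝ, Glue N M k ξ p q → ∀ t, Admissible t →
    psi N M k ξ W p.1 t (p.2 : ℂ) = psi N M k ξ W q.1 t (q.2 : ℂ)
  infty : ∀ r ∈ Finset.Icc 1 N, ∀ t, Admissible t →
    Tendsto (psi N M k ξ W r t) (cocompact ℂ) (𝓝 (valueAtInfty N M k W A r t : ℂ))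

end

/-- Equality of the parameters that enter the wave function. -/
def Data.Agree (N M : ℕ) (W W' : Data) : Prop :=
  ∀ r ∈ Finset.Icc 1 N,
    (∀ l ∈ Finset.Icc 1 (M - N + 1), W.B r l = W'.B r l) ∧
    (∀ n ∈ Finset.Icc 1 (M - N), W.b r n = W'.b r n) ∧
    (∀ j ∈ Finset.Icc 1 (r - 1), W.ε r j = W'.ε r j)

/-- The value at the point `z` of the Riemann sphere of a function `f` of `λ ∈ ℂ`, after the
removal of a removable singularity, is `w`. -/
def HasValueAt (f : ℂ → ℂ) (z : OnePoint ℂ) (w : ℂ) : Prop :=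
  Tendsto f (comap (fun x : ℂ => (x : OnePoint ℂ)) (𝓝[≠] z)) (𝓝 w)

end KPVacuum

end

noncomputable section

namespace KPVacuum

section

/-! ### Minors of a totally positive banded matrix -/

/-! Write `d = M - N`. The construction rests on the coefficients `vcoef` of the exponentials in the
`V^{(r)}_l`; they do not involve the phases, so the parameters built from them do not either.
Agreement at the nodes at time zero forces the denominator on `Γ_r` to be the node polynomial `∑_l
B_l ∏_{j ≠ l} (λ - λ_j)`. Hence `Ψ^{(r)}(λ)` is the mean of the `V^{(r)}_l` with weights
proportional to `B_l / (λ - λ_l)`. The exponentials are linearly independent, so the condition at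
`Q_r`, multiplied by `1 + ∑ ε`, is a square linear system for `(1 + ∑ ε) B` and `ε`
(`isLevelSol_iff`). Existence and uniqueness follow sheet by sheet (`isVacuum_vacuumData`,
`IsVacuum.agree`).

Solvability and positivity come from `ξ → ∞`. On a logarithmic scale `α_l` lies strictly between
`|λ_{l-1}|` and `|λ_l|`, so in the limit the mean at `α_l` retains only the `V_m` with `m < l`
(`asy_weight`). A three-term Plücker relation identifies the limits of the partial sums `∑_{l ≤ n}
B_l V_l` with quotients of minors (`Bhat_mul_vlim`). The limiting system is triangular, its diagonal
is nonzero by total positivity, and its solution is `B̂` with `ε = 0`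
(`det_levelMatrix_vlim_ne_zero`, `isLevelSol_Bhat`). Cramer's rule transfers this to large `ξ` with
error `O(ξ⁻¹)`. Positivity of the `ε` is invisible in the limit; it is read off from the leading
powers of the coefficients (`asy_pow_mul_vcoef`) by solving the last `r - 1` equations backwards
(`asy_pow_mul_coefEps`).

Since the `B` and `V` are positive, the numerator and the denominator of `Ψ^{(r)}` are node
polynomials with alternating signs at the nodes, so each has one root in every gap
(`exists_interlaced`). For widely spaced nodes a root `-y |λ_{n+1}|` nearly satisfies `p / y =
a_{n+1} / (1 - y)` with `p = a_1 + … + a_n`, that is `y = p / (p + a_{n+1})`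
(`abs_root_mul_sub_le`).

For the curve, the marked points of each sheet are listed in increasing order (`marked_iff`), and
every marked point starts an arc of an explicit closed chain of arcs on pairwise different sheets
(`marked_cases`). In the Hausdorff quotient such a chain is a simple closed curve. Counting the
chains gives `1 + N d` ovals, and counting the gluings gives the genus. -/

lemma lastMinor_zero (N : ℕ) (A : ℕ → ℕ → ℝ) (c : ℕ → ℕ) : lastMinor N A 0 c = 1 := by
  simp [lastMinor]

/-- Laplace expansion along a first column whose only possibly nonzero entry is the top one.
Bandedness provides such columns, and `lastMinor_succ_of_row` is the analogue for the top row. -/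
lemma lastMinor_succ_of_column {N m : ℕ} {A : ℕ → ℕ → ℝ} {c : ℕ → ℕ} (hm : m + 1 ≤ N)
    (h : ∀ a < m, A (N - m + 1 + a) (c 0) = 0) :
    lastMinor N A (m + 1) c = A (N - m) (c 0) * lastMinor N A m fun b => c (b + 1) := by
  have e0 : N - (m + 1) + 1 = N - m := by omega
  have e : ∀ a : ℕ, N - (m + 1) + 1 + (a + 1) = N - m + 1 + a := by intro a; omega
  unfold lastMinor
  rw [Matrix.det_succ_column_zero, Fin.sum_univ_succ, Finset.sum_eq_zero]
  · simp only [Fin.val_zero, pow_zero, Matrix.of_apply, add_zero, one_mul, e0]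
    congr 2
    ext a b
    simp [add_comm, add_left_comm]
  · intro a _
    have := h a a.2
    simp only [Matrix.of_apply, Fin.val_succ, Fin.val_zero, e, this]
    simp

lemma lastMinor_succ_of_row {N m : ℕ} {A : ℕ → ℕ → ℝ} {c : ℕ → ℕ} (hm : m + 1 ≤ N)
    (h : ∀ b < m, A (N - m) (c (b + 1)) = 0) :
    lastMinor N A (m + 1) c = A (N - m) (c 0) * lastMinor N A m fun b => c (b + 1) := by
  have e0 : N - (m + 1) + 1 = N - m := by omega
  unfold lastMinor
  rw [Matrix.det_succ_row_zero, Fin.sum_univ_succ, Finset.sum_eq_zero]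
  · simp only [Fin.val_zero, pow_zero, Matrix.of_apply, add_zero, one_mul, e0]
    congr 2
    ext a b
    simp [add_comm, add_left_comm]
  · intro b _
    have := h b b.2
    simp only [Matrix.of_apply, Fin.val_succ, Fin.val_zero, add_zero, e0, this]
    simp

lemma lastMinor_eq_zero_of_eq {N m : ℕ} {A : ℕ → ℕ → ℝ} {c : ℕ → ℕ} {i j : ℕ} (hi : i < m)
    (hj : j < m) (hij : i ≠ j) (h : c i = c j) : lastMinor N A m c = 0 := by
  unfold lastMinor
  refine Matrix.det_zero_of_column_eq (i := ⟨i, hi⟩) (j := ⟨j, hj⟩) (by simpa using hij) ?_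
  intro a
  simp [h]

/-- Moving the last row of a matrix to the top changes the determinant by `(-1) ^ n`. -/
lemma det_rotate_rows {n : ℕ} (w : ℕ → Fin (n + 1) → ℝ) :
    Matrix.det (fun b : Fin (n + 1) => if (b : ℕ) = 0 then w n else w (b - 1)) =
      (-1) ^ n * Matrix.det (fun b : Fin (n + 1) => w b) := by
  set M' : Matrix (Fin (n + 1)) (Fin (n + 1)) ℝ :=
    fun b : Fin (n + 1) => if (b : ℕ) = 0 then w n else w (b - 1) with hM'
  -- The cyclic permutation of `n + 1` rows has sign `(-1) ^ n`.
  have h1 : M'.submatrix (finRotate (n + 1)) id = fun b : Fin (n + 1) => w b := by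
    ext b a
    change (if ((finRotate (n + 1) b : Fin (n + 1)) : ℕ) = 0 then w n
      else w ((finRotate (n + 1) b : Fin (n + 1)) - 1)) a = w b a
    rcases Fin.eq_castSucc_or_eq_last b with ⟨j, rfl⟩ | rfl
    · have : finRotate (n + 1) j.castSucc = j.succ := by simp
      simp [this]
    · simp
  rw [← h1, Matrix.det_permute, sign_finRotate]
  rw [← mul_assoc]
  push_cast
  rw [← mul_pow]
  simp

/-- A three-term Plücker relation between minors of sizes `m + 2` and `m + 1`. -/
lemma det_three_term {m : ℕ} (u : ℕ → Fin (m + 2) → ℝ) (v : Fin (m + 2) → ℝ)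
    (hu : Matrix.det (fun b : Fin (m + 2) => u b) ≠ 0) :
    Matrix.det (fun b : Fin (m + 2) => if (b : ℕ) = 0 then v else u b) *
        Matrix.det (fun b : Fin (m + 1) => Fin.tail (u b)) -
      Matrix.det (fun b : Fin (m + 2) => if (b : ℕ) = 0 then v else u (b - 1)) *
        Matrix.det (fun b : Fin (m + 1) => Fin.tail (u (b + 1))) =
    Matrix.det (fun b : Fin (m + 2) => u b) *
      Matrix.det (fun b : Fin (m + 1) => if (b : ℕ) = 0 then Fin.tail v else Fin.tail (u b)) := by
  classical
  have key : ∀ {n : ℕ} (w : Fin (n + 1) → Fin (n + 1) → ℝ), ∃ L : (Fin (n + 1) → ℝ) →ₗ[ℝ] ℝ,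
      ∀ x, L x = Matrix.det (fun b : Fin (n + 1) => if (b : ℕ) = 0 then x else w b) := by
    intro n w
    refine ⟨(Matrix.detRowAlternating (n := Fin (n + 1)) (R := ℝ)).toMultilinearMap.toLinearMap
      w 0, fun x => ?_⟩
    simp only [MultilinearMap.toLinearMap_apply]
    change Matrix.det (Function.update w 0 x) = _
    congr 1
    ext b a
    by_cases hb : b = 0
    · subst hb; simp
    · have hb' : (b : ℕ) ≠ 0 := fun h => hb (Fin.ext h)
      simp [hb, hb']
  obtain ⟨L1, h1⟩ := key (fun b : Fin (m + 2) => u b)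
  obtain ⟨L2, h2⟩ := key (fun b : Fin (m + 2) => u (b - 1))
  obtain ⟨L3, h3⟩ := key (fun b : Fin (m + 1) => Fin.tail (u b))
  let T : (Fin (m + 2) → ℝ) →ₗ[ℝ] (Fin (m + 1) → ℝ) := LinearMap.funLeft ℝ ℝ Fin.succ
  have hT : ∀ x, T x = Fin.tail x := fun x => rfl
  -- Both sides are linear in `v`, so it suffices to test their difference on the basis formed by
  -- the rows `u 0, …, u (m + 1)`.
  let φ : (Fin (m + 2) → ℝ) →ₗ[ℝ] ℝ :=
    Matrix.det (fun b : Fin (m + 1) => Fin.tail (u b)) • L1 -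
      Matrix.det (fun b : Fin (m + 1) => Fin.tail (u (b + 1))) • L2 -
      Matrix.det (fun b : Fin (m + 2) => u b) • (L3 ∘ₗ T)
  have hφ : φ = 0 := by
    have hli : LinearIndependent ℝ (fun b : Fin (m + 2) => u b) := by
      have := (Matrix.linearIndependent_rows_iff_isUnit
        (A := (fun b : Fin (m + 2) => u b : Matrix (Fin (m + 2)) (Fin (m + 2)) ℝ))).2
        ((Matrix.isUnit_iff_isUnit_det _).2 (isUnit_iff_ne_zero.2 hu))
      exact this
    have hsp := hli.span_eq_top_of_card_eq_finrank (by simp)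
    refine LinearMap.ext_on hsp ?_
    rintro _ ⟨i, rfl⟩
    simp only [φ, LinearMap.sub_apply, LinearMap.smul_apply, LinearMap.comp_apply, hT, h1, h2, h3,
      smul_eq_mul, LinearMap.zero_apply]
    have z : ∀ {n : ℕ} (w : ℕ → Fin (n + 1) → ℝ) (x : Fin (n + 1) → ℝ) (j : ℕ), 1 ≤ j → j ≤ n →
        x = w j → Matrix.det (fun b : Fin (n + 1) => if (b : ℕ) = 0 then x else w b) = 0 := by
      intro n w x j hj hjn hx
      refine Matrix.det_zero_of_row_eq (i := 0) (j := ⟨j, by omega⟩) ?_ ?_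
      · intro h
        have := congrArg Fin.val h
        simp at this
        omega
      · have : j ≠ 0 := by omega
        simp [this, hx]
    -- For `v = u 0` the second determinant has a repeated row, and the other two products coincide.
    -- For `v = u i` with `1 ≤ i ≤ m` all terms vanish.
    by_cases hi0 : (i : ℕ) = 0
    · rw [z (fun b => u (b - 1)) (u i) 1 le_rfl (by omega) (by simp [hi0])]
      have e1 : (fun b : Fin (m + 2) => if (b : ℕ) = 0 then u i else u b) =
          fun b : Fin (m + 2) => u b := by
        ext b a
        by_cases hb : (b : ℕ) = 0 <;> simp [hb, hi0]
      have e2 : (fun b : Fin (m + 1) => if (b : ℕ) = 0 then Fin.tail (u i) else Fin.tail (u b)) =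
          fun b : Fin (m + 1) => Fin.tail (u b) := by
        ext b a
        by_cases hb : (b : ℕ) = 0 <;> simp [hb, hi0]
      rw [e1, e2]
      ring
    · rw [z (fun b => u b) (u i) i (by omega) (by omega) rfl]
      by_cases him : (i : ℕ) ≤ m
      · rw [z (fun b => u (b - 1)) (u i) (i + 1) (by omega) (by omega) (by simp),
          z (fun b => Fin.tail (u b)) (Fin.tail (u i)) i (by omega) (by omega) rfl]
        ring
      -- For the last basis vector the two surviving determinants are cyclic rotations of the
      -- standard ones; their signs `(-1) ^ (m + 1)` and `(-1) ^ m` match the minus sign of the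
      -- relation.
      · have hi : (i : ℕ) = m + 1 := by omega
        have r1 := det_rotate_rows (n := m + 1) u
        have r2 := det_rotate_rows (n := m) (fun b => Fin.tail (u (b + 1)))
        have e2 : (fun b : Fin (m + 1) => if (b : ℕ) = 0 then Fin.tail (u (m + 1))
            else Fin.tail (u b)) =
            fun b : Fin (m + 1) => if (b : ℕ) = 0 then Fin.tail (u (m + 1))
              else Fin.tail (u (b - 1 + 1)) := by
          ext b a
          by_cases hb : (b : ℕ) = 0
          · simp [hb]
          · simp [hb, Nat.sub_add_cancel (Nat.pos_of_ne_zero hb)]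
        rw [hi, r1, e2, r2]
        ring
  have := LinearMap.congr_fun hφ v
  simp only [φ, LinearMap.sub_apply, LinearMap.smul_apply, LinearMap.comp_apply, hT, h1, h2, h3,
    smul_eq_mul, LinearMap.zero_apply] at this
  linarith

lemma lastMinor_eq_det (N : ℕ) (A : ℕ → ℕ → ℝ) (m : ℕ) (c : ℕ → ℕ) :
    lastMinor N A m c = Matrix.det (fun b a : Fin m => A (N - m + 1 + a) (c b)) := by
  unfold lastMinor
  rw [← Matrix.det_transpose]
  rfl

/-- Instance of `det_three_term`: the `u b` are the columns `p + b` of the last `m + 2` rows and `v`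
is the column `j`. Dropping the first coordinate passes to the last `m + 1` rows. -/
lemma minor_three_term {N m p j : ℕ} {A : ℕ → ℕ → ℝ} (hm : m + 2 ≤ N)
    (h : minorFrom N A (m + 2) p ≠ 0) :
    minorJump N A (m + 2) j (p + 1) * minorFrom N A (m + 1) p -
      minorJump N A (m + 2) j p * minorFrom N A (m + 1) (p + 1) =
    minorFrom N A (m + 2) p * minorJump N A (m + 1) j (p + 1) := by
  have e : ∀ a : ℕ, N - (m + 2) + 1 + (a + 1) = N - (m + 1) + 1 + a := by intro a; omega
  unfold minorFrom minorJump at *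
  simp only [lastMinor_eq_det] at *
  have := det_three_term (fun (b : ℕ) (a : Fin (m + 2)) => A (N - (m + 2) + 1 + a) (p + b))
    (fun a : Fin (m + 2) => A (N - (m + 2) + 1 + a) j) h
  have t : ∀ c : ℕ, (Fin.tail fun a : Fin (m + 2) => A (N - (m + 2) + 1 + a) c) =
      fun a : Fin (m + 1) => A (N - (m + 1) + 1 + a) c := by
    intro c
    ext a
    simp [Fin.tail, e]
  simp only [t] at this
  convert this using 3
  · congr 1; ext b a; by_cases hb : (b : ℕ) = 0 <;> simp [hb, add_right_comm]
  · congr 1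
    ext b a
    by_cases hb : (b : ℕ) = 0
    · simp [hb]
    · simp only [hb, if_false]
      rw [Nat.add_sub_assoc (Nat.pos_of_ne_zero hb)]
  · congr 1; ext b a; congr 1; omega
  · congr 1; ext b a; by_cases hb : (b : ℕ) = 0 <;> simp [hb, add_right_comm]

end

/-! ### Positivity of the entries and of the minors of the last rows -/

section

variable {N d : ℕ} {A : ℕ → ℕ → ℝ}

lemma IsNormalizedBandedTP.apply_eq_zero (hA : IsNormalizedBandedTP N (N + d) A) {i j : ℕ}
    (hi : i ∈ Finset.Icc 1 N) (hj : j ∈ Finset.Icc 1 (N + d)) (h : j < i ∨ d + i < j) :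
    A i j = 0 := by
  refine hA.banded i hi j hj ?_
  rwa [Nat.add_sub_cancel_left]

/-- The minors of the last `m` rows are positive, and so are the entries of these rows. -/
lemma IsNormalizedBandedTP.lastMinor_pos_aux (hA : IsNormalizedBandedTP N (N + d) A) (q : ℕ)
    (hq : q ≤ N) :
    (∀ c : ℕ → ℕ, (∀ a b, a < b → b < N - q → c a < c b) →
      (∀ b < N - q, q + 1 ≤ c b ∧ c b ≤ N + d) → 0 < lastMinor N A (N - q) c) ∧
    (∀ i ∈ Finset.Icc 1 q, ∀ j ∈ Finset.Icc i (i + d), 0 < A i j) := by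
  induction q with
  | zero =>
    refine ⟨fun c hc hc' => ?_, by simp⟩
    have := hA.minor_pos (fun a => c a) (fun a b hab => hc a b hab b.2)
      (fun a => Finset.mem_Icc.2 (hc' a a.2))
    unfold lastMinor
    have e : ∀ a, N - (N - 0) + 1 + a = a + 1 := by intro a; omega
    simp only [e]
    exact this
  | succ q ih =>
    obtain ⟨ih1, ih2⟩ := ih (by omega)
    obtain ⟨m, hm⟩ : ∃ m, N - q = m + 1 := ⟨N - q - 1, by omega⟩
    have hm' : N - (q + 1) = m := by omega
    have hNm : N - m = q + 1 := by omega
    rw [hm] at ih1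
    rw [hm']
    have hq1 : q + 1 ∈ Finset.Icc 1 N := by simp; omega
    set i := q + 1 with hi
    -- Column `i` is put in front: below row `i` it vanishes by bandedness, so the larger minor
    -- factors.
    have h1 : ∀ c : ℕ → ℕ, (∀ a b, a < b → b < m → c a < c b) →
        (∀ b < m, i + 1 ≤ c b ∧ c b ≤ N + d) → 0 < A i i * lastMinor N A m c := by
      intro c hc hc'
      have h := ih1 (fun b => if b = 0 then i else c (b - 1)) ?_ ?_
      · rw [lastMinor_succ_of_column (by omega)] at h
        · simpa [hNm] using h
        · intro a ha
          refine hA.apply_eq_zero ?_ ?_ ?_ <;> (try simp) <;> omega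
      · intro a b hab hb
        have hb0 : b ≠ 0 := by omega
        by_cases ha : a = 0
        · have := hc' (b - 1) (by omega)
          simp [ha, hb0]; omega
        · have := hc (a - 1) (b - 1) (by omega) (by omega)
          simpa [ha, hb0] using this
      · intro b hb
        by_cases hb0 : b = 0
        · simp [hb0]; omega
        · have := hc' (b - 1) (by omega)
          simp [hb0]; omega
    -- The columns after `j` are chosen beyond the band of row `i`, so the top row contributes only
    -- `A i j`.
    have h2 : ∀ j ∈ Finset.Icc i (i + d),
        0 < A i j * lastMinor N A m fun b => i + d + (b + 1) := by
      intro j hj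
      rw [Finset.mem_Icc] at hj
      have h := ih1 (fun b => if b = 0 then j else i + d + b) ?_ ?_
      · rw [lastMinor_succ_of_row (by omega)] at h
        · simpa [hNm] using h
        · intro b hb
          refine hA.apply_eq_zero ?_ ?_ ?_ <;> (try simp) <;> omega
      · intro a b hab hb
        have hb0 : b ≠ 0 := by omega
        by_cases ha : a = 0
        · simp [ha, hb0]; omega
        · simp [ha, hb0]; omega
      · intro b hb
        by_cases hb0 : b = 0
        · simp [hb0]; omega
        · simp [hb0]; omega
    have hsum : ∑ j ∈ Finset.Icc i (i + d), A i j = 1 := by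
      rw [← hA.row_sum i hq1]
      refine Finset.sum_subset ?_ ?_
      · intro j hj
        simp only [Finset.mem_Icc] at *
        omega
      · intro j hj hj'
        refine hA.apply_eq_zero hq1 hj ?_
        simp only [Finset.mem_Icc] at *
        omega
    -- All entries of row `i` in the band have the sign of one fixed minor. The row sum `1` makes
    -- that sign positive; then the entries are positive, and `h1` can be divided by `A i i`.
    have hL : 0 < lastMinor N A m fun b => i + d + (b + 1) := by
      have := Finset.sum_pos h2 ⟨i, by simp⟩
      rwa [← Finset.sum_mul, hsum, one_mul] at this
    have hA' : ∀ j ∈ Finset.Icc i (i + d), 0 < A i j := fun j hj =>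
      (pos_iff_pos_of_mul_pos (h2 j hj)).2 hL
    refine ⟨fun c hc hc' => (pos_iff_pos_of_mul_pos (h1 c hc hc')).1 (hA' i (by simp)), ?_⟩
    intro i' hi' j hj
    rcases Nat.lt_or_ge i' i with h | h
    · exact ih2 i' (by simp at *; omega) j hj
    · have : i' = i := by simp at hi'; omega
      subst this
      exact hA' j hj

lemma IsNormalizedBandedTP.lastMinor_pos (hA : IsNormalizedBandedTP N (N + d) A) {m : ℕ}
    (hm : m ≤ N) {c : ℕ → ℕ} (hc : ∀ a b, a < b → b < m → c a < c b)
    (hc' : ∀ b < m, N - m + 1 ≤ c b ∧ c b ≤ N + d) : 0 < lastMinor N A m c := by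
  have := (hA.lastMinor_pos_aux (N - m) (by omega)).1 c
  rw [Nat.sub_sub_self hm] at this
  exact this hc hc'

lemma IsNormalizedBandedTP.apply_pos (hA : IsNormalizedBandedTP N (N + d) A) {i j : ℕ}
    (hi : i ∈ Finset.Icc 1 N) (hij : i ≤ j) (hj : j ≤ i + d) : 0 < A i j :=
  (hA.lastMinor_pos_aux N le_rfl).2 i hi j (by simp [hij, hj])

lemma IsNormalizedBandedTP.minorFrom_pos (hA : IsNormalizedBandedTP N (N + d) A) {m p : ℕ}
    (hm : m ≤ N) (hp : N - m + 1 ≤ p) (hp' : p + m ≤ N + d + 1) : 0 < minorFrom N A m p :=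
  hA.lastMinor_pos hm (fun a b hab _ => by omega) (fun b hb => by omega)

lemma IsNormalizedBandedTP.minorJump_pos (hA : IsNormalizedBandedTP N (N + d) A) {m j p : ℕ}
    (hm : m ≤ N) (hj : N - m + 1 ≤ j) (hjp : j < p) (hj' : j ≤ N + d) (hp' : p + m ≤ N + d + 2) :
    0 < minorJump N A m j p := by
  refine hA.lastMinor_pos hm (fun a b hab hb => ?_) (fun b hb => ?_)
  · have hb0 : b ≠ 0 := by omega
    by_cases ha : a = 0
    · simp [ha, hb0]; omega
    · simp [ha, hb0]; omega
  · by_cases hb0 : b = 0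
    · simp [hb0]; omega
    · simp [hb0]; omega

lemma minorJump_succ (N : ℕ) (A : ℕ → ℕ → ℝ) (m j p : ℕ) (hm : m + 1 ≤ N)
    (h : (∀ a < m, A (N - m + 1 + a) j = 0) ∨ ∀ b < m, A (N - m) (p + b) = 0) :
    minorJump N A (m + 1) j p = A (N - m) j * minorFrom N A m p := by
  unfold minorJump minorFrom
  rcases h with h | h
  · rw [lastMinor_succ_of_column hm]
    · simp [← add_assoc]
    · simpa using h
  · rw [lastMinor_succ_of_row hm]
    · simp [← add_assoc]
    · simpa [← add_assoc] using h

/-! ### The partial sums of the rows of the reduced echelon form -/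

/-- The coefficient of `e^{θ_j}` in `minorSum N A k r n`. -/
noncomputable def minorCoeff (N : ℕ) (A : ℕ → ℕ → ℝ) (r n j : ℕ) : ℝ :=
  if j ∈ Finset.Icc (N - r + 1) (N - r + n) then
    minorJump N A r j (N - r + n + 1) / minorFrom N A (r - 1) (N - r + n + 1) else 0

/-- The sum of the numbers `minorCoeff N A r n j`. -/
noncomputable def minorMass (N : ℕ) (A : ℕ → ℕ → ℝ) (r n : ℕ) : ℝ :=
  ∑ j ∈ Finset.Icc (N - r + 1) (N - r + n), minorCoeff N A r n j

/-- The limit for `ξ → ∞` of the coefficient of `e^{θ_s}` in `V^{(r)}_l`. -/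
noncomputable def vlim (N : ℕ) (A : ℕ → ℕ → ℝ) (r l s : ℕ) : ℝ :=
  if r ≤ 1 then (if s = N + l - 1 then 1 else 0)
  else if l = 1 then (if s = N - r + 1 then 1 else 0)
  else minorCoeff N A (r - 1) (l - 1) s / minorMass N A (r - 1) (l - 1)

lemma minorCoeff_pos (hA : IsNormalizedBandedTP N (N + d) A) {r n j : ℕ} (hr : 1 ≤ r) (hrN : r ≤ N)
    (hn : n ≤ d + 1) (hj : j ∈ Finset.Icc (N - r + 1) (N - r + n)) : 0 < minorCoeff N A r n j := by
  rw [minorCoeff, if_pos hj]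
  rw [Finset.mem_Icc] at hj
  exact div_pos (hA.minorJump_pos hrN (by omega) (by omega) (by omega) (by omega))
    (hA.minorFrom_pos (by omega) (by omega) (by omega))

lemma minorMass_pos (hA : IsNormalizedBandedTP N (N + d) A) {r n : ℕ} (hr : 1 ≤ r) (hrN : r ≤ N)
    (hn0 : 1 ≤ n) (hn : n ≤ d + 1) : 0 < minorMass N A r n :=
  Finset.sum_pos (fun _ hj => minorCoeff_pos hA hr hrN hn hj) ⟨N - r + 1, by simp; omega⟩

lemma minorCoeff_one (N : ℕ) (A : ℕ → ℕ → ℝ) (n j : ℕ) (hN : 1 ≤ N) :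
    minorCoeff N A 1 n j = if j ∈ Finset.Icc N (N - 1 + n) then A N j else 0 := by
  unfold minorCoeff
  rw [Nat.sub_add_cancel hN]
  split_ifs with h
  · rw [minorJump_succ N A 0 _ _ hN (Or.inl (by simp))]
    simp [minorFrom, lastMinor_zero]
  · rfl

/-- Only one column is left for `n = 1`, and below its top entry it vanishes, so the quotient of
minors is a matrix entry. This starts the recursion in `n`. -/
lemma minorCoeff_first (hA : IsNormalizedBandedTP N (N + d) A) {r j : ℕ} (hr : 1 ≤ r)
    (hrN : r ≤ N) :
    minorCoeff N A r 1 j = if j = N - r + 1 then A (N - r + 1) (N - r + 1) else 0 := by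
  unfold minorCoeff
  obtain ⟨m, rfl⟩ : ∃ m, r = m + 1 := ⟨r - 1, by omega⟩
  have e : N - (m + 1) + 1 = N - m := by omega
  have hmem : j ∈ Finset.Icc (N - (m + 1) + 1) (N - (m + 1) + 1) ↔ j = N - m := by simp [e]
  simp only [e] at hmem ⊢
  by_cases h : j = N - m
  · rw [if_pos (hmem.2 h), if_pos h]
    subst h
    rw [minorJump_succ N A m _ _ hrN, Nat.add_sub_cancel, mul_div_cancel_right₀]
    · exact (hA.minorFrom_pos (by omega) (by omega) (by omega)).ne'
    · left
      intro a ha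
      refine hA.apply_eq_zero ?_ ?_ ?_ <;> (try rw [Finset.mem_Icc]) <;> omega
  · rw [if_neg (fun h' => h (hmem.1 h')), if_neg h]

/-- For `n = d + 1` the columns after `j` lie outside the band of row `N - r + 1`, so the minor
factors. The full sum therefore reproduces a row of the matrix, as the condition at `Q_r` demands in
the limit. -/
lemma minorCoeff_last (hA : IsNormalizedBandedTP N (N + d) A) {r j : ℕ} (hr : 1 ≤ r)
    (hrN : r ≤ N) (hj : j ∈ Finset.Icc 1 (N + d)) :
    minorCoeff N A r (d + 1) j = A (N - r + 1) j := by
  unfold minorCoeff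
  obtain ⟨m, rfl⟩ : ∃ m, r = m + 1 := ⟨r - 1, by omega⟩
  have e : N - (m + 1) + 1 = N - m := by omega
  split_ifs with h
  · rw [minorJump_succ N A m _ _ hrN, Nat.add_sub_cancel, mul_div_cancel_right₀, e]
    · exact (hA.minorFrom_pos (by omega) (by omega) (by omega)).ne'
    · right
      intro a ha
      refine hA.apply_eq_zero ?_ ?_ ?_ <;> (try rw [Finset.mem_Icc]) <;> omega
  · refine (hA.apply_eq_zero ?_ hj ?_).symm
    · simp; omega
    · simp only [Finset.mem_Icc] at *; omega

/-- The recursion satisfied by the coefficients of `minorSum`. -/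
lemma Bhat_mul_vlim (hA : IsNormalizedBandedTP N (N + d) A) {r l j : ℕ} (hr : 1 ≤ r) (hrN : r ≤ N)
    (hl : 1 ≤ l) (hld : l ≤ d) :
    minorCoeff N A r (l + 1) j =
      minorCoeff N A r l j + Bhat N A r (l + 1) * vlim N A r (l + 1) j := by
  by_cases hr1 : r = 1
  · subst hr1
    simp only [minorCoeff_one N A _ j hrN, Bhat, vlim, Finset.mem_Icc, if_true, le_refl]
    by_cases h : j = N + (l + 1) - 1
    · rw [if_pos (by omega), if_neg (by omega), if_pos h, h]; simp
    · rw [if_neg h]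
      by_cases h' : N ≤ j ∧ j ≤ N - 1 + l
      · rw [if_pos h', if_pos (by omega)]; simp
      · rw [if_neg h', if_neg (by omega)]; simp
  obtain ⟨m, rfl⟩ : ∃ m, r = m + 2 := ⟨r - 2, by omega⟩
  obtain ⟨p, hp⟩ : ∃ p, N - (m + 2) + (l + 1) = p := ⟨_, rfl⟩
  have hl0 : l + 1 ≠ 1 := by omega
  have e1 : N - (m + 2) + l + 1 = p := by omega
  have e2 : N - (m + 1) + l = p := by omega
  have e3 : N - (m + 2) + 2 = N - (m + 1) + 1 := by omega
  have mass := minorMass_pos hA (r := m + 1) (n := l) (by omega) (by omega) hl (by omega)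
  have d1 := hA.minorFrom_pos (m := m) (p := p + 1) (by omega) (by omega) (by omega)
  have d2 := hA.minorFrom_pos (m := m + 1) (p := p + 1) (by omega) (by omega) (by omega)
  have d3 := hA.minorFrom_pos (m := m + 1) (p := p) (by omega) (by omega) (by omega)
  have d4 := hA.minorFrom_pos (m := m + 2) (p := p) (by omega) (by omega) (by omega)
  have hmass : minorMass N A (m + 1) l =
      (∑ s ∈ Finset.Icc (N - (m + 1) + 1) p, minorJump N A (m + 1) s (p + 1)) /
        minorFrom N A m (p + 1) := by
    rw [Finset.sum_div, minorMass, e2]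
    refine Finset.sum_congr rfl fun s hs => ?_
    rw [minorCoeff, e2, if_pos hs, Nat.add_sub_cancel]
  have hB : Bhat N A (m + 2) (l + 1) = minorFrom N A (m + 2) p * minorFrom N A m (p + 1) /
      (minorFrom N A (m + 1) (p + 1) * minorFrom N A (m + 1) p) * minorMass N A (m + 1) l := by
    rw [Bhat, if_neg (by omega), if_neg hl0, hp, e3, hmass]
    simp only [show m + 2 - 1 = m + 1 by omega]
    field_simp
  have hV : vlim N A (m + 2) (l + 1) j = minorCoeff N A (m + 1) l j / minorMass N A (m + 1) l := by
    rw [vlim, if_neg (by omega), if_neg hl0]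
    rfl
  -- The sum of minors in `Bhat` is, up to a quotient of minors, the mass that normalizes `vlim`;
  -- the two cancel, and the Plücker relation remains.
  rw [hB, hV, mul_assoc, mul_div_cancel₀ _ mass.ne']
  have three := minor_three_term (j := j) (by omega : m + 2 ≤ N) d4.ne'
  unfold minorCoeff
  rw [e1, hp, e2]
  simp only [Nat.add_sub_cancel, show m + 2 - 1 = m + 1 by omega]
  -- The supports of the three coefficients differ at their ends. There the relation persists
  -- because a minor has a zero column (`z1`) or a repeated one (`z2`).
  have z1 : j = N - (m + 2) + 1 → minorJump N A (m + 1) j (p + 1) = 0 := by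
    intro hj
    unfold minorJump lastMinor
    refine Matrix.det_eq_zero_of_column_eq_zero 0 fun a => ?_
    simp only [Matrix.of_apply, Fin.val_zero, if_true]
    have := a.2
    refine hA.apply_eq_zero ?_ ?_ ?_ <;> (try rw [Finset.mem_Icc]) <;> omega
  have z2 : j = p → minorJump N A (m + 2) j p = 0 := by
    rintro rfl
    exact lastMinor_eq_zero_of_eq (i := 0) (j := 1) (by omega) (by omega) (by omega) (by simp)
  have key : minorJump N A (m + 2) j (p + 1) / minorFrom N A (m + 1) (p + 1) =
      minorJump N A (m + 2) j p / minorFrom N A (m + 1) p +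
      minorFrom N A (m + 2) p * minorFrom N A m (p + 1) /
      (minorFrom N A (m + 1) (p + 1) * minorFrom N A (m + 1) p) *
      (minorJump N A (m + 1) j (p + 1) / minorFrom N A m (p + 1)) := by
    field_simp
    linarith
  by_cases hj : j ∈ Finset.Icc (N - (m + 2) + 1) p
  · rw [if_pos hj, key]
    rw [Finset.mem_Icc] at hj
    congr 1
    · by_cases hjp : j = p
      · rw [z2 hjp, if_neg (by rw [Finset.mem_Icc]; omega)]; simp
      · rw [if_pos (by rw [Finset.mem_Icc]; omega)]
    · by_cases hj1 : j = N - (m + 2) + 1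
      · rw [z1 hj1]; simp
      · rw [if_pos (by rw [Finset.mem_Icc]; omega)]
  · rw [if_neg hj]
    rw [Finset.mem_Icc] at hj
    rw [if_neg (by rw [Finset.mem_Icc]; omega), if_neg (by rw [Finset.mem_Icc]; omega)]
    simp

/-- `∑_{l ≤ n} B̂^{(r)}_l V^{(r)}_l` tends to `minorSum N A k r n`, on the level of coefficients. -/
lemma sum_Bhat_mul_vlim (hA : IsNormalizedBandedTP N (N + d) A) {r n j : ℕ} (hr : 1 ≤ r)
    (hrN : r ≤ N) (hn : 1 ≤ n) (hnd : n ≤ d + 1) :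
    ∑ l ∈ Finset.Icc 1 n, Bhat N A r l * vlim N A r l j = minorCoeff N A r n j := by
  induction n, hn using Nat.le_induction with
  | base =>
    rw [Finset.Icc_self, Finset.sum_singleton, minorCoeff_first hA hr hrN]
    by_cases hr1 : r = 1
    · subst hr1
      simp [Bhat, vlim, Nat.sub_add_cancel hrN]
    · have : ¬ r ≤ 1 := by omega
      simp [Bhat, vlim, hr1, this]
  | succ n hn ih =>
    rw [Finset.sum_Icc_succ_top (by omega), ih (by omega), Bhat_mul_vlim hA hr hrN hn (by omega)]

lemma vlim_eq_zero_of_lt {r l s : ℕ} (hr : 1 ≤ r) (hrN : r ≤ N) (hl : 1 ≤ l)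
    (hs : N - r + l < s ∨ s < N - r + 1) : vlim N A r l s = 0 := by
  unfold vlim
  split_ifs with h1 h2 h3 h4
  · omega
  · rfl
  · omega
  · rfl
  · rw [minorCoeff, if_neg, zero_div]
    rw [Finset.mem_Icc]
    omega

/-- With `vlim_eq_zero_of_lt` this gives the triangular shape of the limiting linear system: `V_l`
reaches exactly up to the index `N - r + l`. -/
lemma vlim_diag_pos (hA : IsNormalizedBandedTP N (N + d) A) {r l : ℕ} (hr : 1 ≤ r) (hrN : r ≤ N)
    (hl : 1 ≤ l) (hld : l ≤ d + 1) : 0 < vlim N A r l (N - r + l) := by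
  unfold vlim
  split_ifs with h1 h2 h3 h4
  · exact one_pos
  · omega
  · exact one_pos
  · omega
  · refine div_pos (minorCoeff_pos hA (by omega) (by omega) (by omega : l - 1 ≤ d + 1) ?_)
      (minorMass_pos hA (by omega) (by omega) (by omega) (by omega))
    rw [Finset.mem_Icc]
    omega

lemma sum_vlim (hA : IsNormalizedBandedTP N (N + d) A) {r l : ℕ} (hr : 1 ≤ r) (hrN : r ≤ N)
    (hl : 1 ≤ l) (hld : l ≤ d + 1) : ∑ s ∈ Finset.Icc 1 (N + d), vlim N A r l s = 1 := by
  unfold vlim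
  split_ifs with h1 h2
  · rw [Finset.sum_ite_eq' , if_pos]
    rw [Finset.mem_Icc]
    omega
  · rw [Finset.sum_ite_eq' , if_pos]
    rw [Finset.mem_Icc]
    omega
  · rw [← Finset.sum_div, div_eq_one_iff_eq
      (minorMass_pos hA (by omega) (by omega) (by omega) (by omega)).ne', minorMass]
    refine (Finset.sum_subset ?_ ?_).symm
    · intro j hj
      simp only [Finset.mem_Icc] at *
      omega
    · intro j _ hj
      rw [minorCoeff, if_neg hj]

lemma sum_minorCoeff {r n : ℕ} (hr : 1 ≤ r) (hrN : r ≤ N) (hnd : n ≤ d + 1) :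
    ∑ s ∈ Finset.Icc 1 (N + d), minorCoeff N A r n s = minorMass N A r n := by
  refine (Finset.sum_subset ?_ ?_).symm
  · intro j hj
    simp only [Finset.mem_Icc] at *
    omega
  · intro j _ hj
    rw [minorCoeff, if_neg hj]

/-- Summation of `sum_Bhat_mul_vlim` over the exponentials, since every row of `vlim` has total mass
one. -/
lemma sum_Bhat (hA : IsNormalizedBandedTP N (N + d) A) {r n : ℕ} (hr : 1 ≤ r) (hrN : r ≤ N)
    (hn : 1 ≤ n) (hnd : n ≤ d + 1) : ∑ l ∈ Finset.Icc 1 n, Bhat N A r l = minorMass N A r n := by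
  rw [← sum_minorCoeff (d := d) hr hrN hnd]
  simp_rw [← sum_Bhat_mul_vlim hA hr hrN hn hnd]
  rw [Finset.sum_comm]
  refine Finset.sum_congr rfl fun l hl => ?_
  rw [Finset.mem_Icc] at hl
  rw [← Finset.mul_sum, sum_vlim hA hr hrN hl.1 (by omega), mul_one]

lemma Bhat_pos (hA : IsNormalizedBandedTP N (N + d) A) {r l : ℕ} (hr : 1 ≤ r) (hrN : r ≤ N)
    (hl : 1 ≤ l) (hld : l ≤ d + 1) : 0 < Bhat N A r l := by
  unfold Bhat
  split_ifs with h1 h2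
  · exact hA.apply_pos (by simp; omega) (by omega) (by omega)
  · exact hA.apply_pos (by simp; omega) (by omega) (by omega)
  · refine div_pos (mul_pos (hA.minorFrom_pos hrN (by omega) (by omega)) (Finset.sum_pos ?_ ?_))
      (mul_pos (hA.minorFrom_pos (by omega) (by omega) (by omega))
        (hA.minorFrom_pos (by omega) (by omega) (by omega)))
    · intro s hs
      rw [Finset.mem_Icc] at hs
      exact hA.minorJump_pos (by omega) (by omega) (by omega) (by omega) (by omega)
    · exact ⟨N - r + 2, by simp; omega⟩

/-- The limiting form of `vcoef_succ`: at `α_l` the mean involves only the indices `m < l`, with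
weights proportional to `B̂`. -/
lemma vlim_succ (hA : IsNormalizedBandedTP N (N + d) A) {r l s : ℕ} (hr : 1 ≤ r) (hrN : r + 1 ≤ N)
    (hl : 2 ≤ l) (hld : l ≤ d + 1) :
    vlim N A (r + 1) l s = ∑ m ∈ Finset.Icc 1 (l - 1),
      Bhat N A r m / (∑ m' ∈ Finset.Icc 1 (l - 1), Bhat N A r m') * vlim N A r m s := by
  rw [vlim, if_neg (by omega), if_neg (by omega), Nat.add_sub_cancel,
    ← sum_Bhat_mul_vlim hA hr (by omega) (by omega) (by omega),
    ← sum_Bhat hA hr (by omega) (by omega) (by omega), Finset.sum_div]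
  refine Finset.sum_congr rfl fun m _ => ?_
  ring

lemma minorSum_eq (k : ℕ → ℝ) {r n : ℕ} (hr : 1 ≤ r) (hrN : r ≤ N) (hnd : n ≤ d + 1)
    (t : ℕ → ℝ) :
    minorSum N A k r n t =
      ∑ s ∈ Finset.Icc 1 (N + d), minorCoeff N A r n s * Real.exp (theta (k s) t) := by
  have hsub : Finset.Icc (N - r + 1) (N - r + n) ⊆ Finset.Icc 1 (N + d) := by
    intro j hj
    simp only [Finset.mem_Icc] at *
    omega
  rw [← Finset.sum_subset hsub fun j _ hj => by rw [minorCoeff, if_neg hj, zero_mul], minorSum]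
  exact Finset.sum_congr rfl fun j hj => by rw [minorCoeff, if_pos hj]

end

section

/-! ### Functions with a limit that is attained with rate `O(ξ⁻¹)` -/

/-- `f ξ = c + O(ξ⁻¹)` for `ξ → ∞`. -/
def Asy (f : ℝ → ℝ) (c : ℝ) : Prop :=
  Asymptotics.IsBigO atTop (fun ξ => f ξ - c) fun ξ => ξ⁻¹

namespace Asy

variable {f g : ℝ → ℝ} {c e : ℝ}

lemma const (c : ℝ) : Asy (fun _ => c) c := by
  simp [Asy, Asymptotics.isBigO_zero]

lemma tendsto (hf : Asy f c) : Tendsto f atTop (𝓝 c) := by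
  have : Tendsto (fun ξ => f ξ - c) atTop (𝓝 0) := hf.trans_tendsto tendsto_inv_atTop_zero
  simpa using this.add_const c

lemma isBigO_one (hf : Asy f c) : Asymptotics.IsBigO atTop f fun _ => (1 : ℝ) :=
  hf.tendsto.isBigO_one ℝ

lemma congr' (hf : Asy f c) (h : f =ᶠ[atTop] g) : Asy g c :=
  Asymptotics.IsBigO.congr' hf (h.mono fun ξ hξ => by simp only [hξ]) EventuallyEq.rfl

lemma add (hf : Asy f c) (hg : Asy g e) : Asy (fun ξ => f ξ + g ξ) (c + e) :=
  (Asymptotics.IsBigO.add hf hg).congr_left fun ξ => by ring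

lemma mul (hf : Asy f c) (hg : Asy g e) : Asy (fun ξ => f ξ * g ξ) (c * e) := by
  have h1 := Asymptotics.IsBigO.mul hf hg.isBigO_one
  have h2 := Asymptotics.IsBigO.const_mul_left hg c
  simp only [mul_one] at h1
  exact (h1.add h2).congr_left fun ξ => by ring

lemma sub (hf : Asy f c) (hg : Asy g e) : Asy (fun ξ => f ξ - g ξ) (c - e) :=
  (Asymptotics.IsBigO.sub hf hg).congr_left fun ξ => by ring

lemma inv (hf : Asy f c) (hc : c ≠ 0) : Asy (fun ξ => (f ξ)⁻¹) c⁻¹ := by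
  have h1 : Tendsto (fun ξ => (f ξ)⁻¹) atTop (𝓝 c⁻¹) := hf.tendsto.inv₀ hc
  have h2 := Asymptotics.IsBigO.mul (Asymptotics.IsBigO.const_mul_left hf (-c⁻¹))
    (h1.isBigO_one ℝ)
  simp only [mul_one] at h2
  refine h2.congr' ?_ EventuallyEq.rfl
  filter_upwards [hf.tendsto.eventually_ne hc] with ξ hξ
  field_simp
  ring

lemma div (hf : Asy f c) (hg : Asy g e) (he : e ≠ 0) : Asy (fun ξ => f ξ / g ξ) (c / e) := by
  simp only [div_eq_mul_inv]
  exact hf.mul (hg.inv he)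

lemma sum {ι : Type*} (s : Finset ι) {f : ι → ℝ → ℝ} {c : ι → ℝ} (h : ∀ i ∈ s, Asy (f i) (c i)) :
    Asy (fun ξ => ∑ i ∈ s, f i ξ) (∑ i ∈ s, c i) :=
  (Asymptotics.IsBigO.sum h).congr_left fun ξ => by simp [Finset.sum_apply, Finset.sum_sub_distrib]

lemma prod {ι : Type*} (s : Finset ι) {f : ι → ℝ → ℝ} {c : ι → ℝ} (h : ∀ i ∈ s, Asy (f i) (c i)) :
    Asy (fun ξ => ∏ i ∈ s, f i ξ) (∏ i ∈ s, c i) := by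
  classical
  induction s using Finset.induction_on with
  | empty => simpa using const 1
  | insert a s ha ih =>
    simp only [Finset.prod_insert ha]
    exact (h a (by simp)).mul (ih fun i hi => h i (by simp [hi]))

lemma inv_pow {p : ℕ} (hp : p ≠ 0) : Asy (fun ξ => (ξ ^ p)⁻¹) 0 := by
  refine Asymptotics.IsBigO.of_bound 1 ?_
  filter_upwards [eventually_ge_atTop (1 : ℝ)] with ξ hξ
  rw [sub_zero, one_mul, norm_inv, norm_inv, norm_pow]
  have h1 : 1 ≤ ‖ξ‖ := hξ.trans (le_abs_self ξ)
  exact inv_anti₀ (by linarith) (le_self_pow₀ h1 hp)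

/-- The case distinction lets sums of terms of different orders of magnitude be treated at once:
only those with exponent zero contribute to the limit. -/
lemma inv_pow_mul (hf : Asy f c) (p : ℕ) :
    Asy (fun ξ => (ξ ^ p)⁻¹ * f ξ) (if p = 0 then c else 0) := by
  split_ifs with hp
  · subst hp
    simpa using hf
  · simpa using (inv_pow hp).mul hf

lemma det {n : ℕ} {L : ℝ → Matrix (Fin n) (Fin n) ℝ} {L₀ : Matrix (Fin n) (Fin n) ℝ}
    (h : ∀ i j, Asy (fun ξ => L ξ i j) (L₀ i j)) : Asy (fun ξ => (L ξ).det) L₀.det := by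
  simp only [Matrix.det_apply']
  exact sum _ fun σ _ => (const _).mul (prod _ fun i _ => h _ _)

/-- Numerator and denominator are polynomials in the entries, so the rate `O(ξ⁻¹)` is preserved. No
solution at finite `ξ` is needed, only one of the limiting system. -/
lemma cramer {n : ℕ} {L : ℝ → Matrix (Fin n) (Fin n) ℝ} {L₀ : Matrix (Fin n) (Fin n) ℝ}
    (h : ∀ i j, Asy (fun ξ => L ξ i j) (L₀ i j)) {b x₀ : Fin n → ℝ} (h₀ : L₀.det ≠ 0)
    (hx : L₀.mulVec x₀ = b) (i : Fin n) :
    Asy (fun ξ => (L ξ).cramer b i / (L ξ).det) (x₀ i) := by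
  have hc : L₀.cramer b i = x₀ i * L₀.det := by
    rw [Matrix.cramer_eq_adjugate_mulVec, ← hx, Matrix.mulVec_mulVec, Matrix.adjugate_mul,
      Matrix.smul_mulVec, Matrix.one_mulVec, Pi.smul_apply, smul_eq_mul, mul_comm]
  have e : x₀ i = L₀.cramer b i / L₀.det := by rw [hc, mul_div_cancel_right₀ _ h₀]
  rw [e]
  refine div ?_ (det h) h₀
  simp only [Matrix.cramer_apply]
  refine det fun a c => ?_
  by_cases hci : c = i
  · subst hci; simpa using const _
  · simpa [Matrix.updateCol_ne hci] using h a c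

end Asy

lemma sum_Icc_one {R : Type*} [AddCommMonoid R] (f : ℕ → R) (n : ℕ) :
    ∑ i ∈ Finset.Icc 1 n, f i = ∑ i ∈ Finset.range n, f (i + 1) := by
  induction n with
  | zero => simp
  | succ n ih => rw [Finset.sum_Icc_succ_top (by omega), ih, Finset.sum_range_succ]

/-! ### The linear system for the parameters on one sheet -/

section
variable (N d : ℕ) (A : ℕ → ℕ → ℝ) (r : ℕ) (v : ℕ → ℕ → ℝ)

/-- The linear equations that express that `∑ β_l v_l` has the form required at infinity. -/
def IsLevelSol (β ε : ℕ → ℝ) : Prop :=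
  ∀ s ∈ Finset.Icc (N - r + 1) (N + d), ∑ l ∈ Finset.Icc 1 (d + 1), β l * v l s =
    A (N - r + 1) s + ∑ j ∈ Finset.Icc 1 (r - 1), ε j * A (N - r + 1 + j) s

/-- The matrix of the linear system. -/
def levelMatrix : Matrix (Fin (d + r)) (Fin (d + r)) ℝ := Matrix.of fun q i =>
  if (i : ℕ) ≤ d then v (i + 1) (N - r + 1 + q) else -A (N - r + 1 + (i - d)) (N - r + 1 + q)

/-- The right-hand side of the linear system. -/
def levelRhs (q : Fin (d + r)) : ℝ := A (N - r + 1) (N - r + 1 + q)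

/-- The solution of the linear system, by Cramer's rule. -/
def levelSol (i : ℕ) : ℝ := if h : i < d + r then
  (levelMatrix N d A r v).cramer (levelRhs N d A r) ⟨i, h⟩ / (levelMatrix N d A r v).det else 0

/-- The parameters `ε` determined by the linear system. -/
def levelEps (j : ℕ) : ℝ := levelSol N d A r v (d + j)

/-- The parameters `B` determined by the linear system. -/
def levelB (l : ℕ) : ℝ :=
  levelSol N d A r v (l - 1) / (1 + ∑ j ∈ Finset.Icc 1 (r - 1), levelEps N d A r v j)

variable {N d A r v}

/-- The unknowns `β_1, …, β_{d+1}` occupy the positions `0, …, d`, and `ε_1, …, ε_{r-1}` the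
positions `d + 1, …, d + r - 1`. There are as many equations, namely `s = N - r + 1, …, N + d`. -/
lemma isLevelSol_iff (hr : 1 ≤ r) (hrN : r ≤ N) (β ε : ℕ → ℝ) :
    IsLevelSol N d A r v β ε ↔ (levelMatrix N d A r v).mulVec
      (fun i => if (i : ℕ) ≤ d then β (i + 1) else ε (i - d)) = levelRhs N d A r := by
  have hrow : ∀ q : Fin (d + r), (levelMatrix N d A r v).mulVec
      (fun i => if (i : ℕ) ≤ d then β (i + 1) else ε (i - d)) q =
      ∑ l ∈ Finset.Icc 1 (d + 1), β l * v l (N - r + 1 + q) -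
      ∑ j ∈ Finset.Icc 1 (r - 1), ε j * A (N - r + 1 + j) (N - r + 1 + q) := by
    intro q
    have h1 : (levelMatrix N d A r v).mulVec
      (fun i => if (i : ℕ) ≤ d then β (i + 1) else ε (i - d)) q =
      ∑ i : Fin (d + r), (fun i : ℕ => if i ≤ d then β (i + 1) * v (i + 1) (N - r + 1 + q)
        else -(ε (i - d) * A (N - r + 1 + (i - d)) (N - r + 1 + q))) i := by
      unfold Matrix.mulVec dotProduct levelMatrix
      refine Finset.sum_congr rfl fun i _ => ?_
      simp only [Matrix.of_apply]
      split_ifs <;> ring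
    rw [h1, Fin.sum_univ_eq_sum_range (fun i : ℕ => if i ≤ d then
      β (i + 1) * v (i + 1) (N - r + 1 + q)
      else -(ε (i - d) * A (N - r + 1 + (i - d)) (N - r + 1 + q))), 
      show Finset.range (d + r) = Finset.range ((d + 1) + (r - 1)) from
        congrArg _ (by omega),
      Finset.sum_range_add, sum_Icc_one, sum_Icc_one, sub_eq_add_neg, ← Finset.sum_neg_distrib]
    congr 1
    · refine Finset.sum_congr rfl fun i hi => ?_
      rw [Finset.mem_range] at hi
      rw [if_pos (by omega)]
    · refine Finset.sum_congr rfl fun i hi => ?_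
      rw [if_neg (by omega), show d + 1 + i - d = i + 1 by omega]
  rw [funext_iff]
  simp only [hrow, levelRhs, sub_eq_iff_eq_add]
  constructor
  · intro h q
    have := q.2
    exact h _ (Finset.mem_Icc.2 (by omega))
  · intro h s hs
    rw [Finset.mem_Icc] at hs
    have := h ⟨s - (N - r + 1), by omega⟩
    rwa [show N - r + 1 + (s - (N - r + 1)) = s by omega] at this

/-- The solution of the linear system satisfies it. -/
lemma isLevelSol_levelSol (hr : 1 ≤ r) (hrN : r ≤ N) (h : (levelMatrix N d A r v).det ≠ 0) :
    IsLevelSol N d A r v (fun l => levelSol N d A r v (l - 1)) (levelEps N d A r v) := by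
  rw [isLevelSol_iff hr hrN]
  have e : (fun i : Fin (d + r) => if (i : ℕ) ≤ d then levelSol N d A r v (i + 1 - 1)
      else levelEps N d A r v (i - d)) =
      ((levelMatrix N d A r v).det)⁻¹ • (levelMatrix N d A r v).cramer (levelRhs N d A r) := by
    ext i
    have hi : levelSol N d A r v i =
        ((levelMatrix N d A r v).det)⁻¹ * (levelMatrix N d A r v).cramer (levelRhs N d A r) i := by
      rw [levelSol, dif_pos i.2, div_eq_mul_inv, mul_comm]
    rw [Pi.smul_apply, smul_eq_mul, ← hi]
    split_ifs with h
    · simp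
    · rw [levelEps, show d + (i - d) = (i : ℕ) by omega]
  rw [e, Matrix.mulVec_smul, Matrix.mulVec_cramer, smul_smul, inv_mul_cancel₀ h, one_smul]

/-- The solution of the linear system is unique. -/
lemma IsLevelSol.eq (hr : 1 ≤ r) (hrN : r ≤ N) (h : (levelMatrix N d A r v).det ≠ 0)
    {β ε : ℕ → ℝ} (hβ : IsLevelSol N d A r v β ε) :
    (∀ l ∈ Finset.Icc 1 (d + 1), β l = levelSol N d A r v (l - 1)) ∧
    ∀ j ∈ Finset.Icc 1 (r - 1), ε j = levelEps N d A r v j := by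
  rw [isLevelSol_iff hr hrN] at hβ
  have key : ∀ i : Fin (d + r), levelSol N d A r v i =
      if (i : ℕ) ≤ d then β (i + 1) else ε (i - d) := by
    intro i
    rw [levelSol, dif_pos i.2, div_eq_iff h, Matrix.cramer_eq_adjugate_mulVec, ← hβ,
      Matrix.mulVec_mulVec, Matrix.adjugate_mul, Matrix.smul_mulVec, Matrix.one_mulVec,
      Pi.smul_apply, smul_eq_mul, mul_comm]
  constructor
  · intro l hl
    rw [Finset.mem_Icc] at hl
    have := key ⟨l - 1, by omega⟩
    simp only at this
    rw [this, if_pos (by omega), Nat.sub_add_cancel hl.1]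
  · intro j hj
    rw [Finset.mem_Icc] at hj
    have := key ⟨d + j, by omega⟩
    simp only at this
    rw [levelEps, this, if_neg (by omega), Nat.add_sub_cancel_left]

end

/-! ### The linear system in the limit of large `ξ` -/

section
variable {N d : ℕ} {A : ℕ → ℕ → ℝ} {r : ℕ} {v : ℝ → ℕ → ℕ → ℝ}

/-- The matrix is upper triangular: the column of `β_l` ends at `s = N - r + l`, and that of `ε_j`
ends where the band of row `N - r + 1 + j` ends. Both last entries lie on the diagonal and are
nonzero. -/
lemma det_levelMatrix_vlim_ne_zero (hA : IsNormalizedBandedTP N (N + d) A) (hr : 1 ≤ r)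
    (hrN : r ≤ N) : (levelMatrix N d A r (vlim N A r)).det ≠ 0 := by
  rw [Matrix.det_of_isUpperTriangular]
  · refine Finset.prod_ne_zero_iff.2 fun i _ => ?_
    have := i.2
    simp only [levelMatrix, Matrix.of_apply]
    split_ifs with h
    · rw [show N - r + 1 + (i : ℕ) = N - r + (i + 1) by omega]
      exact (vlim_diag_pos hA hr hrN (by omega) (by omega)).ne'
    · exact neg_ne_zero.2 (hA.apply_pos (Finset.mem_Icc.2 (by omega)) (by omega) (by omega)).ne'
  · intro q i hiq
    have hiq' : (i : ℕ) < q := hiq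
    have h2 := q.2
    simp only [levelMatrix, Matrix.of_apply]
    split_ifs with h
    · exact vlim_eq_zero_of_lt hr hrN (by omega) (by omega)
    · rw [neg_eq_zero]
      exact hA.apply_eq_zero (Finset.mem_Icc.2 (by omega)) (Finset.mem_Icc.2 (by omega)) (by omega)

/-- By `minorCoeff_last` the `B̂` alone reproduce row `N - r + 1`, so no lower rows have to be added
in the limit. -/
lemma isLevelSol_Bhat (hA : IsNormalizedBandedTP N (N + d) A) (hr : 1 ≤ r) (hrN : r ≤ N) :
    IsLevelSol N d A r (vlim N A r) (Bhat N A r) 0 := by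
  intro s hs
  rw [Finset.mem_Icc] at hs
  rw [sum_Bhat_mul_vlim hA hr hrN (by omega) le_rfl,
    minorCoeff_last hA hr hrN (Finset.mem_Icc.2 (by omega))]
  simp

lemma asy_levelMatrix
    (hv : ∀ l ∈ Finset.Icc 1 (d + 1), ∀ s, Asy (fun ξ => v ξ l s) (vlim N A r l s))
    (q i : Fin (d + r)) :
    Asy (fun ξ => levelMatrix N d A r (v ξ) q i) (levelMatrix N d A r (vlim N A r) q i) := by
  simp only [levelMatrix, Matrix.of_apply]
  split_ifs with h
  · exact hv _ (Finset.mem_Icc.2 (by omega)) _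
  · exact Asy.const _

lemma eventually_det_levelMatrix_ne_zero (hA : IsNormalizedBandedTP N (N + d) A) (hr : 1 ≤ r)
    (hrN : r ≤ N)
    (hv : ∀ l ∈ Finset.Icc 1 (d + 1), ∀ s, Asy (fun ξ => v ξ l s) (vlim N A r l s)) :
    ∀ᶠ ξ in atTop, (levelMatrix N d A r (v ξ)).det ≠ 0 :=
  (Asy.det (asy_levelMatrix hv)).tendsto.eventually_ne (det_levelMatrix_vlim_ne_zero hA hr hrN)

lemma asy_levelSol (hA : IsNormalizedBandedTP N (N + d) A) (hr : 1 ≤ r) (hrN : r ≤ N)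
    (hv : ∀ l ∈ Finset.Icc 1 (d + 1), ∀ s, Asy (fun ξ => v ξ l s) (vlim N A r l s)) (i : ℕ) :
    Asy (fun ξ => levelSol N d A r (v ξ) i) (if i ≤ d then Bhat N A r (i + 1) else 0) := by
  unfold levelSol
  by_cases hi : i < d + r
  · simp only [dif_pos hi]
    have := Asy.cramer (asy_levelMatrix hv) (det_levelMatrix_vlim_ne_zero hA hr hrN)
      ((isLevelSol_iff hr hrN _ _).1 (isLevelSol_Bhat hA hr hrN)) ⟨i, hi⟩
    simpa using this
  · simp only [dif_neg hi]
    rw [if_neg (by omega)]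
    exact Asy.const 0

lemma asy_levelEps (hA : IsNormalizedBandedTP N (N + d) A) (hr : 1 ≤ r) (hrN : r ≤ N)
    (hv : ∀ l ∈ Finset.Icc 1 (d + 1), ∀ s, Asy (fun ξ => v ξ l s) (vlim N A r l s)) {j : ℕ}
    (hj : 1 ≤ j) : Asy (fun ξ => levelEps N d A r (v ξ) j) 0 := by
  have := asy_levelSol hA hr hrN hv (d + j)
  rwa [if_neg (by omega)] at this

/-- The normalizing factor `1 + ∑ ε` tends to one, so it does not change the limit of the
unnormalized solution. -/
lemma asy_levelB (hA : IsNormalizedBandedTP N (N + d) A) (hr : 1 ≤ r) (hrN : r ≤ N)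
    (hv : ∀ l ∈ Finset.Icc 1 (d + 1), ∀ s, Asy (fun ξ => v ξ l s) (vlim N A r l s)) {l : ℕ}
    (hl : l ∈ Finset.Icc 1 (d + 1)) :
    Asy (fun ξ => levelB N d A r (v ξ) l) (Bhat N A r l) := by
  rw [Finset.mem_Icc] at hl
  have h1 := asy_levelSol hA hr hrN hv (l - 1)
  rw [if_pos (by omega), Nat.sub_add_cancel hl.1] at h1
  have h2 := (Asy.const 1).add (Asy.sum (Finset.Icc 1 (r - 1)) fun j hj =>
    asy_levelEps hA hr hrN hv (Finset.mem_Icc.1 hj).1)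
  have h3 := h1.div h2 (by simp)
  simpa [levelB] using h3

end

end

section

/-! ### The weights of the wave function at the points `α_l` -/

lemma lam_one (ξ : ℝ) : lam ξ 1 = 0 := by simp [lam]

lemma lam_nonpos {ξ : ℝ} (hξ : 0 ≤ ξ) (l : ℕ) : lam ξ l ≤ 0 := by
  unfold lam
  split_ifs
  · exact le_rfl
  · simp only [neg_nonpos]; positivity

lemma lam_lt {ξ : ℝ} (hξ : 1 < ξ) {l m : ℕ} (hl : 1 ≤ l) (hlm : l < m) : lam ξ m < lam ξ l := by
  unfold lam
  rw [if_neg (by omega)]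
  split_ifs with h
  · simp only [Left.neg_neg_iff]; positivity
  · exact neg_lt_neg (pow_lt_pow_right₀ hξ (by omega))

lemma alpha_pos {ξ : ℝ} (hξ : 0 < ξ) (l : ℕ) : 0 < alpha ξ l := by
  unfold alpha; positivity

lemma alpha_lt {ξ : ℝ} (hξ : 1 < ξ) {l m : ℕ} (hlm : l < m) : alpha ξ l < alpha ξ m := by
  unfold alpha
  exact zpow_lt_zpow_right₀ hξ (by omega)

lemma alpha_sub_lam_pos {ξ : ℝ} (hξ : 0 < ξ) (l m : ℕ) : 0 < alpha ξ l - lam ξ m := by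
  linarith [alpha_pos hξ l, lam_nonpos hξ.le m]

/-- The coefficient of `V_m` in the value of the wave function at `α_l`. -/
def weight (d : ℕ) (ξ : ℝ) (B : ℕ → ℝ) (l m : ℕ) : ℝ :=
  B m / (alpha ξ l - lam ξ m) / ∑ m' ∈ Finset.Icc 1 (d + 1), B m' / (alpha ξ l - lam ξ m')

section
variable {d : ℕ} {ξ : ℝ} {B : ℕ → ℝ}

lemma weight_denom_pos (hξ : 0 < ξ) (hB : ∀ m ∈ Finset.Icc 1 (d + 1), 0 < B m) (l : ℕ) :
    0 < ∑ m ∈ Finset.Icc 1 (d + 1), B m / (alpha ξ l - lam ξ m) :=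
  Finset.sum_pos (fun m hm => div_pos (hB m hm) (alpha_sub_lam_pos hξ l m)) ⟨1, by simp⟩

lemma weight_pos (hξ : 0 < ξ) (hB : ∀ m ∈ Finset.Icc 1 (d + 1), 0 < B m) (l : ℕ) {m : ℕ}
    (hm : m ∈ Finset.Icc 1 (d + 1)) : 0 < weight d ξ B l m :=
  div_pos (div_pos (hB m hm) (alpha_sub_lam_pos hξ l m)) (weight_denom_pos hξ hB l)

lemma sum_weight (hξ : 0 < ξ) (hB : ∀ m ∈ Finset.Icc 1 (d + 1), 0 < B m) (l : ℕ) :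
    ∑ m ∈ Finset.Icc 1 (d + 1), weight d ξ B l m = 1 := by
  unfold weight
  rw [← Finset.sum_div, div_self (weight_denom_pos hξ hB l).ne']

end

/-- The order of magnitude of the weight of `V_m` at `α_l` is `ξ ^ (-weightExp l m)`. -/
def weightExp (l m : ℕ) : ℕ := if m < l then 0 else 2 * (m - l) + 1

/-- Compare `α_l = ξ ^ (2 l - 5)` with `|λ_m| = ξ ^ (2 m - 4)` for `m ≥ 2`: for `m < l` the
denominator is dominated by `α_l`, for `m ≥ l` by `|λ_m|`, which is larger by the factor `ξ ^ (2 (m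
- l) + 1)`. -/
lemma asy_ratio {l m : ℕ} (hl : 2 ≤ l) (hm : 1 ≤ m) :
    Asy (fun ξ => ξ ^ weightExp l m * (alpha ξ l / (alpha ξ l - lam ξ m))) 1 := by
  have key : ∀ p : ℕ, p ≠ 0 → Asy (fun ξ => (1 + (ξ ^ p)⁻¹)⁻¹) 1 := by
    intro p hp
    have := ((Asy.const 1).add (Asy.inv_pow hp)).inv (by simp)
    simpa using this
  unfold weightExp
  by_cases h1 : m = 1
  · subst h1
    simp only [if_pos (show 1 < l by omega), lam_one, sub_zero, pow_zero, one_mul]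
    refine (Asy.const 1).congr' ?_
    filter_upwards [eventually_gt_atTop 0] with ξ hξ
    rw [div_self (alpha_pos hξ l).ne']
  split_ifs with h
  · refine (key (2 * (l - m) - 1) (by omega)).congr' ?_
    filter_upwards [eventually_gt_atTop 0] with ξ hξ
    have ha : alpha ξ l = ξ ^ (2 * (m - 2)) * ξ ^ (2 * (l - m) - 1) := by
      rw [alpha, ← pow_add, ← zpow_natCast]
      congr 1
      omega
    have hX : 0 < ξ ^ (2 * (l - m) - 1) := by positivity
    have hY : 0 < ξ ^ (2 * (m - 2)) := by positivity
    rw [ha, lam, if_neg h1, pow_zero, one_mul, sub_neg_eq_add]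
    generalize ξ ^ (2 * (l - m) - 1) = X at *
    field_simp
  · refine (key (2 * (m - l) + 1) (by omega)).congr' ?_
    filter_upwards [eventually_gt_atTop 0] with ξ hξ
    have ha : ξ ^ (2 * (m - 2)) = alpha ξ l * ξ ^ (2 * (m - l) + 1) := by
      rw [alpha, ← zpow_natCast, ← zpow_natCast, ← zpow_add₀ hξ.ne']
      congr 1
      omega
    have := alpha_pos hξ l
    have hX : 0 < ξ ^ (2 * (m - l) + 1) := by positivity
    rw [lam, if_neg h1, ha, sub_neg_eq_add]
    generalize ξ ^ (2 * (m - l) + 1) = X at *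
    field_simp
    rw [add_comm]

/-- After multiplication by `α_l` the common denominator of the weights is a sum whose terms with `m
≥ l` are of lower order, so it tends to `∑_{m < l} B₀ m`. -/
lemma asy_weight {d : ℕ} {B : ℝ → ℕ → ℝ} {B₀ : ℕ → ℝ}
    (hB : ∀ m ∈ Finset.Icc 1 (d + 1), Asy (fun ξ => B ξ m) (B₀ m))
    (hB₀ : ∀ m ∈ Finset.Icc 1 (d + 1), 0 < B₀ m) {l m : ℕ} (hl : 2 ≤ l) (hld : l ≤ d + 1)
    (hm : m ∈ Finset.Icc 1 (d + 1)) :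
    Asy (fun ξ => ξ ^ weightExp l m * weight d ξ (B ξ) l m)
      (B₀ m / ∑ m' ∈ Finset.Icc 1 (l - 1), B₀ m') := by
  have hsum : (∑ m' ∈ Finset.Icc 1 (d + 1), if weightExp l m' = 0 then B₀ m' else 0) =
      ∑ m' ∈ Finset.Icc 1 (l - 1), B₀ m' := by
    rw [← Finset.sum_filter]
    refine Finset.sum_congr ?_ fun _ _ => rfl
    ext m'
    rw [Finset.mem_filter, Finset.mem_Icc, Finset.mem_Icc, weightExp]
    split_ifs <;> simp <;> omega
  have h1 := (hB m hm).mul (asy_ratio hl (Finset.mem_Icc.1 hm).1)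
  have h2 := Asy.sum (Finset.Icc 1 (d + 1)) fun m' hm' =>
    ((hB m' hm').mul (asy_ratio hl (Finset.mem_Icc.1 hm').1)).inv_pow_mul (weightExp l m')
  simp only [mul_one] at h1 h2
  rw [hsum] at h2
  have h3 : 0 < ∑ m' ∈ Finset.Icc 1 (l - 1), B₀ m' := by
    refine Finset.sum_pos (fun m' hm' => hB₀ m' ?_) ⟨1, by simp; omega⟩
    rw [Finset.mem_Icc] at *
    omega
  refine (h1.div h2 h3.ne').congr' ?_
  filter_upwards [eventually_gt_atTop 0] with ξ hξ
  have hα := alpha_pos hξ l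
  have e : ∑ m' ∈ Finset.Icc 1 (d + 1), (ξ ^ weightExp l m')⁻¹ *
      (B ξ m' * (ξ ^ weightExp l m' * (alpha ξ l / (alpha ξ l - lam ξ m')))) =
      alpha ξ l * ∑ m' ∈ Finset.Icc 1 (d + 1), B ξ m' / (alpha ξ l - lam ξ m') := by
    rw [Finset.mul_sum]
    refine Finset.sum_congr rfl fun m' _ => ?_
    have := alpha_sub_lam_pos hξ l m'
    field_simp
  rw [e, weight]
  have := alpha_sub_lam_pos hξ l m
  field_simp

/-! ### The coefficients of the wave function -/

section
variable (N d : ℕ) (A : ℕ → ℕ → ℝ) (ξ : ℝ)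

/-- The coefficient of `e^{θ_s}` in `V^{(r)}_l`. -/
def vcoef : ℕ → ℕ → ℕ → ℝ
  | 0 => fun _ _ => 0
  | 1 => fun l s => if s = N + l - 1 then 1 else 0
  | r + 2 => fun l s => if l = 1 then (if s = N - (r + 2) + 1 then 1 else 0)
    else ∑ m ∈ Finset.Icc 1 (d + 1),
      weight d ξ (levelB N d A (r + 1) (vcoef (r + 1))) l m * vcoef (r + 1) m s

/-- The parameters `B^{(r)}_l`. -/
def coefB (r l : ℕ) : ℝ := levelB N d A r (vcoef N d A ξ r) l

/-- The parameters `ε^{(r)}_j`. -/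
def coefEps (r j : ℕ) : ℝ := levelEps N d A r (vcoef N d A ξ r) j

lemma vcoef_one (l s : ℕ) : vcoef N d A ξ 1 l s = if s = N + l - 1 then 1 else 0 := rfl

lemma vcoef_succ_one {r : ℕ} (hr : 1 ≤ r) (s : ℕ) :
    vcoef N d A ξ (r + 1) 1 s = if s = N - (r + 1) + 1 then 1 else 0 := by
  obtain ⟨r, rfl⟩ : ∃ r', r = r' + 1 := ⟨r - 1, by omega⟩
  simp [vcoef]

lemma vcoef_succ {r l : ℕ} (hr : 1 ≤ r) (hl : 2 ≤ l) (s : ℕ) :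
    vcoef N d A ξ (r + 1) l s = ∑ m ∈ Finset.Icc 1 (d + 1),
      weight d ξ (coefB N d A ξ r) l m * vcoef N d A ξ r m s := by
  obtain ⟨r, rfl⟩ : ∃ r', r = r' + 1 := ⟨r - 1, by omega⟩
  have : l ≠ 1 := by omega
  simp only [vcoef, if_neg this]
  rfl

end

/-! ### Asymptotics of the coefficients and of the parameters `ε` -/

section
variable {N d : ℕ} {A : ℕ → ℕ → ℝ} {r l s : ℕ}

/-- The induction that drives the construction: limits of the coefficients on `Γ_r` give the limits
of `B^{(r)}` through the linear system, hence those of the weights at `α_l`, hence the limits on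
`Γ_{r+1}`. -/
lemma asy_vcoef (hA : IsNormalizedBandedTP N (N + d) A) (hr : 1 ≤ r) (hrN : r ≤ N) :
    ∀ l ∈ Finset.Icc 1 (d + 1), ∀ s, Asy (fun ξ => vcoef N d A ξ r l s) (vlim N A r l s) := by
  induction r, hr using Nat.le_induction with
  | base =>
    intro l _ s
    simp only [vcoef_one, vlim, le_refl, if_true]
    exact Asy.const _
  | succ r hr ih =>
    intro l hl s
    have ih := ih (by omega)
    rw [Finset.mem_Icc] at hl
    by_cases hl1 : l = 1
    · subst hl1
      simp only [vcoef_succ_one N d A _ hr, vlim, if_neg (show ¬ r + 1 ≤ 1 by omega), if_true]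
      exact Asy.const _
    · simp only [vcoef_succ N d A _ hr (show 2 ≤ l by omega)]
      rw [vlim_succ hA hr hrN (by omega) hl.2]
      have h : ∀ m ∈ Finset.Icc 1 (d + 1), Asy (fun ξ => weight d ξ (coefB N d A ξ r) l m *
          vcoef N d A ξ r m s) (if m ∈ Finset.Icc 1 (l - 1) then Bhat N A r m /
            (∑ m' ∈ Finset.Icc 1 (l - 1), Bhat N A r m') * vlim N A r m s else 0) := by
        intro m hm
        have hw := (asy_weight (fun m hm => asy_levelB hA hr (by omega) ih hm)
          (fun m hm => Bhat_pos hA hr (by omega) (Finset.mem_Icc.1 hm).1 (Finset.mem_Icc.1 hm).2)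
          (by omega) hl.2 hm).inv_pow_mul (weightExp l m)
        have hw' := hw.mul (ih m hm s)
        have e : (if weightExp l m = 0 then Bhat N A r m /
            (∑ m' ∈ Finset.Icc 1 (l - 1), Bhat N A r m') else 0) * vlim N A r m s =
            (if m ∈ Finset.Icc 1 (l - 1) then Bhat N A r m /
            (∑ m' ∈ Finset.Icc 1 (l - 1), Bhat N A r m') * vlim N A r m s else 0) := by
          rw [Finset.mem_Icc] at hm
          by_cases hml : m < l
          · rw [if_pos (by simp [weightExp, hml]), if_pos (Finset.mem_Icc.2 (by omega))]
          · rw [if_neg (by simp [weightExp, hml]), if_neg (by rw [Finset.mem_Icc]; omega),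
              zero_mul]
        rw [e] at hw'
        refine hw'.congr' ?_
        filter_upwards [eventually_gt_atTop 0] with ξ hξ
        have : 0 < ξ ^ weightExp l m := by positivity
        rw [inv_mul_cancel_left₀ this.ne']
        rfl
      have := Asy.sum _ h
      rw [Finset.sum_ite_mem, Finset.inter_eq_right.2] at this
      · exact this
      · intro m hm
        rw [Finset.mem_Icc] at *
        omega

lemma asy_coefB (hA : IsNormalizedBandedTP N (N + d) A) (hr : 1 ≤ r) (hrN : r ≤ N)
    (hl : l ∈ Finset.Icc 1 (d + 1)) : Asy (fun ξ => coefB N d A ξ r l) (Bhat N A r l) :=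
  asy_levelB hA hr hrN (asy_vcoef hA hr hrN) hl

/-- The coefficient of `e^{θ_{N-r+l+i}}` in `V^{(r)}_l` has the order of magnitude `ξ ^ (-i)`. -/
lemma asy_pow_mul_vcoef (hA : IsNormalizedBandedTP N (N + d) A) (hr : 1 ≤ r) (hrN : r ≤ N)
    (hl : l ∈ Finset.Icc 1 (d + 1)) (s : ℕ) :
    ∃ g, 0 ≤ g ∧ Asy (fun ξ => ξ ^ (s - (N - r + l)) * vcoef N d A ξ r l s) g ∧
      (2 ≤ l ∨ s = N - r + l → N - r + l ≤ s → s ≤ N + l - 1 → 0 < g) := by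
  induction r, hr using Nat.le_induction generalizing l with
  | base =>
    rw [Finset.mem_Icc] at hl
    by_cases hs : s = N + l - 1
    · refine ⟨1, zero_le_one, ?_, fun _ _ _ => one_pos⟩
      simp only [vcoef_one, if_pos hs, show s - (N - 1 + l) = 0 by omega]
      simpa using Asy.const 1
    · refine ⟨0, le_rfl, ?_, fun _ _ _ => by omega⟩
      simp only [vcoef_one, if_neg hs, mul_zero]
      exact Asy.const 0
  | succ r hr ih =>
    have hlm := Finset.mem_Icc.1 hl
    by_cases hl1 : l = 1
    · subst hl1
      by_cases hs : s = N - (r + 1) + 1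
      · refine ⟨1, zero_le_one, ?_, fun _ _ _ => one_pos⟩
        simp only [vcoef_succ_one N d A _ hr, if_pos hs,
          show s - (N - (r + 1) + 1) = 0 by omega]
        simpa using Asy.const 1
      · refine ⟨0, le_rfl, ?_, fun _ _ _ => by omega⟩
        simp only [vcoef_succ_one N d A _ hr, if_neg hs, mul_zero]
        exact Asy.const 0
    · simp only [vcoef_succ N d A _ hr (show 2 ≤ l by omega)]
      have h : ∀ m ∈ Finset.Icc 1 (d + 1), ∃ g, 0 ≤ g ∧
          Asy (fun ξ => ξ ^ (s - (N - (r + 1) + l)) * (weight d ξ (coefB N d A ξ r) l m *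
            vcoef N d A ξ r m s)) g ∧
          ((m = l ∧ N - r + l ≤ s ∨ m = l - 1 ∧ s = N - r + m) → s ≤ N + l - 1 → 0 < g) := by
        intro m hm
        obtain ⟨g, hg0, hg, hgpos⟩ := ih (by omega) hm
        have hw := asy_weight (fun m hm => asy_coefB hA hr (by omega) hm)
          (fun m hm => Bhat_pos hA hr (by omega) (Finset.mem_Icc.1 hm).1 (Finset.mem_Icc.1 hm).2)
          (by omega) hlm.2 hm
        rw [Finset.mem_Icc] at hm
        have hS : 0 < ∑ m' ∈ Finset.Icc 1 (l - 1), Bhat N A r m' := by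
          rw [sum_Bhat hA hr (by omega) (by omega) (by omega)]
          exact minorMass_pos hA hr (by omega) (by omega) (by omega)
        have hBm := Bhat_pos hA hr (by omega : r ≤ N) hm.1 hm.2
        -- `D` is the amount by which the order of the `m`-th summand is smaller than the claimed
        -- one. Subtraction is truncated, so indices `s` at or below the diagonal carry the exponent
        -- zero.
        obtain ⟨D, hD⟩ : ∃ D, weightExp l m + (s - (N - r + m)) = D + (s - (N - (r + 1) + l)) := by
          refine ⟨_, (Nat.sub_add_cancel ?_).symm⟩
          unfold weightExp
          split_ifs <;> omega
        refine ⟨if D = 0 then Bhat N A r m / (∑ m' ∈ Finset.Icc 1 (l - 1), Bhat N A r m') * g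
          else 0, ?_, ((hw.mul hg).inv_pow_mul D).congr' ?_, ?_⟩
        · split_ifs
          · positivity
          · exact le_rfl
        · filter_upwards [eventually_gt_atTop 0] with ξ hξ
          have h1 : ξ ^ weightExp l m * ξ ^ (s - (N - r + m)) =
              ξ ^ D * ξ ^ (s - (N - (r + 1) + l)) := by
            rw [← pow_add, ← pow_add, hD]
          have h2 : 0 < ξ ^ D := by positivity
          calc (ξ ^ D)⁻¹ * (ξ ^ weightExp l m * weight d ξ (coefB N d A ξ r) l m *
                (ξ ^ (s - (N - r + m)) * vcoef N d A ξ r m s))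
              = (ξ ^ D)⁻¹ * (ξ ^ weightExp l m * ξ ^ (s - (N - r + m))) *
                (weight d ξ (coefB N d A ξ r) l m * vcoef N d A ξ r m s) := by ring
            _ = _ := by rw [h1, inv_mul_cancel_left₀ h2.ne']
        · intro h3 h4
          have hD0 : D = 0 := by
            unfold weightExp at hD
            split_ifs at hD <;> omega
          rw [if_pos hD0]
          have := hgpos (by omega) (by omega) (by omega)
          positivity
      choose! g hg0 hg hgpos using h
      refine ⟨∑ m ∈ Finset.Icc 1 (d + 1), g m, Finset.sum_nonneg hg0, ?_, ?_⟩
      · refine (Asy.sum _ hg).congr' (Eventually.of_forall fun ξ => ?_)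
        simp only [Finset.mul_sum]
      · intro _ hs1 hs2
        refine Finset.sum_pos' hg0 ?_
        -- A summand of leading order with positive limit: `m = l` if `s` is at least `N - r + l`;
        -- otherwise `s = N - r + l - 1`, and `m = l - 1` meets the diagonal entry.
        by_cases hs : N - r + l ≤ s
        · exact ⟨l, hl, hgpos l hl (by omega) hs2⟩
        · have hl' : l - 1 ∈ Finset.Icc 1 (d + 1) := Finset.mem_Icc.2 (by omega)
          exact ⟨l - 1, hl', hgpos _ hl' (by omega) hs2⟩

/-- The parameters `ε^{(r)}_j` have the order of magnitude `ξ ^ (-j)`. -/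
lemma asy_pow_mul_coefEps (hA : IsNormalizedBandedTP N (N + d) A) (hd : 1 ≤ d) (hr : 1 ≤ r)
    (hrN : r ≤ N) {j : ℕ} (hj : j ∈ Finset.Icc 1 (r - 1)) :
    ∃ c, 0 < c ∧ Asy (fun ξ => ξ ^ j * coefEps N d A ξ r j) c := by
  -- Descending induction on `j`: the equation that determines `ε_j` also contains the `ε_i` with `i
  -- > j`.
  suffices h : ∀ n j, r - 1 - j = n → j ∈ Finset.Icc 1 (r - 1) →
      ∃ c, 0 < c ∧ Asy (fun ξ => ξ ^ j * coefEps N d A ξ r j) c from h _ j rfl hj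
  intro n
  induction n using Nat.strong_induction_on with
  | _ n ih =>
  intro j hjn hj
  rw [Finset.mem_Icc] at hj
  -- This is the last column in the band of row `N - r + 1 + j`. The rows `N - r + 1 + i` with `i <
  -- j` vanish there, including the right-hand side `i = 0`.
  set s := N + d - r + 1 + j with hs
  have hrow : A (N - r + 1) s = 0 := hA.apply_eq_zero (Finset.mem_Icc.2 (by omega))
    (Finset.mem_Icc.2 (by omega)) (by omega)
  have hlow : ∀ i ∈ Finset.Icc 1 (r - 1), i ∉ Finset.Icc j (r - 1) → A (N - r + 1 + i) s = 0 := by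
    intro i hi hi'
    rw [Finset.mem_Icc] at hi hi'
    exact hA.apply_eq_zero (Finset.mem_Icc.2 (by omega)) (Finset.mem_Icc.2 (by omega)) (by omega)
  have hdiag : 0 < A (N - r + 1 + j) s :=
    hA.apply_pos (Finset.mem_Icc.2 (by omega)) (by omega) (by omega)
  have hv := asy_vcoef hA hr hrN
  -- The term of index `l` has order `ξ ^ (-(d + 1 - l + j))` at most, so after multiplication by `ξ
  -- ^ j` only `l = d + 1` survives. Since `d ≥ 1` this index is at least `2`, which yields a
  -- positive limit.
  have h1 : ∀ l ∈ Finset.Icc 1 (d + 1), ∃ g, 0 ≤ g ∧ (l = d + 1 → 0 < g) ∧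
      Asy (fun ξ => ξ ^ j * (levelSol N d A r (vcoef N d A ξ r) (l - 1) *
        vcoef N d A ξ r l s)) g := by
    intro l hl
    obtain ⟨g, hg0, hg, hgpos⟩ := asy_pow_mul_vcoef hA hr hrN hl s
    have hsol := asy_levelSol hA hr hrN hv (l - 1)
    rw [Finset.mem_Icc] at hl
    rw [if_pos (by omega), Nat.sub_add_cancel hl.1] at hsol
    have hB := Bhat_pos hA hr hrN hl.1 hl.2
    refine ⟨if d + 1 - l = 0 then Bhat N A r l * g else 0, ?_, ?_,
      ((hsol.mul hg).inv_pow_mul (d + 1 - l)).congr' ?_⟩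
    · split_ifs
      · positivity
      · exact le_rfl
    · intro h
      rw [if_pos (by omega)]
      exact mul_pos hB (hgpos (by omega) (by omega) (by omega))
    · filter_upwards [eventually_gt_atTop 0] with ξ hξ
      have h2 : 0 < ξ ^ (d + 1 - l) := by positivity
      rw [show s - (N - r + l) = (d + 1 - l) + j by omega, pow_add]
      field_simp
  choose! g hg0 hgpos hg using h1
  -- By the induction hypothesis the later `ε_i` have order `ξ ^ (-i)`, which is negligible against
  -- `ξ ^ (-j)`.
  have h2 : ∀ i ∈ Finset.Icc (j + 1) (r - 1),
      Asy (fun ξ => ξ ^ j * (coefEps N d A ξ r i * A (N - r + 1 + i) s)) 0 := by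
    intro i hi
    rw [Finset.mem_Icc] at hi
    obtain ⟨c, _, hc⟩ := ih (r - 1 - i) (by omega) i rfl (Finset.mem_Icc.2 (by omega))
    have := (hc.mul (Asy.const (A (N - r + 1 + i) s))).inv_pow_mul (i - j)
    rw [if_neg (by omega)] at this
    refine this.congr' ?_
    filter_upwards [eventually_gt_atTop 0] with ξ hξ
    have h2 : 0 < ξ ^ (i - j) := by positivity
    have h3 : ξ ^ i = ξ ^ (i - j) * ξ ^ j := by rw [← pow_add]; congr 1; omega
    rw [h3]
    field_simp
  have h3 := ((Asy.sum _ hg).sub (Asy.sum _ h2)).div (Asy.const (A (N - r + 1 + j) s)) hdiag.ne'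
  rw [Finset.sum_const_zero, sub_zero] at h3
  refine ⟨_, div_pos (Finset.sum_pos' hg0
    ⟨d + 1, by simp, hgpos _ (by simp) rfl⟩) hdiag, h3.congr' ?_⟩
  filter_upwards [eventually_det_levelMatrix_ne_zero hA hr hrN hv] with ξ hξ
  have h4 := isLevelSol_levelSol hr hrN hξ s (Finset.mem_Icc.2 (by omega))
  have h5 : ∑ i ∈ Finset.Icc 1 (r - 1), levelEps N d A r (vcoef N d A ξ r) i *
      A (N - r + 1 + i) s = coefEps N d A ξ r j * A (N - r + 1 + j) s +
      ∑ i ∈ Finset.Icc (j + 1) (r - 1), coefEps N d A ξ r i * A (N - r + 1 + i) s := by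
    rw [← Finset.sum_subset (s₁ := Finset.Icc j (r - 1)),
      ← Finset.add_sum_Ioc_eq_sum_Icc hj.2,
      show Finset.Icc (j + 1) (r - 1) = Finset.Ioc j (r - 1) by ext; simp]
    · rfl
    · intro i hi
      rw [Finset.mem_Icc] at *
      omega
    · intro i hi hi'
      rw [hlow i hi hi', mul_zero]
  rw [hrow, zero_add, h5] at h4
  rw [← Finset.mul_sum, ← Finset.mul_sum, div_eq_iff hdiag.ne', h4]
  ring

end

end

section

/-! ### Interlacing roots -/

open Polynomial in
/-- `∑_l a_l ∏_{j ≠ l} (X - λ_j)`. -/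
def nodePoly (d : ℕ) (lm a : ℕ → ℝ) : ℝ[X] :=
  ∑ l ∈ Finset.Icc 1 (d + 1), C (a l) * ∏ j ∈ (Finset.Icc 1 (d + 1)).erase l, (X - C (lm j))

open Polynomial in
/-- `∏_n (X - x_n)`. -/
def rootPoly (d : ℕ) (x : ℕ → ℝ) : ℝ[X] := ∏ n ∈ Finset.Icc 1 d, (X - C (x n))

/-- `x_n` lies in the open interval `]λ_{n+1}, λ_n[`, for all `n ∈ [d]`. -/
def Interlaced (d : ℕ) (lm x : ℕ → ℝ) : Prop :=
  ∀ n ∈ Finset.Icc 1 d, x n ∈ Set.Ioo (lm (n + 1)) (lm n)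

/-- The sequence `λ_1 > λ_2 > … > λ_{d+1}` is strictly decreasing. -/
def Decreasing (d : ℕ) (lm : ℕ → ℝ) : Prop := StrictAntiOn lm (Set.Icc 1 (d + 1))

section
variable {d : ℕ} {lm a x y : ℕ → ℝ}

lemma Interlaced.lt_node (hlm : Decreasing d lm) (hx : Interlaced d lm x) {n l : ℕ}
    (hn : n ∈ Finset.Icc 1 d) (hl : 1 ≤ l) (hln : l ≤ n) : x n < lm l := by
  rw [Finset.mem_Icc] at hn
  refine (hx n (Finset.mem_Icc.2 hn)).2.trans_le ?_
  exact hlm.antitoneOn ⟨hl, by omega⟩ ⟨hn.1, by omega⟩ hln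

lemma Interlaced.node_lt (hlm : Decreasing d lm) (hx : Interlaced d lm x) {n l : ℕ}
    (hn : n ∈ Finset.Icc 1 d) (hl : l ≤ d + 1) (hln : n < l) : lm l < x n := by
  rw [Finset.mem_Icc] at hn
  refine (hlm.antitoneOn ⟨by omega, by omega⟩ ⟨by omega, hl⟩ hln).trans_lt ?_
  exact (hx n (Finset.mem_Icc.2 hn)).1

lemma Interlaced.ne_node (hlm : Decreasing d lm) (hx : Interlaced d lm x) {n l : ℕ}
    (hn : n ∈ Finset.Icc 1 d) (hl : l ∈ Finset.Icc 1 (d + 1)) : lm l ≠ x n := by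
  rw [Finset.mem_Icc] at hl
  rcases Nat.lt_or_ge n l with h | h
  · exact (hx.node_lt hlm hn hl.2 h).ne
  · exact (hx.lt_node hlm hn hl.1 h).ne'

lemma Interlaced.eq_of_mem (hlm : Decreasing d lm) (hx : Interlaced d lm x) {n m : ℕ} {z : ℝ}
    (hn : n ∈ Finset.Icc 1 d) (hm : m ∈ Finset.Icc 1 d) (hz : z ∈ Set.Icc (lm (n + 1)) (lm n))
    (h : z = x m) : m = n := by
  subst h
  have hn' := Finset.mem_Icc.1 hn
  rcases Nat.lt_trichotomy m n with h | h | h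
  · exact absurd hz.2 (not_le.2 (hx.node_lt hlm hm (by omega) h))
  · exact h
  · exact absurd hz.1 (not_le.2 (hx.lt_node hlm hm (by omega) (by omega)))

lemma Interlaced.injOn (hlm : Decreasing d lm) (hx : Interlaced d lm x) :
    Set.InjOn x (Finset.Icc 1 d) := by
  intro n hn m hm h
  exact (hx.eq_of_mem hlm hn hm (Set.Ioo_subset_Icc_self (hx n hn)) h).symm

lemma eval_nodePoly (z : ℝ) : (nodePoly d lm a).eval z =
    ∑ l ∈ Finset.Icc 1 (d + 1), a l * ∏ j ∈ (Finset.Icc 1 (d + 1)).erase l, (z - lm j) := by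
  simp [nodePoly, Polynomial.eval_finsetSum, Polynomial.eval_prod]

lemma eval_nodePoly_node {l : ℕ} (hl : l ∈ Finset.Icc 1 (d + 1)) :
    (nodePoly d lm a).eval (lm l) =
      a l * ∏ j ∈ (Finset.Icc 1 (d + 1)).erase l, (lm l - lm j) := by
  rw [eval_nodePoly, Finset.sum_eq_single_of_mem l hl]
  intro m _ hml
  rw [Finset.prod_eq_zero (i := l), mul_zero]
  · exact Finset.mem_erase.2 ⟨hml.symm, hl⟩
  · exact sub_self _

lemma eval_rootPoly (z : ℝ) : (rootPoly d x).eval z = ∏ n ∈ Finset.Icc 1 d, (z - x n) := by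
  simp [rootPoly, Polynomial.eval_prod]

/-- At a node a single summand survives. For two neighbouring nodes the remaining products have
equal signs factor by factor, except for the difference of the two nodes themselves. -/
lemma eval_nodePoly_mul_neg (hlm : Decreasing d lm) (ha : ∀ l ∈ Finset.Icc 1 (d + 1), 0 < a l)
    {n : ℕ} (hn : n ∈ Finset.Icc 1 d) :
    (nodePoly d lm a).eval (lm (n + 1)) * (nodePoly d lm a).eval (lm n) < 0 := by
  have hn' := Finset.mem_Icc.1 hn
  have h1 : n ∈ Finset.Icc 1 (d + 1) := Finset.mem_Icc.2 (by omega)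
  have h2 : n + 1 ∈ Finset.Icc 1 (d + 1) := Finset.mem_Icc.2 (by omega)
  rw [eval_nodePoly_node h1, eval_nodePoly_node h2,
    ← Finset.mul_prod_erase _ _ (Finset.mem_erase.2 ⟨by omega, h1⟩ :
      n ∈ (Finset.Icc 1 (d + 1)).erase (n + 1)),
    ← Finset.mul_prod_erase _ _ (Finset.mem_erase.2 ⟨by omega, h2⟩ :
      n + 1 ∈ (Finset.Icc 1 (d + 1)).erase n), Finset.erase_right_comm]
  have hgap : lm (n + 1) < lm n := hlm ⟨by omega, by omega⟩ ⟨by omega, by omega⟩ (by omega)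
  have hpos : 0 < (∏ j ∈ ((Finset.Icc 1 (d + 1)).erase n).erase (n + 1), (lm (n + 1) - lm j)) *
      ∏ j ∈ ((Finset.Icc 1 (d + 1)).erase n).erase (n + 1), (lm n - lm j) := by
    rw [← Finset.prod_mul_distrib]
    refine Finset.prod_pos fun j hj => ?_
    rw [Finset.mem_erase, Finset.mem_erase, Finset.mem_Icc] at hj
    rcases Nat.lt_or_ge j n with h | h
    · refine mul_pos_of_neg_of_neg (sub_neg.2 ?_) (sub_neg.2 ?_)
      · exact hlm ⟨by omega, by omega⟩ ⟨by omega, by omega⟩ (by omega)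
      · exact hlm ⟨by omega, by omega⟩ ⟨by omega, by omega⟩ (by omega)
    · refine mul_pos (sub_pos.2 ?_) (sub_pos.2 ?_)
      · exact hlm ⟨by omega, by omega⟩ ⟨by omega, by omega⟩ (by omega)
      · exact hlm ⟨by omega, by omega⟩ ⟨by omega, by omega⟩ (by omega)
  have := mul_pos (mul_pos (ha _ h1) (ha _ h2))
    (mul_pos (mul_pos (sub_pos.2 hgap) (sub_pos.2 hgap)) hpos)
  nlinarith [this]

open Polynomial in
lemma prod_X_sub_C_sub_mem_degreeLT {s t : Finset ℕ} (h : s.card = t.card) (f g : ℕ → ℝ) :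
    (∏ j ∈ s, (X - C (f j)) - ∏ j ∈ t, (X - C (g j))) ∈ degreeLT ℝ t.card := by
  rw [mem_degreeLT]
  have h1 : (∏ j ∈ s, (X - C (f j))).Monic := monic_prod_of_monic _ _ fun _ _ => monic_X_sub_C _
  have h2 : (∏ j ∈ t, (X - C (g j))).Monic := monic_prod_of_monic _ _ fun _ _ => monic_X_sub_C _
  have d1 : (∏ j ∈ s, (X - C (f j))).degree = (t.card : WithBot ℕ) := by
    rw [degree_prod]; simp [h]
  have d2 : (∏ j ∈ t, (X - C (g j))).degree = (t.card : WithBot ℕ) := by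
    rw [degree_prod]; simp
  rw [← d1]
  exact degree_sub_lt_left (d1.trans d2.symm) h1.ne_zero (by rw [h1.leadingCoeff, h2.leadingCoeff])

lemma card_erase_Icc {l : ℕ} (hl : l ∈ Finset.Icc 1 (d + 1)) :
    ((Finset.Icc 1 (d + 1)).erase l).card = (Finset.Icc 1 d).card := by
  rw [Finset.card_erase_of_mem hl]; simp

open Polynomial in
-- The leading coefficient of the node polynomial is `∑ a_l`. No relation between `x` and the nodes
-- is needed, so this serves both existence of the roots and uniqueness of the poles.
lemma nodePoly_sub_mem_degreeLT (d : ℕ) (lm a x : ℕ → ℝ) :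
    nodePoly d lm a - C (∑ l ∈ Finset.Icc 1 (d + 1), a l) * rootPoly d x ∈ degreeLT ℝ d := by
  have : nodePoly d lm a - C (∑ l ∈ Finset.Icc 1 (d + 1), a l) * rootPoly d x =
      ∑ l ∈ Finset.Icc 1 (d + 1), a l • (∏ j ∈ (Finset.Icc 1 (d + 1)).erase l, (X - C (lm j)) -
        ∏ n ∈ Finset.Icc 1 d, (X - C (x n))) := by
    simp only [nodePoly, rootPoly, map_sum, Finset.sum_mul, ← Finset.sum_sub_distrib, smul_eq_C_mul,
      mul_sub]
  rw [this]
  refine Submodule.sum_mem _ fun l hl => Submodule.smul_mem _ _ ?_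
  have := prod_X_sub_C_sub_mem_degreeLT (card_erase_Icc hl) lm x
  simpa using this

/-- A polynomial with positive node coefficients has one root in each gap. -/
lemma exists_interlaced (hlm : Decreasing d lm) (ha : ∀ l ∈ Finset.Icc 1 (d + 1), 0 < a l) :
    ∃ x, Interlaced d lm x ∧
      nodePoly d lm a = Polynomial.C (∑ l ∈ Finset.Icc 1 (d + 1), a l) * rootPoly d x := by
  have h : ∀ n ∈ Finset.Icc 1 d, ∃ z ∈ Set.Ioo (lm (n + 1)) (lm n),
      (nodePoly d lm a).eval z = 0 := by
    intro n hn
    have hneg := eval_nodePoly_mul_neg hlm ha hn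
    have hn' := Finset.mem_Icc.1 hn
    have hgap : lm (n + 1) < lm n := hlm ⟨by omega, by omega⟩ ⟨by omega, by omega⟩ (by omega)
    have hc : ContinuousOn (fun z => (nodePoly d lm a).eval z) (Set.Icc (lm (n + 1)) (lm n)) :=
      (nodePoly d lm a).continuous.continuousOn
    rcases mul_neg_iff.1 hneg with ⟨h1, h2⟩ | ⟨h1, h2⟩
    · obtain ⟨z, hz, hz0⟩ := intermediate_value_Ioo' hgap.le hc ⟨h2, h1⟩
      exact ⟨z, hz, hz0⟩
    · obtain ⟨z, hz, hz0⟩ := intermediate_value_Ioo hgap.le hc ⟨h1, h2⟩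
      exact ⟨z, hz, hz0⟩
  choose! x hx hx0 using h
  have hx' : Interlaced d lm x := hx
  refine ⟨x, hx', sub_eq_zero.1 ?_⟩
  -- The difference has degree less than `d` and vanishes at the `d` distinct roots found in the
  -- gaps.
  refine Polynomial.eq_zero_of_degree_lt_of_eval_index_eq_zero (s := Finset.Icc 1 d)
    (hx'.injOn hlm) ?_ fun n hn => ?_
  · have := Polynomial.mem_degreeLT.1 (nodePoly_sub_mem_degreeLT d lm a x)
    simpa using this
  · rw [Polynomial.eval_sub, hx0 n hn, Polynomial.eval_mul, eval_rootPoly,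
      Finset.prod_eq_zero hn (sub_self _)]
    simp

lemma Interlaced.eq_of_rootPoly (hlm : Decreasing d lm) (hx : Interlaced d lm x)
    (hy : Interlaced d lm y) (h : rootPoly d x = rootPoly d y) {n : ℕ} (hn : n ∈ Finset.Icc 1 d) :
    x n = y n := by
  have h1 : (rootPoly d y).eval (x n) = 0 := by
    rw [← h, eval_rootPoly, Finset.prod_eq_zero hn (sub_self _)]
  rw [eval_rootPoly, Finset.prod_eq_zero_iff] at h1
  obtain ⟨m, hm, hmn⟩ := h1
  rw [sub_eq_zero] at hmn
  have := hy.eq_of_mem hlm hn hm (Set.Ioo_subset_Icc_self (hx n hn)) hmn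
  rwa [this] at hmn

/-- A polynomial of degree at most `d` is determined by its values at the nodes. -/
lemma nodePoly_eq_rootPoly (hlm : Decreasing d lm)
    (h : ∀ l ∈ Finset.Icc 1 (d + 1), a l * ∏ j ∈ (Finset.Icc 1 (d + 1)).erase l, (lm l - lm j) =
      ∏ n ∈ Finset.Icc 1 d, (lm l - x n)) : nodePoly d lm a = rootPoly d x := by
  refine sub_eq_zero.1 (Polynomial.eq_zero_of_degree_lt_of_eval_index_eq_zero
    (s := Finset.Icc 1 (d + 1)) (v := lm) ?_ ?_ fun l hl => ?_)
  · rw [Finset.coe_Icc]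
    exact hlm.injOn
  · have h1 : rootPoly d x ∈ Polynomial.degreeLT ℝ (d + 1) := by
      rw [Polynomial.mem_degreeLT, rootPoly, Polynomial.degree_prod]
      simp only [Polynomial.degree_X_sub_C, Finset.sum_const, Nat.card_Icc, Nat.add_sub_cancel,
        nsmul_one]
      exact_mod_cast Nat.lt_succ_self d
    have h2 := Polynomial.degreeLT_mono (Nat.le_succ d) (nodePoly_sub_mem_degreeLT d lm a x)
    have h3 := Submodule.add_mem _ h2
      (Submodule.smul_mem _ (∑ l ∈ Finset.Icc 1 (d + 1), a l - 1) h1)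
    rw [Polynomial.smul_eq_C_mul, map_sub, map_one, sub_mul, one_mul, sub_add_sub_cancel,
      Polynomial.mem_degreeLT] at h3
    simpa using h3
  · rw [Polynomial.eval_sub, eval_nodePoly_node hl, eval_rootPoly, h l hl, sub_self]

open scoped Classical in
/-- The roots of `∑_l a_l ∏_{j ≠ l} (X - λ_j)` in the gaps. -/
def gapRoots (d : ℕ) (lm a : ℕ → ℝ) : ℕ → ℝ :=
  if h : ∃ x, Interlaced d lm x ∧
    nodePoly d lm a = Polynomial.C (∑ l ∈ Finset.Icc 1 (d + 1), a l) * rootPoly d x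
  then h.choose else 0

lemma gapRoots_spec (hlm : Decreasing d lm) (ha : ∀ l ∈ Finset.Icc 1 (d + 1), 0 < a l) :
    Interlaced d lm (gapRoots d lm a) ∧ nodePoly d lm a =
      Polynomial.C (∑ l ∈ Finset.Icc 1 (d + 1), a l) * rootPoly d (gapRoots d lm a) := by
  have h := exists_interlaced hlm ha
  rw [gapRoots, dif_pos h]
  exact h.choose_spec

lemma nodePoly_congr {a' : ℕ → ℝ} (h : ∀ l ∈ Finset.Icc 1 (d + 1), a l = a' l) :
    nodePoly d lm a = nodePoly d lm a' :=
  Finset.sum_congr rfl fun l hl => by rw [h l hl]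

lemma gapRoots_congr {a' : ℕ → ℝ} (h : ∀ l ∈ Finset.Icc 1 (d + 1), a l = a' l) :
    gapRoots d lm a = gapRoots d lm a' := by
  unfold gapRoots
  rw [nodePoly_congr h, Finset.sum_congr rfl h]

lemma sum_mul_prod_eq (hlm : Decreasing d lm) (ha : ∀ l ∈ Finset.Icc 1 (d + 1), 0 < a l) (z : ℂ) :
    ∑ l ∈ Finset.Icc 1 (d + 1), (a l : ℂ) * ∏ j ∈ (Finset.Icc 1 (d + 1)).erase l, (z - lm j) =
      ((∑ l ∈ Finset.Icc 1 (d + 1), a l : ℝ) : ℂ) *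
        ∏ n ∈ Finset.Icc 1 d, (z - gapRoots d lm a n) := by
  have := congrArg (Polynomial.aeval z) (gapRoots_spec hlm ha).2
  simpa [nodePoly, rootPoly, map_sum, map_prod] using this

lemma sum_mul_prod_eq_real (hlm : Decreasing d lm) (ha : ∀ l ∈ Finset.Icc 1 (d + 1), 0 < a l)
    (z : ℝ) :
    ∑ l ∈ Finset.Icc 1 (d + 1), a l * ∏ j ∈ (Finset.Icc 1 (d + 1)).erase l, (z - lm j) =
      (∑ l ∈ Finset.Icc 1 (d + 1), a l) * ∏ n ∈ Finset.Icc 1 d, (z - gapRoots d lm a n) := by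
  have := congrArg (Polynomial.eval z) (gapRoots_spec hlm ha).2
  rwa [eval_nodePoly, Polynomial.eval_mul, eval_rootPoly, Polynomial.eval_C] at this

end

/-! ### Rational functions at infinity -/

lemma tendsto_prod_sub_div_pow (s : Finset ℕ) (f : ℕ → ℂ) :
    Tendsto (fun z : ℂ => (∏ j ∈ s, (z - f j)) / z ^ s.card) (cocompact ℂ) (𝓝 1) := by
  have h : ∀ j ∈ s, Tendsto (fun z : ℂ => 1 - f j * z⁻¹) (cocompact ℂ) (𝓝 1) := by
    intro j _
    have := (tendsto_inv₀_cobounded (α := ℂ)).const_mul (f j)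
    rw [Metric.cobounded_eq_cocompact] at this
    simpa using this.const_sub 1
  have h2 := tendsto_finsetProd s h
  rw [Finset.prod_const_one] at h2
  refine h2.congr' ?_
  have : ∀ᶠ z : ℂ in cocompact ℂ, z ≠ 0 := by
    rw [← Metric.cobounded_eq_cocompact]
    exact Bornology.eventually_ne_cobounded 0
  filter_upwards [this] with z hz
  rw [← Finset.prod_const, ← Finset.prod_div_distrib]
  exact Finset.prod_congr rfl fun j _ => by field_simp

lemma tendsto_prod_sub_div_prod_sub {s t : Finset ℕ} (hst : s.card = t.card) (f g : ℕ → ℂ) :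
    Tendsto (fun z : ℂ => (∏ j ∈ s, (z - f j)) / ∏ j ∈ t, (z - g j)) (cocompact ℂ) (𝓝 1) := by
  have := (tendsto_prod_sub_div_pow s f).div (tendsto_prod_sub_div_pow t g) one_ne_zero
  rw [div_one] at this
  refine this.congr' ?_
  have : ∀ᶠ z : ℂ in cocompact ℂ, z ≠ 0 := by
    rw [← Metric.cobounded_eq_cocompact]
    exact Bornology.eventually_ne_cobounded 0
  filter_upwards [this] with z hz
  rw [Pi.div_apply, hst, div_div_div_cancel_right₀ (pow_ne_zero _ hz)]

/-- Each summand has `d` monic linear factors in the numerator and in the denominator, so only its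
coefficient is left at infinity. -/
lemma tendsto_sum_term {d : ℕ} (B lm b V : ℕ → ℂ) :
    Tendsto (fun z : ℂ => ∑ l ∈ Finset.Icc 1 (d + 1), term d B lm b l z * V l) (cocompact ℂ)
      (𝓝 (∑ l ∈ Finset.Icc 1 (d + 1), B l * V l)) := by
  refine tendsto_finsetSum _ fun l hl => ?_
  have := ((tendsto_prod_sub_div_prod_sub (card_erase_Icc hl) lm b).const_mul (B l)).mul_const (V l)
  rw [mul_one] at this
  refine this.congr fun z => ?_
  rw [term]
  ring

/-! ### Independence of the exponentials -/

/-- The times `(τ, 0, 0, …)`. -/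
def firstTime (τ : ℝ) (i : ℕ) : ℝ := if i = 0 then τ else 0

lemma admissible_firstTime (τ : ℝ) : Admissible (firstTime τ) := by
  intro x
  refine summable_of_ne_finset_zero (s := {0}) fun i hi => ?_
  rw [Finset.mem_singleton] at hi
  simp [firstTime, hi]

lemma theta_firstTime (x τ : ℝ) : theta x (firstTime τ) = x * τ := by
  unfold theta
  rw [tsum_eq_single 0]
  · simp [firstTime]
  · intro i hi
    simp [firstTime, hi]

lemma theta_zero (x : ℝ) : theta x 0 = 0 := by simp [theta]

lemma admissible_zero : Admissible 0 := fun x => by simp [summable_zero]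

/-- The times `(i, 0, 0, …)`, `i = 0, 1, …`, already suffice: they give a Vandermonde system with
the distinct nodes `e^{k_s}`. -/
lemma eq_zero_of_sum_exp_eq_zero {M : ℕ} {k : ℕ → ℝ} (hk : StrictMonoOn k (Set.Icc 1 M))
    {c : ℕ → ℝ} (h : ∀ t, Admissible t →
      ∑ s ∈ Finset.Icc 1 M, c s * Real.exp (theta (k s) t) = 0) :
    ∀ s ∈ Finset.Icc 1 M, c s = 0 := by
  have hinj : Function.Injective fun j : Fin M => Real.exp (k (j + 1)) := by
    intro i j hij
    have := hk.injOn ⟨by omega, by omega⟩ ⟨by omega, by omega⟩ (Real.exp_injective hij)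
    exact Fin.ext (by omega)
  have h0 : (fun j : Fin M => c (j + 1)) = 0 := by
    refine Matrix.eq_zero_of_forall_pow_sum_mul_pow_eq_zero hinj fun i => ?_
    have := h _ (admissible_firstTime i)
    rw [sum_Icc_one, ← Fin.sum_univ_eq_sum_range
      (fun j => c (j + 1) * Real.exp (theta (k (j + 1)) (firstTime i)))] at this
    rw [← this]
    refine Finset.sum_congr rfl fun j _ => ?_
    rw [theta_firstTime, ← Real.exp_nat_mul, mul_comm (k _)]
  intro s hs
  rw [Finset.mem_Icc] at hs
  have := congrFun h0 ⟨s - 1, by omega⟩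
  simpa [Nat.sub_add_cancel hs.1] using this

end

section

/-! ### The vacuum wave function -/

lemma decreasing_lam (d : ℕ) {ξ : ℝ} (hξ : 1 < ξ) : Decreasing d (lam ξ) :=
  fun _ hl _ _ hlm => lam_lt hξ hl.1 hlm

lemma thetaC_ofReal (x : ℝ) (t : ℕ → ℝ) : thetaC x t = theta x t := by
  unfold thetaC theta
  push_cast
  rfl

lemma term_ofReal (d : ℕ) (B lm b : ℕ → ℝ) (l : ℕ) (z : ℝ) :
    term d (fun j => (B j : ℂ)) (fun j => (lm j : ℂ)) (fun n => (b n : ℂ)) l z =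
      ((term d B lm b l z : ℝ) : ℂ) := by
  unfold term
  push_cast
  rfl

lemma sum_term_mul {K : Type*} [Field K] (d : ℕ) (B lm b V : ℕ → K) (z : K) :
    ∑ l ∈ Finset.Icc 1 (d + 1), term d B lm b l z * V l =
      (∑ l ∈ Finset.Icc 1 (d + 1),
        B l * V l * ∏ j ∈ (Finset.Icc 1 (d + 1)).erase l, (z - lm j)) /
      ∏ n ∈ Finset.Icc 1 d, (z - b n) := by
  rw [Finset.sum_div]
  refine Finset.sum_congr rfl fun l _ => ?_
  rw [term]
  ring

lemma sum_term_node {K : Type*} [Field K] {d : ℕ} (B lm b V : ℕ → K) {l : ℕ}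
    (hl : l ∈ Finset.Icc 1 (d + 1)) :
    ∑ m ∈ Finset.Icc 1 (d + 1), term d B lm b m (lm l) * V m = term d B lm b l (lm l) * V l := by
  refine Finset.sum_eq_single_of_mem l hl fun m _ hml => ?_
  rw [term, Finset.prod_eq_zero (Finset.mem_erase.2 ⟨hml.symm, hl⟩) (sub_self _)]
  simp

section
variable {N d : ℕ} {A : ℕ → ℕ → ℝ} {k : ℕ → ℝ} {ξ : ℝ} {W W' : Data} {r l : ℕ} {t : ℕ → ℝ}

lemma V_one : V N (N + d) k ξ W 1 l t = Real.exp (theta (k (N + l - 1)) t) := rfl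

lemma V_succ_one (hr : 1 ≤ r) :
    V N (N + d) k ξ W (r + 1) 1 t = Real.exp (theta (k (N - (r + 1) + 1)) t) := by
  obtain ⟨r, rfl⟩ : ∃ r', r = r' + 1 := ⟨r - 1, by omega⟩
  simp [V]

lemma V_succ (hr : 1 ≤ r) (hl : l ≠ 1) : V N (N + d) k ξ W (r + 1) l t =
    ∑ m ∈ Finset.Icc 1 (d + 1),
      term d (W.B r) (lam ξ) (W.b r) m (alpha ξ l) * V N (N + d) k ξ W r m t := by
  obtain ⟨r, rfl⟩ : ∃ r', r = r' + 1 := ⟨r - 1, by omega⟩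
  simp only [V, if_neg hl, Nat.add_sub_cancel_left]

lemma psi_zero (z : ℂ) : psi N (N + d) k ξ W 0 t z = Complex.exp (thetaC z t) := by simp [psi]

lemma psi_pos (hr : 1 ≤ r) (z : ℂ) : psi N (N + d) k ξ W r t z =
    ∑ l ∈ Finset.Icc 1 (d + 1), term d (fun j => (W.B r j : ℂ)) (fun j => (lam ξ j : ℂ))
      (fun n => (W.b r n : ℂ)) l z * (V N (N + d) k ξ W r l t : ℂ) := by
  simp only [psi, if_neg (show r ≠ 0 by omega), Nat.add_sub_cancel_left]

lemma psi_ofReal (hr : 1 ≤ r) (x : ℝ) : psi N (N + d) k ξ W r t x =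
    ((∑ l ∈ Finset.Icc 1 (d + 1), term d (W.B r) (lam ξ) (W.b r) l x *
      V N (N + d) k ξ W r l t : ℝ) : ℂ) := by
  rw [psi_pos hr]
  simp only [term_ofReal]
  push_cast
  rfl

/-- The values at the points glued to `λ_l`. -/
lemma psi_glue_base : psi N (N + d) k ξ W 0 t (k (N + l - 1) : ℝ) =
    (V N (N + d) k ξ W 1 l t : ℂ) := by
  rw [psi_zero, thetaC_ofReal, V_one, Complex.ofReal_exp]

lemma psi_glue_first (hr : 2 ≤ r) : psi N (N + d) k ξ W 0 t (k (N - r + 1) : ℝ) =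
    (V N (N + d) k ξ W r 1 t : ℂ) := by
  obtain ⟨r, rfl⟩ : ∃ r', r = r' + 1 := ⟨r - 1, by omega⟩
  rw [psi_zero, thetaC_ofReal, V_succ_one (by omega), Complex.ofReal_exp]

lemma psi_glue_chain (hr : 2 ≤ r) (hl : 2 ≤ l) : psi N (N + d) k ξ W (r - 1) t (alpha ξ l : ℝ) =
    (V N (N + d) k ξ W r l t : ℂ) := by
  obtain ⟨r, rfl⟩ : ∃ r', r = r' + 1 := ⟨r - 1, by omega⟩
  rw [Nat.add_sub_cancel, psi_ofReal (by omega), V_succ (by omega) (by omega)]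

/-- Only the parameters of the sheets before `Γ_r` enter, which makes uniqueness an induction on
`r`. -/
lemma V_congr (h : ∀ q ∈ Finset.Icc 1 (r - 1), (∀ l ∈ Finset.Icc 1 (d + 1), W.B q l = W'.B q l) ∧
    ∀ n ∈ Finset.Icc 1 d, W.b q n = W'.b q n) (hr : 1 ≤ r) (l : ℕ) :
    V N (N + d) k ξ W r l t = V N (N + d) k ξ W' r l t := by
  induction r, hr using Nat.le_induction generalizing l with
  | base => rfl
  | succ r hr ih =>
    by_cases hl : l = 1
    · rw [hl, V_succ_one hr, V_succ_one hr]
    · rw [V_succ hr hl, V_succ hr hl]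
      obtain ⟨h1, h2⟩ := h r (Finset.mem_Icc.2 (by omega))
      refine Finset.sum_congr rfl fun m hm => ?_
      have h3 : ∏ n ∈ Finset.Icc 1 d, (alpha ξ l - W.b r n) =
          ∏ n ∈ Finset.Icc 1 d, (alpha ξ l - W'.b r n) :=
        Finset.prod_congr rfl fun n hn => by rw [h2 n hn]
      rw [ih (fun q hq => h q (by rw [Finset.mem_Icc] at *; omega)), term, term, h1 m hm, h3]

end

/-! ### Existence -/

/-- The parameters of the vacuum wave function. -/
def vacuumData (N d : ℕ) (A : ℕ → ℕ → ℝ) (ξ : ℝ) : Data where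
  B := coefB N d A ξ
  b r := gapRoots d (lam ξ) (coefB N d A ξ r)
  ε := coefEps N d A ξ

/-- The linear systems at `ξ` are uniquely solvable, with positive solutions. -/
structure IsRegular (N d : ℕ) (A : ℕ → ℕ → ℝ) (ξ : ℝ) : Prop where
  one_lt : 1 < ξ
  det_ne_zero : ∀ r ∈ Finset.Icc 1 N, (levelMatrix N d A r (vcoef N d A ξ r)).det ≠ 0
  coefB_pos : ∀ r ∈ Finset.Icc 1 N, ∀ l ∈ Finset.Icc 1 (d + 1), 0 < coefB N d A ξ r l
  coefEps_pos : ∀ r ∈ Finset.Icc 1 N, ∀ j ∈ Finset.Icc 1 (r - 1), 0 < coefEps N d A ξ r j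

/-- Each condition is open and holds in the limit, where for the `ε` the rescaled quantity `ξ ^ j
ε_j` has to be used because `ε_j` itself tends to zero. -/
lemma eventually_isRegular {N d : ℕ} {A : ℕ → ℕ → ℝ} (hA : IsNormalizedBandedTP N (N + d) A)
    (hd : 1 ≤ d) : ∀ᶠ ξ in atTop, IsRegular N d A ξ := by
  have h1 : ∀ᶠ ξ in atTop, ∀ r ∈ Finset.Icc 1 N,
      (levelMatrix N d A r (vcoef N d A ξ r)).det ≠ 0 := by
    rw [Filter.eventually_all_finset]
    intro r hr
    rw [Finset.mem_Icc] at hr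
    exact eventually_det_levelMatrix_ne_zero hA hr.1 hr.2 (asy_vcoef hA hr.1 hr.2)
  have h2 : ∀ᶠ ξ in atTop, ∀ r ∈ Finset.Icc 1 N, ∀ l ∈ Finset.Icc 1 (d + 1),
      0 < coefB N d A ξ r l := by
    simp only [Filter.eventually_all_finset]
    intro r hr l hl
    rw [Finset.mem_Icc] at hr
    have hl' := Finset.mem_Icc.1 hl
    exact (asy_coefB hA hr.1 hr.2 hl).tendsto.eventually_const_lt
      (Bhat_pos hA hr.1 hr.2 hl'.1 hl'.2)
  have h3 : ∀ᶠ ξ in atTop, ∀ r ∈ Finset.Icc 1 N, ∀ j ∈ Finset.Icc 1 (r - 1),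
      0 < coefEps N d A ξ r j := by
    simp only [Filter.eventually_all_finset]
    intro r hr j hj
    rw [Finset.mem_Icc] at hr
    obtain ⟨c, hc, h⟩ := asy_pow_mul_coefEps hA hd hr.1 hr.2 hj
    filter_upwards [h.tendsto.eventually_const_lt hc, eventually_gt_atTop 0] with ξ h1 h2
    exact (pos_iff_pos_of_mul_pos h1).1 (by positivity)
  filter_upwards [h1, h2, h3, eventually_gt_atTop 1] with ξ h1 h2 h3 h4
  exact ⟨h4, h1, h2, h3⟩

section
variable {N d : ℕ} {A : ℕ → ℕ → ℝ} {k : ℕ → ℝ} {ξ : ℝ} {r l s : ℕ} {t : ℕ → ℝ}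

lemma vcoef_nonneg (h : IsRegular N d A ξ) (hr : 1 ≤ r) (hrN : r ≤ N) (hl : 1 ≤ l) (s : ℕ) :
    0 ≤ vcoef N d A ξ r l s := by
  have hξ := h.one_lt
  induction r, hr using Nat.le_induction generalizing l with
  | base => rw [vcoef_one]; split_ifs <;> simp
  | succ r hr ih =>
    rcases Nat.lt_or_ge l 2 with hl' | hl'
    · have : l = 1 := by omega
      subst this
      rw [vcoef_succ_one N d A ξ hr]; split_ifs <;> simp
    · rw [vcoef_succ N d A ξ hr hl']
      refine Finset.sum_nonneg fun m hm => mul_nonneg ?_ (ih (by omega) (Finset.mem_Icc.1 hm).1)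
      exact (weight_pos (by linarith) (h.coefB_pos r (Finset.mem_Icc.2 (by omega))) l hm).le

lemma vcoef_eq_zero (hr : 1 ≤ r) (hrN : r ≤ N) (hl : 1 ≤ l) (hs : s < N - r + 1) :
    vcoef N d A ξ r l s = 0 := by
  induction r, hr using Nat.le_induction generalizing l with
  | base => rw [vcoef_one, if_neg (by omega)]
  | succ r hr ih =>
    rcases Nat.lt_or_ge l 2 with hl' | hl'
    · have : l = 1 := by omega
      subst this
      rw [vcoef_succ_one N d A ξ hr, if_neg (by omega)]
    · rw [vcoef_succ N d A ξ hr hl']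
      refine Finset.sum_eq_zero fun m hm => ?_
      rw [ih (by omega) (Finset.mem_Icc.1 hm).1 (by omega), mul_zero]

/-- Only `V^{(r)}_1` involves `e^{θ_{N-r+1}}`. -/
lemma vcoef_first (hr : 1 ≤ r) (hrN : r ≤ N) (hl : 1 ≤ l) :
    vcoef N d A ξ r l (N - r + 1) = if l = 1 then 1 else 0 := by
  rcases Nat.lt_or_ge r 2 with hr2 | hr2
  · have : r = 1 := by omega
    subst this
    exact if_congr (by omega) rfl rfl
  · obtain ⟨r, rfl⟩ : ∃ r', r = r' + 1 := ⟨r - 1, by omega⟩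
    split_ifs with h
    · rw [h, vcoef_succ_one N d A ξ (by omega), if_pos rfl]
    · rw [vcoef_succ N d A ξ (by omega) (by omega)]
      refine Finset.sum_eq_zero fun m hm => ?_
      rw [vcoef_eq_zero (by omega) (by omega) (Finset.mem_Icc.1 hm).1 (by omega), mul_zero]

lemma sum_vcoef (h : IsRegular N d A ξ) (hr : 1 ≤ r) (hrN : r ≤ N)
    (hl : l ∈ Finset.Icc 1 (d + 1)) :
    ∑ s ∈ Finset.Icc 1 (N + d), vcoef N d A ξ r l s = 1 := by
  have hξ := h.one_lt
  induction r, hr using Nat.le_induction generalizing l with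
  | base =>
    simp only [vcoef_one]
    rw [Finset.mem_Icc] at hl
    rw [Finset.sum_ite_eq', if_pos (Finset.mem_Icc.2 (by omega))]
  | succ r hr ih =>
    have hl' := Finset.mem_Icc.1 hl
    by_cases hl1 : l = 1
    · subst hl1
      simp only [vcoef_succ_one N d A ξ hr]
      rw [Finset.sum_ite_eq', if_pos (Finset.mem_Icc.2 (by omega))]
    · simp only [vcoef_succ N d A ξ hr (show 2 ≤ l by omega)]
      rw [Finset.sum_comm, ← sum_weight (by linarith : (0 : ℝ) < ξ)
        (h.coefB_pos r (Finset.mem_Icc.2 (by omega))) l]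
      refine Finset.sum_congr rfl fun m hm => ?_
      rw [← Finset.mul_sum, ih (by omega) hm, mul_one]

lemma one_add_sum_coefEps_pos (h : IsRegular N d A ξ) (hr : r ∈ Finset.Icc 1 N) :
    0 < 1 + ∑ j ∈ Finset.Icc 1 (r - 1), coefEps N d A ξ r j := by
  have := Finset.sum_nonneg fun j hj => (h.coefEps_pos r hr j hj).le
  linarith

/-- The normalized form of the linear system. -/
lemma sum_coefB_mul_vcoef (hA : IsNormalizedBandedTP N (N + d) A) (h : IsRegular N d A ξ)
    (hr : r ∈ Finset.Icc 1 N) (hs : s ∈ Finset.Icc 1 (N + d)) :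
    ∑ l ∈ Finset.Icc 1 (d + 1), coefB N d A ξ r l * vcoef N d A ξ r l s =
      (A (N - r + 1) s + ∑ j ∈ Finset.Icc 1 (r - 1), coefEps N d A ξ r j * A (N - r + 1 + j) s) /
        (1 + ∑ j ∈ Finset.Icc 1 (r - 1), coefEps N d A ξ r j) := by
  have hpos := one_add_sum_coefEps_pos h hr
  have hr' := Finset.mem_Icc.1 hr
  have hs' := Finset.mem_Icc.1 hs
  -- The linear system does not contain the equations for these `s`; they hold because all
  -- coefficients vanish.
  by_cases hsr : s < N - r + 1
  · rw [Finset.sum_eq_zero, hA.apply_eq_zero (Finset.mem_Icc.2 (by omega)) hs (by omega),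
      Finset.sum_eq_zero]
    · simp
    · intro j hj
      rw [Finset.mem_Icc] at hj
      rw [hA.apply_eq_zero (Finset.mem_Icc.2 (by omega)) hs (by omega), mul_zero]
    · intro l hl
      rw [vcoef_eq_zero hr'.1 hr'.2 (Finset.mem_Icc.1 hl).1 hsr, mul_zero]
  · have := isLevelSol_levelSol hr'.1 hr'.2 (h.det_ne_zero r hr) s (Finset.mem_Icc.2 (by omega))
    rw [eq_div_iff hpos.ne', Finset.sum_mul]
    simp only [coefEps] at hpos ⊢
    rw [← this]
    refine Finset.sum_congr rfl fun l _ => ?_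
    rw [coefB, levelB]
    field_simp

/-- Summation of the normalized system over `s`, since the rows of `A` and of `vcoef` all have sum
one. This makes the node polynomial monic. -/
lemma sum_coefB (hA : IsNormalizedBandedTP N (N + d) A) (h : IsRegular N d A ξ)
    (hr : r ∈ Finset.Icc 1 N) : ∑ l ∈ Finset.Icc 1 (d + 1), coefB N d A ξ r l = 1 := by
  have hpos := one_add_sum_coefEps_pos h hr
  have hr' := Finset.mem_Icc.1 hr
  have h1 := Finset.sum_congr rfl fun s (hs : s ∈ Finset.Icc 1 (N + d)) =>
    sum_coefB_mul_vcoef hA h hr hs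
  rw [Finset.sum_comm, ← Finset.sum_div, Finset.sum_add_distrib,
    hA.row_sum _ (Finset.mem_Icc.2 (by omega)), Finset.sum_comm (s := Finset.Icc 1 (N + d))] at h1
  have h2 : ∑ j ∈ Finset.Icc 1 (r - 1), ∑ s ∈ Finset.Icc 1 (N + d),
      coefEps N d A ξ r j * A (N - r + 1 + j) s =
      ∑ j ∈ Finset.Icc 1 (r - 1), coefEps N d A ξ r j := by
    refine Finset.sum_congr rfl fun j hj => ?_
    rw [Finset.mem_Icc] at hj
    rw [← Finset.mul_sum, hA.row_sum _ (Finset.mem_Icc.2 (by omega)), mul_one]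
  rw [h2, div_self hpos.ne'] at h1
  rw [← h1]
  refine Finset.sum_congr rfl fun l hl => ?_
  rw [← Finset.mul_sum, sum_vcoef h hr'.1 hr'.2 hl, mul_one]

lemma interlaced_b (h : IsRegular N d A ξ) (hr : r ∈ Finset.Icc 1 N) :
    Interlaced d (lam ξ) ((vacuumData N d A ξ).b r) :=
  (gapRoots_spec (decreasing_lam d h.one_lt) (h.coefB_pos r hr)).1

/-- The denominator of the wave function is the node polynomial of the `B_l`. Hence `Ψ` is a
weighted mean of the `V_l`, takes the value `V_l` at `λ_l`, and equals one at time zero. -/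
lemma sum_coefB_mul_prod (hA : IsNormalizedBandedTP N (N + d) A) (h : IsRegular N d A ξ)
    (hr : r ∈ Finset.Icc 1 N) (z : ℝ) :
    ∑ l ∈ Finset.Icc 1 (d + 1), coefB N d A ξ r l *
      ∏ j ∈ (Finset.Icc 1 (d + 1)).erase l, (z - lam ξ j) =
    ∏ n ∈ Finset.Icc 1 d, (z - (vacuumData N d A ξ).b r n) := by
  rw [sum_mul_prod_eq_real (decreasing_lam d h.one_lt) (h.coefB_pos r hr), sum_coefB hA h hr,
    one_mul]
  rfl

/-- Division of numerator and denominator by `∏_j (α_l - λ_j)` turns the rational function into the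
weight used in the recursion for `vcoef`. -/
lemma term_alpha (hA : IsNormalizedBandedTP N (N + d) A) (h : IsRegular N d A ξ)
    (hr : r ∈ Finset.Icc 1 N) {m : ℕ} (hm : m ∈ Finset.Icc 1 (d + 1)) :
    term d ((vacuumData N d A ξ).B r) (lam ξ) ((vacuumData N d A ξ).b r) m (alpha ξ l) =
      weight d ξ (coefB N d A ξ r) l m := by
  have hξ : 0 < ξ := by linarith [h.one_lt]
  have hne : ∀ j, alpha ξ l - lam ξ j ≠ 0 := fun j => (alpha_sub_lam_pos hξ l j).ne'
  have hP : ∏ j ∈ Finset.Icc 1 (d + 1), (alpha ξ l - lam ξ j) ≠ 0 :=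
    Finset.prod_ne_zero_iff.2 fun j _ => hne j
  have e : ∀ j ∈ Finset.Icc 1 (d + 1),
      coefB N d A ξ r j * ∏ i ∈ (Finset.Icc 1 (d + 1)).erase j, (alpha ξ l - lam ξ i) =
      (∏ i ∈ Finset.Icc 1 (d + 1), (alpha ξ l - lam ξ i)) *
        (coefB N d A ξ r j / (alpha ξ l - lam ξ j)) := by
    intro j hj
    rw [← Finset.mul_prod_erase _ _ hj]
    have := hne j
    field_simp
  rw [term, ← sum_coefB_mul_prod hA h hr, Finset.sum_congr rfl e]
  change coefB N d A ξ r m * _ / _ = _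
  rw [e m hm, ← Finset.mul_sum, mul_div_mul_left _ _ hP, weight]

/-- Connects the recursion for `vcoef`, in which the phases do not occur, with the recursion for the
wave function. -/
lemma V_vacuumData (hA : IsNormalizedBandedTP N (N + d) A) (h : IsRegular N d A ξ) (hr : 1 ≤ r)
    (hrN : r ≤ N) (hl : l ∈ Finset.Icc 1 (d + 1)) :
    V N (N + d) k ξ (vacuumData N d A ξ) r l t =
      ∑ s ∈ Finset.Icc 1 (N + d), vcoef N d A ξ r l s * Real.exp (theta (k s) t) := by
  induction r, hr using Nat.le_induction generalizing l with
  | base =>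
    rw [Finset.mem_Icc] at hl
    simp only [vcoef_one, ite_mul, one_mul, zero_mul]
    rw [Finset.sum_ite_eq', if_pos (Finset.mem_Icc.2 (by omega)), V_one]
  | succ r hr ih =>
    have hl' := Finset.mem_Icc.1 hl
    by_cases hl1 : l = 1
    · subst hl1
      simp only [vcoef_succ_one N d A ξ hr, ite_mul, one_mul, zero_mul]
      rw [Finset.sum_ite_eq', if_pos (Finset.mem_Icc.2 (by omega)), V_succ_one hr]
    · rw [V_succ hr (by omega)]
      simp only [vcoef_succ N d A ξ hr (show 2 ≤ l by omega), Finset.sum_mul]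
      rw [Finset.sum_comm]
      refine Finset.sum_congr rfl fun m hm => ?_
      rw [ih (by omega) hm, term_alpha hA h (Finset.mem_Icc.2 (by omega)) hm, Finset.mul_sum]
      exact Finset.sum_congr rfl fun s _ => by ring

lemma V_pos (hA : IsNormalizedBandedTP N (N + d) A) (h : IsRegular N d A ξ)
    (hr : r ∈ Finset.Icc 1 N) (hl : l ∈ Finset.Icc 1 (d + 1)) :
    0 < V N (N + d) k ξ (vacuumData N d A ξ) r l t := by
  rw [Finset.mem_Icc] at hr
  rw [V_vacuumData hA h hr.1 hr.2 hl]
  have hl' := (Finset.mem_Icc.1 hl).1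
  have h0 := sum_vcoef h hr.1 hr.2 hl
  obtain ⟨s, hs, hs0⟩ : ∃ s ∈ Finset.Icc 1 (N + d), vcoef N d A ξ r l s ≠ 0 :=
    Finset.exists_ne_zero_of_sum_ne_zero (by rw [h0]; exact one_ne_zero)
  refine Finset.sum_pos' (fun s _ => mul_nonneg (vcoef_nonneg h hr.1 hr.2 hl' s)
    (Real.exp_pos _).le) ⟨s, hs, mul_pos ?_ (Real.exp_pos _)⟩
  exact lt_of_le_of_ne (vcoef_nonneg h hr.1 hr.2 hl' s) hs0.symm

lemma V_zero (hA : IsNormalizedBandedTP N (N + d) A) (h : IsRegular N d A ξ)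
    (hr : r ∈ Finset.Icc 1 N) (hl : l ∈ Finset.Icc 1 (d + 1)) :
    V N (N + d) k ξ (vacuumData N d A ξ) r l 0 = 1 := by
  rw [Finset.mem_Icc] at hr
  rw [V_vacuumData hA h hr.1 hr.2 hl, ← sum_vcoef h hr.1 hr.2 hl]
  simp [theta_zero]

lemma sum_coefB_mul_V (hA : IsNormalizedBandedTP N (N + d) A) (h : IsRegular N d A ξ)
    (hr : r ∈ Finset.Icc 1 N) :
    ∑ l ∈ Finset.Icc 1 (d + 1), coefB N d A ξ r l * V N (N + d) k ξ (vacuumData N d A ξ) r l t =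
      valueAtInfty N (N + d) k (vacuumData N d A ξ) A r t := by
  have hr' := Finset.mem_Icc.1 hr
  rw [valueAtInfty, Finset.sum_div]
  have e : ∀ l ∈ Finset.Icc 1 (d + 1),
      coefB N d A ξ r l * V N (N + d) k ξ (vacuumData N d A ξ) r l t =
      ∑ s ∈ Finset.Icc 1 (N + d),
        coefB N d A ξ r l * vcoef N d A ξ r l s * Real.exp (theta (k s) t) := by
    intro l hl
    rw [V_vacuumData hA h hr'.1 hr'.2 hl, Finset.mul_sum]
    exact Finset.sum_congr rfl fun s _ => by ring
  rw [Finset.sum_congr rfl e, Finset.sum_comm]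
  refine Finset.sum_congr rfl fun s hs => ?_
  rw [← Finset.sum_mul, sum_coefB_mul_vcoef hA h hr hs]
  change _ = (A (N - r + 1) s + ∑ j ∈ Finset.Icc 1 (r - 1), coefEps N d A ξ r j *
    A (N - r + 1 + j) s) * _ / (1 + ∑ j ∈ Finset.Icc 1 (r - 1), coefEps N d A ξ r j)
  ring

/-- The value at the marked point `λ_l`. -/
lemma term_node_eq_one (hA : IsNormalizedBandedTP N (N + d) A) (h : IsRegular N d A ξ)
    (hr : r ∈ Finset.Icc 1 N) (hl : l ∈ Finset.Icc 1 (d + 1)) :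
    term d ((vacuumData N d A ξ).B r) (lam ξ) ((vacuumData N d A ξ).b r) l (lam ξ l) = 1 := by
  have hlm := decreasing_lam d h.one_lt
  have h1 := sum_coefB_mul_prod hA h hr (lam ξ l)
  rw [← eval_nodePoly, eval_nodePoly_node hl] at h1
  rw [term, ← h1]
  refine div_self (h1.trans_ne (Finset.prod_ne_zero_iff.2 fun n hn => ?_))
  exact sub_ne_zero.2 ((interlaced_b h hr).ne_node hlm hn hl)

lemma psi_node (hA : IsNormalizedBandedTP N (N + d) A) (h : IsRegular N d A ξ)
    (hr : r ∈ Finset.Icc 1 N) (hl : l ∈ Finset.Icc 1 (d + 1)) :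
    psi N (N + d) k ξ (vacuumData N d A ξ) r t (lam ξ l : ℝ) =
      (V N (N + d) k ξ (vacuumData N d A ξ) r l t : ℂ) := by
  rw [psi_ofReal (Finset.mem_Icc.1 hr).1, sum_term_node _ _ _ _ hl, term_node_eq_one hA h hr hl,
    one_mul]

lemma isVacuum_vacuumData (hN : 1 ≤ N) (hA : IsNormalizedBandedTP N (N + d) A) (h : IsRegular N d A ξ) :
    IsVacuum N (N + d) k ξ (vacuumData N d A ξ) A where
  pole_mem r hr n hn := by
    rw [Nat.add_sub_cancel_left] at hn
    exact interlaced_b h hr n hn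
  eps_pos := h.coefEps_pos
  glue p q hpq t _ := by
    rcases hpq with ⟨l, h1, h2⟩ | ⟨r, h1, h2⟩ | ⟨r, l, h1, h2, h3, h4⟩ <;> dsimp only
    · rw [Nat.add_sub_cancel_left] at h2
      rw [psi_glue_base]
      exact psi_node hA h (Finset.mem_Icc.2 ⟨le_rfl, hN⟩) (Finset.mem_Icc.2 ⟨h1, h2⟩)
    · rw [psi_glue_first h1]
      exact psi_node hA h (Finset.mem_Icc.2 (by omega)) (Finset.mem_Icc.2 (by omega))
    · rw [Nat.add_sub_cancel_left] at h4
      rw [psi_glue_chain h1 h3]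
      exact psi_node hA h (Finset.mem_Icc.2 (by omega)) (Finset.mem_Icc.2 (by omega))
  infty r hr t _ := by
    rw [← sum_coefB_mul_V hA h hr]
    push_cast
    exact (tendsto_sum_term _ _ _ _).congr fun z => (psi_pos (Finset.mem_Icc.1 hr).1 z).symm

/-! ### Uniqueness -/

lemma psi_node_of_isVacuum {W : Data} (hW : IsVacuum N (N + d) k ξ W A) (ht : Admissible t)
    (hr : r ∈ Finset.Icc 1 N) (hl : l ∈ Finset.Icc 1 (d + 1)) :
    psi N (N + d) k ξ W r t (lam ξ l : ℝ) = (V N (N + d) k ξ W r l t : ℂ) := by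
  rw [Finset.mem_Icc] at hr hl
  by_cases hr1 : r = 1
  · subst hr1
    rw [← psi_glue_base]
    exact hW.glue _ _ (Glue.base l hl.1 (by omega)) t ht
  by_cases hl1 : l = 1
  · subst hl1
    rw [← psi_glue_first (by omega)]
    exact hW.glue _ _ (Glue.first r (by omega) hr.2) t ht
  · rw [← psi_glue_chain (by omega) (by omega)]
    exact hW.glue _ _ (Glue.chain r l (by omega) hr.2 (by omega) (by omega)) t ht

/-- Induction over the sheets. Time zero makes the denominator equal to the node polynomial; the
value at infinity at all times gives the linear system. Its unique solution fixes `B` and `ε`, and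
then the poles are the roots in the gaps. -/
lemma IsVacuum.agree (hA : IsNormalizedBandedTP N (N + d) A) (h : IsRegular N d A ξ)
    (hk : StrictMonoOn k (Set.Icc 1 (N + d))) {W : Data} (hW : IsVacuum N (N + d) k ξ W A) :
    Data.Agree N (N + d) W (vacuumData N d A ξ) := by
  have hlm := decreasing_lam d h.one_lt
  intro r
  induction r using Nat.strong_induction_on with
  | _ r ih =>
  intro hr
  have hr' := Finset.mem_Icc.1 hr
  simp only [Nat.add_sub_cancel_left] at ih ⊢
  have hV : ∀ l t, V N (N + d) k ξ W r l t = V N (N + d) k ξ (vacuumData N d A ξ) r l t := by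
    intro l t
    refine V_congr (fun q hq => ?_) hr'.1 l
    rw [Finset.mem_Icc] at hq
    have := ih q (by omega) (Finset.mem_Icc.2 (by omega))
    exact ⟨this.1, this.2.1⟩
  have hb : Interlaced d (lam ξ) (W.b r) := by
    have := hW.pole_mem r hr
    rwa [Nat.add_sub_cancel_left] at this
  -- At time zero all `V_l` equal one by `V_zero`, so the gluing condition says that numerator and
  -- denominator agree at the node.
  have hnode : ∀ l ∈ Finset.Icc 1 (d + 1),
      W.B r l * ∏ j ∈ (Finset.Icc 1 (d + 1)).erase l, (lam ξ l - lam ξ j) =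
        ∏ n ∈ Finset.Icc 1 d, (lam ξ l - W.b r n) := by
    intro l hl
    have h1 := psi_node_of_isVacuum hW admissible_zero hr hl
    rw [psi_ofReal hr'.1, sum_term_node _ _ _ _ hl, hV, V_zero hA h hr hl, mul_one] at h1
    have h2 : term d (W.B r) (lam ξ) (W.b r) l (lam ξ l) = 1 := by exact_mod_cast h1
    rw [term, div_eq_one_iff_eq] at h2
    · exact h2
    · exact Finset.prod_ne_zero_iff.2 fun n hn => sub_ne_zero.2 (hb.ne_node hlm hn hl)
  have hpoly := nodePoly_eq_rootPoly hlm hnode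
  have heps : 0 < 1 + ∑ j ∈ Finset.Icc 1 (r - 1), W.ε r j := by
    have := Finset.sum_nonneg fun j hj => (hW.eps_pos r hr j hj).le
    linarith
  have hinf : ∀ t, Admissible t → ∑ l ∈ Finset.Icc 1 (d + 1), W.B r l *
      V N (N + d) k ξ (vacuumData N d A ξ) r l t = valueAtInfty N (N + d) k W A r t := by
    intro t ht
    have h1 := hW.infty r hr t ht
    have h2 := (tendsto_sum_term (d := d) (fun j => (W.B r j : ℂ)) (fun j => (lam ξ j : ℂ))
      (fun n => (W.b r n : ℂ)) (fun l => (V N (N + d) k ξ W r l t : ℂ))).congr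
      fun z => (psi_pos hr'.1 z).symm
    have h3 := tendsto_nhds_unique h2 h1
    simp only [hV] at h3
    exact_mod_cast h3
  -- Comparison of the coefficients of the exponentials; here the strict ordering of the phases
  -- enters.
  have hcoef : ∀ s ∈ Finset.Icc 1 (N + d),
      (∑ l ∈ Finset.Icc 1 (d + 1), W.B r l * vcoef N d A ξ r l s) -
      (A (N - r + 1) s + ∑ j ∈ Finset.Icc 1 (r - 1), W.ε r j * A (N - r + 1 + j) s) /
        (1 + ∑ j ∈ Finset.Icc 1 (r - 1), W.ε r j) = 0 := by
    refine eq_zero_of_sum_exp_eq_zero hk fun t ht => ?_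
    have h1 := hinf t ht
    rw [valueAtInfty, Finset.sum_div] at h1
    have e : ∀ l ∈ Finset.Icc 1 (d + 1),
        W.B r l * V N (N + d) k ξ (vacuumData N d A ξ) r l t =
        ∑ s ∈ Finset.Icc 1 (N + d), W.B r l * vcoef N d A ξ r l s * Real.exp (theta (k s) t) := by
      intro l hl
      rw [V_vacuumData hA h hr'.1 hr'.2 hl, Finset.mul_sum]
      exact Finset.sum_congr rfl fun s _ => by ring
    rw [Finset.sum_congr rfl e, Finset.sum_comm, ← sub_eq_zero, ← Finset.sum_sub_distrib] at h1
    rw [← h1]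
    refine Finset.sum_congr rfl fun s _ => ?_
    rw [sub_mul, Finset.sum_mul]
    ring
  -- Multiplication by `1 + ∑ ε`, positive because the `ε` are, removes the quotient at infinity and
  -- makes the conditions linear.
  have hsol : IsLevelSol N d A r (vcoef N d A ξ r)
      (fun l => (1 + ∑ j ∈ Finset.Icc 1 (r - 1), W.ε r j) * W.B r l) (W.ε r) := by
    intro s hs
    rw [Finset.mem_Icc] at hs
    have h1 := hcoef s (Finset.mem_Icc.2 (by omega))
    rw [sub_eq_zero, eq_div_iff heps.ne'] at h1
    rw [← h1, Finset.sum_mul]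
    exact Finset.sum_congr rfl fun l _ => by ring
  obtain ⟨h1, h2⟩ := hsol.eq hr'.1 hr'.2 (h.det_ne_zero r hr)
  have hB : ∀ l ∈ Finset.Icc 1 (d + 1), W.B r l = coefB N d A ξ r l := by
    intro l hl
    rw [coefB, levelB, ← h1 l hl, ← Finset.sum_congr rfl h2, mul_div_cancel_left₀ _ heps.ne']
  refine ⟨hB, fun n hn => ?_, h2⟩
  refine hb.eq_of_rootPoly hlm (interlaced_b h hr) ?_ hn
  have := (gapRoots_spec hlm (h.coefB_pos r hr)).2
  rw [sum_coefB hA h hr, map_one, one_mul] at this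
  rw [← hpoly, nodePoly_congr hB, this]
  rfl

end

end

section

/-! ### The essential singularity -/

/-- Convergence at the real point `‖z‖ + 1` is absolute, because a real summable family is
absolutely summable, and dominates the series on the disc of that radius. -/
lemma differentiable_thetaC {t : ℕ → ℝ} (ht : Admissible t) :
    Differentiable ℂ fun z => thetaC z t := by
  intro z
  have hz : z ∈ Metric.ball (0 : ℂ) (‖z‖ + 1) := by simp
  refine DifferentiableOn.differentiableAt (s := Metric.ball (0 : ℂ) (‖z‖ + 1)) ?_
    (Metric.isOpen_ball.mem_nhds hz)
  refine Complex.differentiableOn_tsum_of_summable_norm (u := fun i => |(‖z‖ + 1) ^ (i + 1) * t i|)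
    (ht (‖z‖ + 1)).abs (fun i => ?_) Metric.isOpen_ball fun i w hw => ?_
  · exact ((differentiable_id.pow (i + 1)).mul_const _).differentiableOn
  · rw [mem_ball_zero_iff] at hw
    rw [norm_mul, norm_pow, abs_mul, abs_pow, Complex.norm_real, Real.norm_eq_abs,
      abs_of_nonneg (by positivity : 0 ≤ ‖z‖ + 1)]
    gcongr

lemma thetaC_zero (t : ℕ → ℝ) : thetaC 0 t = 0 := by simp [thetaC]

/-- A time sequence with vanishing phase function is zero. -/
lemma eq_zero_of_theta_eq_zero {t : ℕ → ℝ} (ht : Admissible t) (h : ∀ x, theta x t = 0) :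
    t = 0 := by
  set c : ℕ → ℝ := fun n => if n = 0 then 0 else t (n - 1) with hc
  -- The times are the Taylor coefficients of the phase function, shifted by one because there is no
  -- constant term.
  have hp : HasFPowerSeriesAt (0 : ℝ → ℝ) (FormalMultilinearSeries.ofScalars ℝ c) 0 := by
    rw [hasFPowerSeriesAt_iff]
    refine Eventually.of_forall fun x => ?_
    simp only [FormalMultilinearSeries.coeff_ofScalars, Pi.zero_apply, smul_eq_mul]
    have h1 : HasSum (fun i => x ^ (i + 1) * t i) 0 := by
      rw [← h x]
      exact (ht x).hasSum
    rw [← hasSum_nat_add_iff' 1]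
    simpa [hc] using h1
  have h0 := hp.eq_zero
  ext i
  have := congrArg (fun p => FormalMultilinearSeries.coeff p (i + 1)) h0
  have h1 : FormalMultilinearSeries.coeff (0 : FormalMultilinearSeries ℝ ℝ ℝ) (i + 1) = 0 := rfl
  simpa [FormalMultilinearSeries.coeff_ofScalars, hc, h1] using this

/-- A pole at infinity would make the entire function `e^{-θ}` tend to zero, hence vanish by
Liouville's theorem. A finite limit would make `e^θ` constant, hence `θ = 0` on the real line and `t
= 0`. -/
lemma not_meromorphicAt_exp_thetaC_inv {t : ℕ → ℝ} (ht : Admissible t) (h0 : t ≠ 0) :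
    ¬ MeromorphicAt (fun w => Complex.exp (thetaC w⁻¹ t)) 0 := by
  intro hm
  have hinv : Tendsto (fun z : ℂ => z⁻¹) (cocompact ℂ) (𝓝[≠] 0) := by
    rw [← Metric.cobounded_eq_cocompact]
    exact tendsto_inv₀_cobounded'
  have hdiff : Differentiable ℂ fun z => Complex.exp (thetaC z t) :=
    (differentiable_thetaC ht).cexp
  rcases lt_or_ge (meromorphicOrderAt (fun w => Complex.exp (thetaC w⁻¹ t)) 0) 0 with ho | ho
  · have h1 := (tendsto_cobounded_of_meromorphicOrderAt_neg ho).comp hinv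
    have h2 := (tendsto_inv₀_cobounded (α := ℂ)).comp h1
    have hd : Differentiable ℂ fun z => (Complex.exp (thetaC z t))⁻¹ :=
      hdiff.inv fun z => Complex.exp_ne_zero _
    have h3 := hd.apply_eq_of_tendsto_cocompact 0 (c := 0) (by
      refine h2.congr fun z => ?_
      simp)
    simp at h3
  · obtain ⟨c, hc⟩ := tendsto_nhds_of_meromorphicOrderAt_nonneg hm ho
    have h1 : Tendsto (fun z => Complex.exp (thetaC z t)) (cocompact ℂ) (𝓝 c) := by
      refine (hc.comp hinv).congr fun z => ?_
      simp
    have h2 := fun z => hdiff.apply_eq_of_tendsto_cocompact z h1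
    refine h0 (eq_zero_of_theta_eq_zero ht fun x => ?_)
    have h3 := (h2 x).trans (h2 0).symm
    rw [thetaC_zero, thetaC_ofReal, Complex.exp_zero, ← Complex.ofReal_exp] at h3
    have h4 : Real.exp (theta x t) = 1 := by exact_mod_cast h3
    exact (Real.exp_eq_one_iff _).1 h4

/-! ### Zeros, poles and values -/

lemma meromorphicOrderAt_sub_const (a z₀ : ℂ) :
    meromorphicOrderAt (fun z => z - a) z₀ = ((if z₀ = a then 1 else 0 : ℤ) : WithTop ℤ) := by
  have hm : MeromorphicAt (fun z : ℂ => z - a) z₀ := by fun_prop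
  rw [meromorphicOrderAt_eq_int_iff hm]
  split_ifs with h
  · exact ⟨fun _ => 1, analyticAt_const, one_ne_zero, Eventually.of_forall fun z => by simp [h]⟩
  · exact ⟨fun z => z - a, by fun_prop, sub_ne_zero.2 h, Eventually.of_forall fun z => by simp⟩

lemma meromorphicOrderAt_eq_zero_of_analyticAt {f : ℂ → ℂ} {z₀ : ℂ} (hf : AnalyticAt ℂ f z₀)
    (h0 : f z₀ ≠ 0) : meromorphicOrderAt f z₀ = 0 := by
  have := (meromorphicOrderAt_eq_int_iff (n := 0) hf.meromorphicAt).2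
    ⟨f, hf, h0, Eventually.of_forall fun z => by simp⟩
  simpa using this

lemma analyticAt_prod_sub (s : Finset ℕ) (x : ℕ → ℂ) (z₀ : ℂ) :
    AnalyticAt ℂ (fun z => ∏ n ∈ s, (z - x n)) z₀ :=
  Finset.analyticAt_fun_prod s fun n _ => by fun_prop

/-- Only the `n`-th factors can vanish at the point. Keeping the two contributions separate covers
the case in which zero and pole cancel. -/
lemma meromorphicOrderAt_prod_div_prod {s : Finset ℕ} {n : ℕ} (hn : n ∈ s) {c z₀ : ℂ}
    (hc : c ≠ 0) {x y : ℕ → ℂ} (h : ∀ m ∈ s, m ≠ n → z₀ ≠ x m ∧ z₀ ≠ y m) :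
    meromorphicOrderAt (fun z => c * (∏ m ∈ s, (z - x m)) / ∏ m ∈ s, (z - y m)) z₀ =
      (((if z₀ = x n then 1 else 0) - (if z₀ = y n then 1 else 0) : ℤ) : WithTop ℤ) := by
  have e : (fun z => c * (∏ m ∈ s, (z - x m)) / ∏ m ∈ s, (z - y m)) =
      (fun z => c * (∏ m ∈ s.erase n, (z - x m)) / ∏ m ∈ s.erase n, (z - y m)) *
        (fun z => z - x n) * (fun z => z - y n)⁻¹ := by
    ext z
    simp only [Pi.mul_apply, Pi.inv_apply]
    rw [← Finset.mul_prod_erase _ _ hn, ← Finset.mul_prod_erase s (fun m => z - y m) hn]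
    rw [div_eq_mul_inv, div_eq_mul_inv, mul_inv]
    ring
  have hy : ∏ m ∈ s.erase n, (z₀ - y m) ≠ 0 := Finset.prod_ne_zero_iff.2 fun m hm =>
    sub_ne_zero.2 (h m (Finset.mem_of_mem_erase hm) (Finset.ne_of_mem_erase hm)).2
  have hx : ∏ m ∈ s.erase n, (z₀ - x m) ≠ 0 := Finset.prod_ne_zero_iff.2 fun m hm =>
    sub_ne_zero.2 (h m (Finset.mem_of_mem_erase hm) (Finset.ne_of_mem_erase hm)).1
  have hG : AnalyticAt ℂ (fun z => c * (∏ m ∈ s.erase n, (z - x m)) /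
      ∏ m ∈ s.erase n, (z - y m)) z₀ :=
    (analyticAt_const.mul (analyticAt_prod_sub _ _ _)).div (analyticAt_prod_sub _ _ _) hy
  have m1 : MeromorphicAt (fun z : ℂ => z - x n) z₀ := by fun_prop
  have m2 : MeromorphicAt (fun z : ℂ => z - y n) z₀ := by fun_prop
  rw [e, meromorphicOrderAt_mul (hG.meromorphicAt.mul m1) m2.inv,
    meromorphicOrderAt_mul hG.meromorphicAt m1, meromorphicOrderAt_inv,
    meromorphicOrderAt_eq_zero_of_analyticAt hG (div_ne_zero (mul_ne_zero hc hx) hy),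
    meromorphicOrderAt_sub_const, meromorphicOrderAt_sub_const, zero_add]
  split_ifs <;> rfl

/-- Values on a finite set are irrelevant for the limit along a punctured neighbourhood; in
particular the conventional value at a removable singularity plays no role. -/
lemma hasValueAt_of_finite {f : ℂ → ℂ} {S : Set ℂ} (hS : S.Finite) {w : ℂ}
    (h : ∀ z, z ∉ S → f z = w) (z : OnePoint ℂ) : HasValueAt f z w := by
  refine tendsto_const_nhds.congr' ?_
  have h1 : ((fun x : ℂ => (x : OnePoint ℂ)) '' S)ᶜ ∈ 𝓝[≠] z :=
    nhdsNE_le_cofinite z (hS.image _).compl_mem_cofinite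
  filter_upwards [preimage_mem_comap h1] with x hx
  exact (h x fun hxS => hx ⟨x, hxS, rfl⟩).symm

section
variable {N d : ℕ} {A : ℕ → ℕ → ℝ} {k : ℕ → ℝ} {ξ : ℝ} {r n : ℕ} {t : ℕ → ℝ}

/-- The zeros of the wave function. -/
def zeros (N d : ℕ) (A : ℕ → ℕ → ℝ) (k : ℕ → ℝ) (ξ : ℝ) (r n : ℕ) (t : ℕ → ℝ) : ℝ :=
  gapRoots d (lam ξ)
    (fun l => coefB N d A ξ r l * V N (N + d) k ξ (vacuumData N d A ξ) r l t) n

lemma coefB_mul_V_pos (hA : IsNormalizedBandedTP N (N + d) A) (h : IsRegular N d A ξ)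
    (hr : r ∈ Finset.Icc 1 N) : ∀ l ∈ Finset.Icc 1 (d + 1),
    0 < coefB N d A ξ r l * V N (N + d) k ξ (vacuumData N d A ξ) r l t :=
  fun l hl => mul_pos (h.coefB_pos r hr l hl) (V_pos hA h hr hl)

lemma interlaced_zeros (hA : IsNormalizedBandedTP N (N + d) A) (h : IsRegular N d A ξ)
    (hr : r ∈ Finset.Icc 1 N) : Interlaced d (lam ξ) fun n => zeros N d A k ξ r n t :=
  (gapRoots_spec (decreasing_lam d h.one_lt) (coefB_mul_V_pos hA h hr)).1

lemma sum_coefB_mul_V_pos (hA : IsNormalizedBandedTP N (N + d) A) (h : IsRegular N d A ξ)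
    (hr : r ∈ Finset.Icc 1 N) : 0 < ∑ l ∈ Finset.Icc 1 (d + 1),
      coefB N d A ξ r l * V N (N + d) k ξ (vacuumData N d A ξ) r l t :=
  Finset.sum_pos (coefB_mul_V_pos hA h hr) ⟨1, by simp⟩

lemma psi_eq_prod (hA : IsNormalizedBandedTP N (N + d) A) (h : IsRegular N d A ξ)
    (hr : r ∈ Finset.Icc 1 N) (z : ℂ) : psi N (N + d) k ξ (vacuumData N d A ξ) r t z =
    ((∑ l ∈ Finset.Icc 1 (d + 1),
      coefB N d A ξ r l * V N (N + d) k ξ (vacuumData N d A ξ) r l t : ℝ) : ℂ) *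
      (∏ n ∈ Finset.Icc 1 d, (z - (zeros N d A k ξ r n t : ℂ))) /
      ∏ n ∈ Finset.Icc 1 d, (z - ((vacuumData N d A ξ).b r n : ℂ)) := by
  rw [psi_pos (Finset.mem_Icc.1 hr).1, sum_term_mul]
  congr 1
  have := sum_mul_prod_eq (decreasing_lam d h.one_lt) (coefB_mul_V_pos (k := k) (t := t) hA h hr) z
  simp only [Complex.ofReal_mul] at this
  exact this

lemma zeros_zero (hA : IsNormalizedBandedTP N (N + d) A) (h : IsRegular N d A ξ)
    (hr : r ∈ Finset.Icc 1 N) (n : ℕ) :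
    zeros N d A k ξ r n 0 = (vacuumData N d A ξ).b r n := by
  unfold zeros
  rw [gapRoots_congr (a' := coefB N d A ξ r) fun l hl => by rw [V_zero hA h hr hl, mul_one]]
  rfl

lemma hasValueAt_psi (hA : IsNormalizedBandedTP N (N + d) A) (h : IsRegular N d A ξ)
    (hr : r ≤ N) (z : OnePoint ℂ) :
    HasValueAt (psi N (N + d) k ξ (vacuumData N d A ξ) r 0) z 1 := by
  by_cases hr0 : r = 0
  · subst hr0
    refine hasValueAt_of_finite Set.finite_empty (fun z _ => ?_) z
    rw [psi_zero]
    simp [thetaC]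
  have hr' : r ∈ Finset.Icc 1 N := Finset.mem_Icc.2 (by omega)
  refine hasValueAt_of_finite (S := (fun n => ((vacuumData N d A ξ).b r n : ℂ)) ''
    (Finset.Icc 1 d : Set ℕ)) ((Finset.finite_toSet _).image _) (fun z hz => ?_) z
  rw [psi_eq_prod hA h hr',
    Finset.sum_congr rfl fun l hl => by rw [V_zero hA h hr' hl, mul_one], sum_coefB hA h hr',
    Complex.ofReal_one, one_mul, Finset.prod_congr rfl fun n _ => by rw [zeros_zero hA h hr' n]]
  refine div_self (Finset.prod_ne_zero_iff.2 fun n hn => sub_ne_zero.2 fun hzn => hz ?_)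
  exact ⟨n, hn, hzn.symm⟩

lemma meromorphicOrderAt_psi (hA : IsNormalizedBandedTP N (N + d) A) (h : IsRegular N d A ξ)
    (hr : r ∈ Finset.Icc 1 N) (hn : n ∈ Finset.Icc 1 d) {z : ℂ}
    (hz : ∀ m ∈ Finset.Icc 1 d, m ≠ n →
      z ≠ (zeros N d A k ξ r m t : ℂ) ∧ z ≠ ((vacuumData N d A ξ).b r m : ℂ)) :
    meromorphicOrderAt (psi N (N + d) k ξ (vacuumData N d A ξ) r t) z =
      (((if z = (zeros N d A k ξ r n t : ℂ) then 1 else 0) -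
        (if z = ((vacuumData N d A ξ).b r n : ℂ) then 1 else 0) : ℤ) : WithTop ℤ) := by
  rw [funext (psi_eq_prod (k := k) (t := t) hA h hr)]
  refine meromorphicOrderAt_prod_div_prod hn ?_ hz
  exact_mod_cast (sum_coefB_mul_V_pos hA h hr).ne'

lemma meromorphicOrderAt_psi_of_mem_gap (hA : IsNormalizedBandedTP N (N + d) A)
    (h : IsRegular N d A ξ) (hr : r ∈ Finset.Icc 1 N) (hn : n ∈ Finset.Icc 1 d) {x : ℝ}
    (hx : x ∈ Set.Icc (lam ξ (n + 1)) (lam ξ n)) :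
    meromorphicOrderAt (psi N (N + d) k ξ (vacuumData N d A ξ) r t) x =
      (((if (x : ℂ) = (zeros N d A k ξ r n t : ℂ) then 1 else 0) -
        (if (x : ℂ) = ((vacuumData N d A ξ).b r n : ℂ) then 1 else 0) : ℤ) : WithTop ℤ) := by
  have hlm := decreasing_lam d h.one_lt
  refine meromorphicOrderAt_psi hA h hr hn fun m hm hmn => ⟨fun hz => ?_, fun hz => ?_⟩
  · exact hmn ((interlaced_zeros hA h hr).eq_of_mem hlm hn hm hx (Complex.ofReal_injective hz))
  · exact hmn ((interlaced_b h hr).eq_of_mem hlm hn hm hx (Complex.ofReal_injective hz))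

lemma Interlaced.neg {x : ℕ → ℝ} (hξ : 1 < ξ) (hx : Interlaced d (lam ξ) x)
    (hn : n ∈ Finset.Icc 1 d) : x n < 0 := by
  have := hx.lt_node (decreasing_lam d hξ) hn le_rfl (Finset.mem_Icc.1 hn).1
  rwa [lam_one] at this

/-- All zeros and poles on `Γ_r` are negative. This covers the arcs that lie between `λ_1` and the
`α_l`, which belong to ovals of the next index. -/
lemma meromorphicOrderAt_psi_of_nonneg (hA : IsNormalizedBandedTP N (N + d) A)
    (h : IsRegular N d A ξ) (hd : 1 ≤ d) (hr : r ∈ Finset.Icc 1 N) {x : ℝ} (hx : 0 ≤ x) :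
    meromorphicOrderAt (psi N (N + d) k ξ (vacuumData N d A ξ) r t) x = 0 := by
  have h1 : ∀ m ∈ Finset.Icc 1 d,
      (x : ℂ) ≠ (zeros N d A k ξ r m t : ℂ) ∧ (x : ℂ) ≠ ((vacuumData N d A ξ).b r m : ℂ) := by
    refine fun m hm => ⟨fun hz => ?_, fun hz => ?_⟩
    · have := (interlaced_zeros (k := k) (t := t) hA h hr).neg h.one_lt hm
      simp only [← Complex.ofReal_injective hz] at this
      linarith
    · have := (interlaced_b h hr).neg h.one_lt hm
      rw [← Complex.ofReal_injective hz] at this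
      linarith
  have hd' : 1 ∈ Finset.Icc 1 d := Finset.mem_Icc.2 ⟨le_rfl, hd⟩
  rw [meromorphicOrderAt_psi hA h hr hd' fun m hm _ => h1 m hm, if_neg (h1 1 hd').1,
    if_neg (h1 1 hd').2]
  rfl

lemma meromorphicOrderAt_psi_zero (ht : Admissible t) (W : Data) (z : ℂ) :
    meromorphicOrderAt (psi N (N + d) k ξ W 0 t) z = 0 := by
  rw [funext (psi_zero (N := N) (d := d) (k := k) (ξ := ξ) (W := W) (t := t))]
  refine meromorphicOrderAt_eq_zero_of_analyticAt ?_ (Complex.exp_ne_zero _)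
  exact ((differentiable_thetaC ht).cexp).analyticAt z

/-- The poles are genuine for some times. -/
lemma exists_meromorphicOrderAt_eq_neg_one (hA : IsNormalizedBandedTP N (N + d) A)
    (h : IsRegular N d A ξ) (hk : StrictMonoOn k (Set.Icc 1 (N + d))) (hr : r ∈ Finset.Icc 1 N)
    (hn : n ∈ Finset.Icc 1 d) : ∃ t, Admissible t ∧
      meromorphicOrderAt (psi N (N + d) k ξ (vacuumData N d A ξ) r t)
        ((vacuumData N d A ξ).b r n : ℂ) = -1 := by
  have hlm := decreasing_lam d h.one_lt
  have hr' := Finset.mem_Icc.1 hr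
  set b := (vacuumData N d A ξ).b r n with hb
  -- If the zero coincided with `b` at all times, the numerator at `b` would be a linear combination
  -- of exponentials that vanishes identically.
  obtain ⟨t, ht, hne⟩ : ∃ t, Admissible t ∧ zeros N d A k ξ r n t ≠ b := by
    by_contra! hcon
    have hsum : ∀ t, Admissible t → ∑ s ∈ Finset.Icc 1 (N + d),
        (∑ l ∈ Finset.Icc 1 (d + 1), coefB N d A ξ r l *
          (∏ j ∈ (Finset.Icc 1 (d + 1)).erase l, (b - lam ξ j)) * vcoef N d A ξ r l s) *
        Real.exp (theta (k s) t) = 0 := by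
      intro t ht
      have h1 := sum_mul_prod_eq_real hlm (coefB_mul_V_pos (k := k) (t := t) hA h hr) b
      rw [Finset.prod_eq_zero hn (sub_eq_zero.2 (hcon t ht).symm), mul_zero] at h1
      rw [← h1]
      simp only [Finset.sum_mul]
      rw [Finset.sum_comm]
      refine Finset.sum_congr rfl fun l hl => ?_
      rw [V_vacuumData hA h hr'.1 hr'.2 hl, Finset.mul_sum, Finset.sum_mul]
      exact Finset.sum_congr rfl fun s _ => by ring
    -- The exponential of index `N - r + 1` occurs in `V_1` only, so its coefficient is `B_1 ∏_{j ≠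
    -- 1} (b - λ_j)`, which is nonzero.
    have h2 := eq_zero_of_sum_exp_eq_zero hk hsum (N - r + 1) (Finset.mem_Icc.2 (by omega))
    rw [Finset.sum_eq_single_of_mem 1 (by simp), vcoef_first hr'.1 hr'.2 le_rfl, if_pos rfl,
      mul_one] at h2
    · refine mul_ne_zero (h.coefB_pos r hr 1 (by simp)).ne' ?_ h2
      refine Finset.prod_ne_zero_iff.2 fun j hj => sub_ne_zero.2 ?_
      exact ((interlaced_b h hr).ne_node hlm hn (Finset.mem_of_mem_erase hj)).symm
    · intro l hl hl1
      rw [vcoef_first hr'.1 hr'.2 (Finset.mem_Icc.1 hl).1, if_neg hl1, mul_zero]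
  refine ⟨t, ht, ?_⟩
  rw [meromorphicOrderAt_psi_of_mem_gap hA h hr hn
    (Set.Ioo_subset_Icc_self (interlaced_b h hr n hn)), if_neg, if_pos rfl]
  · rfl
  · exact fun hz => hne (Complex.ofReal_injective hz).symm

end

end

section

/-! ### The asymptotics of the zeros -/

/-- The real inequalities behind `abs_root_mul_sub_le`. -/
lemma abs_mul_add_sub_le {ξ y p α S T R : ℝ} (hξ : 2 ≤ ξ) (hy0 : 0 < y) (hy1 : y < 1)
    (hp0 : 0 < p) (hα0 : 0 < α) (hR0 : 0 ≤ R) (hS : p + α ≤ S) (heq : T = α / (1 - y) + R)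
    (hT1 : p ≤ y * T) (hT2 : (y - (ξ ^ 2)⁻¹) * T ≤ p) (hRle : R ≤ S * (ξ ^ 2 - 1)⁻¹) :
    |y * (p + α) - p| ≤ 2 * S * ξ⁻¹ := by
  have hξ2 : 0 < ξ ^ 2 := by positivity
  have hξ21 : 0 < ξ ^ 2 - 1 := by nlinarith
  have hη : 0 < (ξ ^ 2)⁻¹ := inv_pos.2 hξ2
  have hy1' : 0 < 1 - y := by linarith
  -- Lower bound: insert the equation for `T` into `p ≤ y T` and multiply by `1 - y`.
  have hb1 : p - R ≤ y * (p + α) := by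
    rw [heq] at hT1
    have h1 : y * (α / (1 - y) + R) * (1 - y) = y * α + R * (y * (1 - y)) := by
      field_simp
    have h2 : p * (1 - y) ≤ y * α + R * (y * (1 - y)) := by
      rw [← h1]
      exact mul_le_mul_of_nonneg_right hT1 hy1'.le
    have h3 : y * (1 - y) ≤ 1 := mul_le_one₀ hy1.le hy1'.le (by linarith)
    have h4 : R * (y * (1 - y)) ≤ R := mul_le_of_le_one_right hR0 h3
    linarith
  -- Upper bound: if `y` exceeds `ξ⁻²`, drop `R` from the equation for `T`; otherwise `y` is so
  -- small that the bound is immediate.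
  have hb2 : y * (p + α) ≤ p + α * (ξ ^ 2)⁻¹ := by
    rcases le_or_gt (ξ ^ 2)⁻¹ y with h | h
    · have h1 : (y - (ξ ^ 2)⁻¹) * (α / (1 - y)) ≤ p := by
        refine le_trans (mul_le_mul_of_nonneg_left ?_ (sub_nonneg.2 h)) hT2
        rw [heq]
        linarith
      rw [← mul_div_assoc, div_le_iff₀ hy1'] at h1
      linarith
    · have h1 : y * α ≤ (ξ ^ 2)⁻¹ * α := mul_le_mul_of_nonneg_right h.le hα0.le
      have h2 : y * p ≤ p := mul_le_of_le_one_left hp0.le hy1.le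
      linarith
  have hi1 : (ξ ^ 2 - 1)⁻¹ ≤ 2 * ξ⁻¹ := by
    rw [inv_le_comm₀ hξ21 (by positivity), mul_inv, inv_inv]
    nlinarith
  have hi2 : (ξ ^ 2)⁻¹ ≤ 2 * ξ⁻¹ := by
    rw [inv_le_comm₀ hξ2 (by positivity), mul_inv, inv_inv]
    nlinarith
  have hS0 : 0 < S := by linarith
  rw [abs_le]
  constructor
  · have := hRle.trans (mul_le_mul_of_nonneg_left hi1 hS0.le)
    linarith
  · have h1 : α * (ξ ^ 2)⁻¹ ≤ S * (2 * ξ⁻¹) :=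
      mul_le_mul (by linarith) hi2 hη.le hS0.le
    linarith

/-- The position of a zero in the gap between `λ_{n+1}` and `λ_n`, relative to the size of the gap,
is nearly determined by the coefficients of the marked points that are not beyond it. -/
lemma abs_root_mul_sub_le {d n : ℕ} {ξ : ℝ} (hξ : 2 ≤ ξ) {a : ℕ → ℝ}
    (ha : ∀ l ∈ Finset.Icc 1 (d + 1), 0 < a l) (hn : n ∈ Finset.Icc 1 d) {y : ℝ}
    (hx : -(y * ξ ^ (2 * (n - 1))) ∈ Set.Ioo (lam ξ (n + 1)) (lam ξ n))
    (h0 : ∑ l ∈ Finset.Icc 1 (d + 1), a l *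
      ∏ j ∈ (Finset.Icc 1 (d + 1)).erase l, (-(y * ξ ^ (2 * (n - 1))) - lam ξ j) = 0) :
    0 < y ∧ y < 1 ∧
    |y * ∑ l ∈ Finset.Icc 1 (n + 1), a l - ∑ l ∈ Finset.Icc 1 n, a l| ≤
      2 * (∑ l ∈ Finset.Icc 1 (d + 1), a l) * ξ⁻¹ := by
  have hξ1 : 1 < ξ := by linarith
  have hn' := Finset.mem_Icc.1 hn
  have hlm := decreasing_lam d hξ1
  set X := ξ ^ (2 * (n - 1)) with hX
  set x := -(y * X) with hxd
  have hX0 : 0 < X := by positivity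
  have hlamn : lam ξ (n + 1) = -X := by
    rw [lam, if_neg (by omega)]
    congr 2
  have hy0 : 0 < y := by
    have := hx.2.trans_le (lam_nonpos (by linarith) n)
    by_contra hcon
    have : y * X ≤ 0 := mul_nonpos_of_nonpos_of_nonneg (not_lt.1 hcon) hX0.le
    linarith
  have hy1 : y < 1 := by
    have := hx.1
    rw [hlamn, hxd, neg_lt_neg_iff] at this
    by_contra hcon
    nlinarith [not_lt.1 hcon]
  refine ⟨hy0, hy1, ?_⟩
  -- the equation in partial fractions
  have hlow : ∀ l ∈ Finset.Icc 1 n, x < lam ξ l := by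
    intro l hl
    rw [Finset.mem_Icc] at hl
    exact hx.2.trans_le (hlm.antitoneOn ⟨hl.1, by omega⟩ ⟨hn'.1, by omega⟩ hl.2)
  have hhigh : ∀ l ∈ Finset.Icc (n + 1) (d + 1), lam ξ l < x := by
    intro l hl
    rw [Finset.mem_Icc] at hl
    exact (hlm.antitoneOn ⟨by omega, by omega⟩ ⟨by omega, hl.2⟩ hl.1).trans_lt hx.1
  have hne : ∀ l ∈ Finset.Icc 1 (d + 1), x - lam ξ l ≠ 0 := by
    intro l hl
    rw [Finset.mem_Icc] at hl
    rcases Nat.lt_or_ge n l with h | h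
    · exact (sub_pos.2 (hhigh l (Finset.mem_Icc.2 (by omega)))).ne'
    · exact (sub_neg.2 (hlow l (Finset.mem_Icc.2 (by omega)))).ne
  have hfrac : ∑ l ∈ Finset.Icc 1 (d + 1), a l / (x - lam ξ l) = 0 := by
    have hP : ∏ j ∈ Finset.Icc 1 (d + 1), (x - lam ξ j) ≠ 0 := Finset.prod_ne_zero_iff.2 hne
    have : ∑ l ∈ Finset.Icc 1 (d + 1), a l *
        ∏ j ∈ (Finset.Icc 1 (d + 1)).erase l, (x - lam ξ j) =
        (∏ j ∈ Finset.Icc 1 (d + 1), (x - lam ξ j)) *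
          ∑ l ∈ Finset.Icc 1 (d + 1), a l / (x - lam ξ l) := by
      rw [Finset.mul_sum]
      refine Finset.sum_congr rfl fun l hl => ?_
      rw [← Finset.mul_prod_erase _ _ hl]
      have := hne l hl
      field_simp
    rw [this] at h0
    exact (mul_eq_zero.1 h0).resolve_left hP
  have hsplit : ∀ f : ℕ → ℝ, ∑ l ∈ Finset.Icc 1 (d + 1), f l =
      ∑ l ∈ Finset.Icc 1 n, f l + f (n + 1) + ∑ l ∈ Finset.Icc (n + 2) (d + 1), f l := by
    intro f
    have e1 : ∑ l ∈ Finset.Icc 1 (n + 1), f l = ∑ l ∈ Finset.Icc 1 n, f l + f (n + 1) :=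
      Finset.sum_Icc_succ_top (by omega) _
    rw [← e1, ← Finset.sum_union]
    · congr 1
      ext l
      simp only [Finset.mem_union, Finset.mem_Icc]
      omega
    · rw [Finset.disjoint_left]
      intro l hl hl'
      rw [Finset.mem_Icc] at hl hl'
      omega
  set p := ∑ l ∈ Finset.Icc 1 n, a l with hp
  set S := ∑ l ∈ Finset.Icc 1 (d + 1), a l with hS
  set T := ∑ l ∈ Finset.Icc 1 n, a l * (X / (lam ξ l - x)) with hT
  set R := ∑ l ∈ Finset.Icc (n + 2) (d + 1), a l * (X / (x - lam ξ l)) with hR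
  set α := a (n + 1) with hα
  have hα0 : 0 < α := ha _ (Finset.mem_Icc.2 (by omega))
  have hapos : ∀ l ∈ Finset.Icc 1 n, 0 < a l := fun l hl =>
    ha l (by rw [Finset.mem_Icc] at *; omega)
  have hapos' : ∀ l ∈ Finset.Icc (n + 2) (d + 1), 0 < a l := fun l hl =>
    ha l (by rw [Finset.mem_Icc] at *; omega)
  have hp0 : 0 < p := Finset.sum_pos hapos ⟨1, by simp; omega⟩
  have hS' : S = p + α + ∑ l ∈ Finset.Icc (n + 2) (d + 1), a l := hsplit a
  have hrest : 0 ≤ ∑ l ∈ Finset.Icc (n + 2) (d + 1), a l :=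
    Finset.sum_nonneg fun l hl => (hapos' l hl).le
  have hy1' : 0 < 1 - y := by linarith
  -- The terms with `l ≤ n` balance the term at the lower end of the gap and the remaining ones.
  -- Multiplication by `X = |λ_{n+1}|` makes all quantities of bounded size away from the ends of
  -- the gap.
  have heq : T = α / (1 - y) + R := by
    have h1 := hsplit fun l => X * (a l / (x - lam ξ l))
    rw [← Finset.mul_sum, hfrac, mul_zero] at h1
    have h2 : ∑ l ∈ Finset.Icc 1 n, X * (a l / (x - lam ξ l)) = -T := by
      rw [hT, ← Finset.sum_neg_distrib]
      refine Finset.sum_congr rfl fun l hl => ?_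
      have h3 := sub_pos.2 (hlow l hl)
      have h4 := (sub_neg.2 (hlow l hl)).ne
      rw [← neg_sub (lam ξ l) x]
      field_simp
    have h3 : X * (a (n + 1) / (x - lam ξ (n + 1))) = α / (1 - y) := by
      rw [hlamn, hxd, show -(y * X) - -X = X * (1 - y) by ring, ← hα]
      field_simp
    have h4 : ∑ l ∈ Finset.Icc (n + 2) (d + 1), X * (a l / (x - lam ξ l)) = R :=
      Finset.sum_congr rfl fun l _ => by ring
    rw [h2, h3, h4] at h1
    linarith
  have hξ2 : 0 < ξ ^ 2 := by positivity
  have hR0 : 0 ≤ R := Finset.sum_nonneg fun l hl => by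
    have h1 := hapos' l hl
    have h2 := sub_pos.2 (hhigh l (by rw [Finset.mem_Icc] at *; omega))
    positivity
  have hξ21 : 0 < ξ ^ 2 - 1 := by nlinarith
  -- The nodes beyond the gap satisfy `|λ_l| ≥ ξ² X`, whereas `|x| < X`.
  have hRle : R ≤ S * (ξ ^ 2 - 1)⁻¹ := by
    have h1 : R ≤ (∑ l ∈ Finset.Icc (n + 2) (d + 1), a l) * (ξ ^ 2 - 1)⁻¹ := by
      rw [Finset.sum_mul]
      refine Finset.sum_le_sum fun l hl => mul_le_mul_of_nonneg_left ?_ (hapos' l hl).le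
      have h2 := sub_pos.2 (hhigh l (by rw [Finset.mem_Icc] at *; omega))
      rw [Finset.mem_Icc] at hl
      have h3 : ξ ^ 2 * X ≤ -lam ξ l := by
        rw [lam, if_neg (by omega), neg_neg, hX, ← pow_add]
        exact pow_le_pow_right₀ hξ1.le (by omega)
      rw [div_le_iff₀ h2, ← div_eq_inv_mul, le_div_iff₀ hξ21, hxd]
      nlinarith
    refine h1.trans (mul_le_mul_of_nonneg_right ?_ (inv_pos.2 hξ21).le)
    linarith
  -- Seen from the scale `X`, the nodes with `l ≤ n` nearly coincide with the origin, so that `T` is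
  -- close to `p / y`.
  have hηle : ∀ l ∈ Finset.Icc 1 n, -lam ξ l ≤ (ξ ^ 2)⁻¹ * X := by
    intro l hl
    rw [Finset.mem_Icc] at hl
    rw [lam]
    split_ifs with h
    · rw [neg_zero]; positivity
    · rw [neg_neg, ← div_eq_inv_mul, le_div_iff₀ hξ2, ← pow_add]
      exact pow_le_pow_right₀ hξ1.le (by omega)
  have hT1 : p ≤ y * T := by
    rw [hp, hT, Finset.mul_sum]
    refine Finset.sum_le_sum fun l hl => ?_
    have h1 := hapos l hl
    have h2 := sub_pos.2 (hlow l hl)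
    have h3 := lam_nonpos (by linarith : 0 ≤ ξ) l
    have h4 : 1 ≤ y * (X / (lam ξ l - x)) := by
      rw [← mul_div_assoc, le_div_iff₀ h2, hxd]
      linarith
    nlinarith
  have hT2 : (y - (ξ ^ 2)⁻¹) * T ≤ p := by
    rw [hp, hT, Finset.mul_sum]
    refine Finset.sum_le_sum fun l hl => ?_
    have h1 := hapos l hl
    have h2 := sub_pos.2 (hlow l hl)
    have h3 := hηle l hl
    have h4 : (y - (ξ ^ 2)⁻¹) * (X / (lam ξ l - x)) ≤ 1 := by
      rw [← mul_div_assoc, div_le_iff₀ h2, hxd]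
      linarith
    nlinarith
  have hq : ∑ l ∈ Finset.Icc 1 (n + 1), a l = p + α := Finset.sum_Icc_succ_top (by omega) _
  rw [hq]
  exact abs_mul_add_sub_le hξ hy0 hy1 hp0 hα0 hR0 (by linarith) heq hT1 hT2 hRle

/-- Passage from the exact coefficients to approximate ones. -/
lemma exists_relative_error {y p q p' q' S c μ ξ X : ℝ} (hy0 : 0 < y) (hy1 : y < 1)
    (hμ : 0 < μ) (hp' : μ ≤ p') (hq' : 0 < q') (h : |y * q - p| ≤ 2 * S * ξ⁻¹)
    (hp : |p - p'| ≤ c * ξ⁻¹) (hq : |q - q'| ≤ c * ξ⁻¹) :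
    ∃ δ, |δ| ≤ (2 * S + 2 * c) / μ * ξ⁻¹ ∧ -(y * X) = -(p' / q') * X * (1 + δ) := by
  have hp0 : 0 < p' := hμ.trans_le hp'
  -- The choice is dictated by solving `y = (p' / q') (1 + δ)` for `δ`.
  refine ⟨(y * q' - p') / p', ?_, ?_⟩
  · have h1 : |y * q' - p'| ≤ (2 * S + 2 * c) * ξ⁻¹ := by
      have e : y * q' - p' = (y * q - p) + (p - p') - y * (q - q') := by ring
      have h2 : |y * (q - q')| ≤ c * ξ⁻¹ := by
        rw [abs_mul, abs_of_pos hy0]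
        exact (mul_le_of_le_one_left (abs_nonneg _) hy1.le).trans hq
      rw [abs_le] at *
      constructor <;> linarith [h.1, h.2, hp.1, hp.2, h2.1, h2.2]
    rw [abs_div, abs_of_pos hp0, div_mul_eq_mul_div]
    have h3 : 0 ≤ (2 * S + 2 * c) * ξ⁻¹ := (abs_nonneg _).trans h1
    exact div_le_div₀ h3 h1 hμ hp'
  · field_simp
    ring

lemma Asy.exists_bound {f : ℝ → ℝ} {c : ℝ} (hf : Asy f c) :
    ∃ C, 0 ≤ C ∧ ∀ᶠ ξ in atTop, |f ξ - c| ≤ C * ξ⁻¹ := by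
  obtain ⟨C, hC, h⟩ := Asymptotics.IsBigO.exists_nonneg hf
  refine ⟨C, hC, ?_⟩
  filter_upwards [h.bound, eventually_gt_atTop 0] with ξ h1 h2
  rwa [Real.norm_eq_abs, Real.norm_eq_abs, abs_of_pos (inv_pos.2 h2)] at h1

/-- A uniform estimate for linear combinations of bounded functions. -/
lemma exists_bound_sum {ι : Type*} (s : Finset ι) {f : ι → ℝ → ℝ} {c : ι → ℝ}
    (h : ∀ i ∈ s, Asy (f i) (c i)) (M : ℝ) :
    ∃ C, 0 ≤ C ∧ ∀ᶠ ξ in atTop, ∀ E : ι → ℝ, (∀ i ∈ s, |E i| ≤ M) →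
      |∑ i ∈ s, f i ξ * E i - ∑ i ∈ s, c i * E i| ≤ C * ξ⁻¹ := by
  have h1 : ∀ i ∈ s, ∃ C, 0 ≤ C ∧ ∀ᶠ ξ in atTop, |f i ξ - c i| ≤ C * ξ⁻¹ :=
    fun i hi => (h i hi).exists_bound
  choose! C hC0 hC using h1
  refine ⟨∑ i ∈ s, C i * |M|, Finset.sum_nonneg fun i hi => mul_nonneg (hC0 i hi) (abs_nonneg _), ?_⟩
  have h2 : ∀ᶠ ξ in atTop, ∀ i ∈ s, |f i ξ - c i| ≤ C i * ξ⁻¹ :=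
    (Filter.eventually_all_finset s).2 hC
  filter_upwards [h2] with ξ hξ E hE
  rw [← Finset.sum_sub_distrib, Finset.sum_mul]
  refine (Finset.abs_sum_le_sum_abs _ _).trans (Finset.sum_le_sum fun i hi => ?_)
  rw [← sub_mul, abs_mul, mul_right_comm]
  exact mul_le_mul (hξ i hi) ((hE i hi).trans (le_abs_self M)) (abs_nonneg _)
    ((abs_nonneg _).trans (hξ i hi))

lemma theta_extendTimes {j₀ : ℕ} (x : ℝ) (τ : Fin j₀ → ℝ) :
    theta x (extendTimes τ) = ∑ i : Fin j₀, x ^ ((i : ℕ) + 1) * τ i := by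
  unfold theta
  rw [tsum_eq_sum (s := Finset.range j₀)]
  · rw [← Fin.sum_univ_eq_sum_range (fun i => x ^ (i + 1) * extendTimes τ i)]
    refine Finset.sum_congr rfl fun i _ => ?_
    rw [extendTimes, dif_pos i.2]
  · intro i hi
    rw [Finset.mem_range] at hi
    rw [extendTimes, dif_neg hi, mul_zero]

lemma exists_theta_bound {j₀ : ℕ} {K₀ : Set (Fin j₀ → ℝ)} (hK : IsCompact K₀) (k : ℕ → ℝ)
    (s : Finset ℕ) : ∃ C, ∀ i ∈ s, ∀ τ ∈ K₀, |theta (k i) (extendTimes τ)| ≤ C := by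
  have h : ∀ i ∈ s, ∃ C, 0 ≤ C ∧ ∀ τ ∈ K₀, |theta (k i) (extendTimes τ)| ≤ C := by
    intro i _
    have hc : Continuous fun τ : Fin j₀ → ℝ => theta (k i) (extendTimes τ) := by
      simp only [theta_extendTimes]
      fun_prop
    obtain ⟨C, hC⟩ := hK.exists_bound_of_continuousOn hc.continuousOn
    exact ⟨|C|, abs_nonneg C, fun τ hτ => (hC τ hτ).trans (le_abs_self C)⟩
  choose! C hC0 hC using h
  refine ⟨∑ i ∈ s, C i, fun i hi τ hτ => (hC i hi τ hτ).trans ?_⟩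
  exact Finset.single_le_sum hC0 hi

section
variable {N d : ℕ} {A : ℕ → ℕ → ℝ} {k : ℕ → ℝ} {r n : ℕ}

/-- `abs_root_mul_sub_le` locates the zero by the exact partial sums. These differ by `O(ξ⁻¹)` from
the sums with `B̂` and the actual `V`, and from the minor sums. Compactness of the times gives
uniform bounds, and lower bounds on the numerators turn absolute into relative errors. -/
lemma zeros_asymptotics (hA : IsNormalizedBandedTP N (N + d) A) (hd : 1 ≤ d)
    (hr : r ∈ Finset.Icc 1 N) (hn : n ∈ Finset.Icc 1 d) {j₀ : ℕ} {K₀ : Set (Fin j₀ → ℝ)}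
    (hK : IsCompact K₀) :
    ∃ C : ℝ, ∀ᶠ ξ in atTop, ∀ τ ∈ K₀, ∃ δ δ' : ℝ, |δ| ≤ C * ξ⁻¹ ∧ |δ'| ≤ C * ξ⁻¹ ∧
      zeros N d A k ξ r n (extendTimes τ) =
        -((∑ l ∈ Finset.Icc 1 n, Bhat N A r l *
              V N (N + d) k ξ (vacuumData N d A ξ) r l (extendTimes τ)) /
            ∑ l ∈ Finset.Icc 1 (n + 1), Bhat N A r l *
              V N (N + d) k ξ (vacuumData N d A ξ) r l (extendTimes τ)) *
          ξ ^ (2 * (n - 1)) * (1 + δ) ∧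
      zeros N d A k ξ r n (extendTimes τ) =
        -(minorSum N A k r n (extendTimes τ) / minorSum N A k r (n + 1) (extendTimes τ)) *
          ξ ^ (2 * (n - 1)) * (1 + δ') := by
  have hr' := Finset.mem_Icc.1 hr
  have hn' := Finset.mem_Icc.1 hn
  obtain ⟨Θ, hΘ⟩ := exists_theta_bound hK k (Finset.Icc 1 (N + d))
  set M := Real.exp Θ with hM
  set m := Real.exp (-Θ) with hm
  have hm0 : 0 < m := Real.exp_pos _
  have hE : ∀ s ∈ Finset.Icc 1 (N + d), ∀ τ ∈ K₀,
      m ≤ Real.exp (theta (k s) (extendTimes τ)) ∧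
      Real.exp (theta (k s) (extendTimes τ)) ≤ M := by
    intro s hs τ hτ
    have := abs_le.1 (hΘ s hs τ hτ)
    exact ⟨Real.exp_le_exp.2 this.1, Real.exp_le_exp.2 this.2⟩
  have hsub : ∀ q ≤ d + 1, Finset.Icc 1 q ⊆ Finset.Icc 1 (d + 1) := fun q hq =>
    Finset.Icc_subset_Icc le_rfl hq
  have h1 : ∀ q ∈ Finset.Icc n (n + 1), ∃ C, 0 ≤ C ∧ ∀ᶠ ξ in atTop, ∀ E : ℕ → ℝ,
      (∀ i ∈ Finset.Icc 1 q, |E i| ≤ M) → |∑ i ∈ Finset.Icc 1 q, coefB N d A ξ r i * E i -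
        ∑ i ∈ Finset.Icc 1 q, Bhat N A r i * E i| ≤ C * ξ⁻¹ := by
    intro q hq
    rw [Finset.mem_Icc] at hq
    exact exists_bound_sum _ (f := fun i ξ => coefB N d A ξ r i)
      (fun i hi => asy_coefB hA hr'.1 hr'.2 (hsub q (by omega) hi)) M
  -- For the second formula the partial sums are expanded in exponentials first, so that the limits
  -- of the products `B_i v_i` are compared with the quotients of minors.
  have h2 : ∀ q ∈ Finset.Icc n (n + 1), ∃ C, 0 ≤ C ∧ ∀ᶠ ξ in atTop, ∀ E : ℕ → ℝ,
      (∀ s ∈ Finset.Icc 1 (N + d), |E s| ≤ M) → |∑ s ∈ Finset.Icc 1 (N + d),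
        (∑ i ∈ Finset.Icc 1 q, coefB N d A ξ r i * vcoef N d A ξ r i s) * E s -
        ∑ s ∈ Finset.Icc 1 (N + d), minorCoeff N A r q s * E s| ≤ C * ξ⁻¹ := by
    intro q hq
    rw [Finset.mem_Icc] at hq
    refine exists_bound_sum _ (f := fun s ξ => ∑ i ∈ Finset.Icc 1 q,
      coefB N d A ξ r i * vcoef N d A ξ r i s) (fun s _ => ?_) M
    rw [← sum_Bhat_mul_vlim hA hr'.1 hr'.2 (by omega) (by omega)]
    exact Asy.sum _ fun i hi => (asy_coefB hA hr'.1 hr'.2 (hsub q (by omega) hi)).mul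
      (asy_vcoef hA hr'.1 hr'.2 i (hsub q (by omega) hi) s)
  choose! C1 hC1 h1 using h1
  choose! C2 hC2 h2 using h2
  have hnn : n ∈ Finset.Icc n (n + 1) := by simp
  have hnn1 : n + 1 ∈ Finset.Icc n (n + 1) := by simp
  set c := C1 n + C1 (n + 1) + C2 n + C2 (n + 1) with hc
  have hc0 := hC1 n hnn
  have hc1 := hC1 (n + 1) hnn1
  have hc2 := hC2 n hnn
  have hc3 := hC2 (n + 1) hnn1
  have hBhat0 := Bhat_pos hA hr'.1 hr'.2 le_rfl (by omega : 1 ≤ d + 1)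
  set μ := Bhat N A r 1 * m with hμ
  set μ' := minorMass N A r n * m with hμ'
  have hμ0 : 0 < μ := mul_pos hBhat0 hm0
  have hμ0' : 0 < μ' := mul_pos (minorMass_pos hA hr'.1 hr'.2 hn'.1 (by omega)) hm0
  refine ⟨(2 * M + 2 * c) / μ + (2 * M + 2 * c) / μ', ?_⟩
  filter_upwards [eventually_isRegular hA hd, h1 n hnn, h1 (n + 1) hnn1, h2 n hnn,
    h2 (n + 1) hnn1, eventually_ge_atTop 2] with ξ hreg g1 g2 g3 g4 hξ2 τ hτ
  have hξ0 : 0 < ξ := by linarith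
  have hξi : 0 < ξ⁻¹ := inv_pos.2 hξ0
  set t := extendTimes τ with ht
  set U := fun l => V N (N + d) k ξ (vacuumData N d A ξ) r l t with hU
  have hUeq : ∀ l ∈ Finset.Icc 1 (d + 1), U l = ∑ s ∈ Finset.Icc 1 (N + d),
      vcoef N d A ξ r l s * Real.exp (theta (k s) t) :=
    fun l hl => V_vacuumData hA hreg hr'.1 hr'.2 hl
  have hUm : ∀ l ∈ Finset.Icc 1 (d + 1), m ≤ U l ∧ U l ≤ M := by
    intro l hl
    have hv := vcoef_nonneg hreg hr'.1 hr'.2 (Finset.mem_Icc.1 hl).1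
    have hs := sum_vcoef hreg hr'.1 hr'.2 hl
    rw [hUeq l hl]
    constructor
    · rw [← one_mul m, ← hs, Finset.sum_mul]
      exact Finset.sum_le_sum fun s hs => mul_le_mul_of_nonneg_left (hE s hs τ hτ).1 (hv s)
    · rw [← one_mul M, ← hs, Finset.sum_mul]
      exact Finset.sum_le_sum fun s hs => mul_le_mul_of_nonneg_left (hE s hs τ hτ).2 (hv s)
  have hUabs : ∀ q ≤ d + 1, ∀ l ∈ Finset.Icc 1 q, |U l| ≤ M := by
    intro q hq l hl
    have := hUm l (hsub q hq hl)
    rw [abs_of_pos (hm0.trans_le this.1)]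
    exact this.2
  have hEabs : ∀ s ∈ Finset.Icc 1 (N + d), |Real.exp (theta (k s) t)| ≤ M := by
    intro s hs
    rw [abs_of_pos (Real.exp_pos _)]
    exact (hE s hs τ hτ).2
  have hsumU : ∀ q ≤ d + 1, ∑ i ∈ Finset.Icc 1 q, coefB N d A ξ r i * U i =
      ∑ s ∈ Finset.Icc 1 (N + d), (∑ i ∈ Finset.Icc 1 q,
        coefB N d A ξ r i * vcoef N d A ξ r i s) * Real.exp (theta (k s) t) := by
    intro q hq
    simp only [Finset.sum_mul]
    rw [Finset.sum_comm]
    refine Finset.sum_congr rfl fun i hi => ?_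
    rw [hUeq i (hsub q hq hi), Finset.mul_sum]
    exact Finset.sum_congr rfl fun s _ => by ring
  have ha := coefB_mul_V_pos (k := k) (t := t) hA hreg hr
  have hS : ∑ l ∈ Finset.Icc 1 (d + 1), coefB N d A ξ r l * U l ≤ M := by
    rw [← one_mul M, ← sum_coefB hA hreg hr, Finset.sum_mul]
    exact Finset.sum_le_sum fun l hl =>
      mul_le_mul_of_nonneg_left (hUm l hl).2 (hreg.coefB_pos r hr l hl).le
  have hX0 : 0 < ξ ^ (2 * (n - 1)) := by positivity
  obtain ⟨y, hy⟩ : ∃ y, zeros N d A k ξ r n t = -(y * ξ ^ (2 * (n - 1))) :=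
    ⟨-zeros N d A k ξ r n t / ξ ^ (2 * (n - 1)), by field_simp⟩
  have hroot := sum_mul_prod_eq_real (decreasing_lam d hreg.one_lt) ha (zeros N d A k ξ r n t)
  have hmem := interlaced_zeros (k := k) (t := t) hA hreg hr n hn
  simp only [hy] at hmem
  rw [Finset.prod_eq_zero hn (sub_eq_zero.2 rfl), mul_zero, hy] at hroot
  obtain ⟨hy0, hy1, hyb⟩ := abs_root_mul_sub_le hξ2 ha hn hmem hroot
  have hyb' : |y * ∑ l ∈ Finset.Icc 1 (n + 1), coefB N d A ξ r l * U l -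
      ∑ l ∈ Finset.Icc 1 n, coefB N d A ξ r l * U l| ≤ 2 * M * ξ⁻¹ := by
    refine hyb.trans (mul_le_mul_of_nonneg_right ?_ hξi.le)
    linarith
  have hp1 : ∀ q, 1 ≤ q → q ≤ d + 1 → μ ≤ ∑ l ∈ Finset.Icc 1 q, Bhat N A r l * U l := by
    intro q hq1 hq
    have h1 : μ ≤ Bhat N A r 1 * U 1 :=
      mul_le_mul_of_nonneg_left (hUm 1 (by simp)).1 hBhat0.le
    refine h1.trans (Finset.single_le_sum (f := fun l => Bhat N A r l * U l) (fun l hl => ?_)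
      (Finset.mem_Icc.2 ⟨le_rfl, hq1⟩))
    have hl' := Finset.mem_Icc.1 hl
    exact mul_nonneg (Bhat_pos hA hr'.1 hr'.2 hl'.1 (by omega)).le
      (hm0.trans_le (hUm l (hsub q hq hl)).1).le
  have hcoef0 : ∀ q ≤ d + 1, ∀ s, 0 ≤ minorCoeff N A r q s := by
    intro q hq s
    by_cases hs : s ∈ Finset.Icc (N - r + 1) (N - r + q)
    · exact (minorCoeff_pos hA hr'.1 hr'.2 hq hs).le
    · rw [minorCoeff, if_neg hs]
  have hp2 : ∀ q ≤ d + 1, minorMass N A r q * m ≤ ∑ s ∈ Finset.Icc 1 (N + d),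
      minorCoeff N A r q s * Real.exp (theta (k s) t) := by
    intro q hq
    rw [← sum_minorCoeff (d := d) hr'.1 hr'.2 hq, Finset.sum_mul]
    exact Finset.sum_le_sum fun s hs =>
      mul_le_mul_of_nonneg_left (hE s hs τ hτ).1 (hcoef0 q hq s)
  have hle : ∀ b ≤ c, b * ξ⁻¹ ≤ c * ξ⁻¹ := fun b hb => mul_le_mul_of_nonneg_right hb hξi.le
  obtain ⟨δ, hδ, hδe⟩ := exists_relative_error (X := ξ ^ (2 * (n - 1))) hy0 hy1 hμ0
    (hp1 n hn'.1 (by omega)) (hμ0.trans_le (hp1 (n + 1) (by omega) (by omega))) hyb'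
    ((g1 U (hUabs n (by omega))).trans (hle _ (by linarith)))
    ((g2 U (hUabs (n + 1) (by omega))).trans (hle _ (by linarith)))
  have g3' := g3 _ hEabs
  have g4' := g4 _ hEabs
  rw [← hsumU n (by omega)] at g3'
  rw [← hsumU (n + 1) (by omega)] at g4'
  have hq2 : 0 < ∑ s ∈ Finset.Icc 1 (N + d),
      minorCoeff N A r (n + 1) s * Real.exp (theta (k s) t) :=
    (mul_pos (minorMass_pos hA hr'.1 hr'.2 (by omega) (by omega)) hm0).trans_le
      (hp2 (n + 1) (by omega))
  obtain ⟨δ', hδ', hδe'⟩ := exists_relative_error (X := ξ ^ (2 * (n - 1))) hy0 hy1 hμ0'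
    (hp2 n (by omega)) hq2 hyb' (g3'.trans (hle _ (by linarith)))
    (g4'.trans (hle _ (by linarith)))
  have hM0 : 0 < M := Real.exp_pos _
  have hpos1 : 0 ≤ (2 * M + 2 * c) / μ * ξ⁻¹ := (abs_nonneg _).trans hδ
  have hpos2 : 0 ≤ (2 * M + 2 * c) / μ' * ξ⁻¹ := (abs_nonneg _).trans hδ'
  refine ⟨δ, δ', ?_, ?_, ?_, ?_⟩
  · rw [add_mul]; linarith
  · rw [add_mul]; linarith
  · rw [hy, hδe]
  · rw [hy, hδe', minorSum_eq k hr'.1 hr'.2 (by omega : n ≤ d + 1),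
      minorSum_eq k hr'.1 hr'.2 (by omega : n + 1 ≤ d + 1)]

end

end

section

/-! ### The marked points of the sheets -/

/-- The data that define the curve are in general position. -/
structure IsGeneric (N d : ℕ) (k : ℕ → ℝ) (ξ : ℝ) : Prop where
  one_le : 1 ≤ N
  one_le_sub : 1 ≤ d
  strictMonoOn : StrictMonoOn k (Set.Icc 1 (N + d))
  one_lt : 1 < ξ

/-- The labels of the double points. -/
def nodes (N d : ℕ) : Finset (ℕ × ℕ) := Finset.Icc 1 N ×ˢ Finset.Icc 1 (d + 1)

/-- The marked point `λ_l` of `Γ_r`. -/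
def up (ξ : ℝ) (ν : ℕ × ℕ) : ℕ × ℝ := (ν.1, lam ξ ν.2)

/-- The point that is glued to `λ_l ∈ Γ_r`. -/
def low (N : ℕ) (k : ℕ → ℝ) (ξ : ℝ) (ν : ℕ × ℕ) : ℕ × ℝ :=
  if ν.1 = 1 then (0, k (N + ν.2 - 1))
  else if ν.2 = 1 then (0, k (N - ν.1 + 1)) else (ν.1 - 1, alpha ξ ν.2)

/-- The marked points of `Γ_s` in increasing order. -/
def mark (d : ℕ) (k : ℕ → ℝ) (ξ : ℝ) (s j : ℕ) : ℝ :=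
  if s = 0 then k j else if j ≤ d + 1 then lam ξ (d + 2 - j) else alpha ξ (j - d)

/-- The number of marked points of `Γ_s`. -/
def markCount (N d s : ℕ) : ℕ := if s = 0 then N + d else if s < N then 2 * d + 1 else d + 1

section

variable {N d : ℕ} {k : ℕ → ℝ} {ξ : ℝ}

lemma mem_nodes {ν : ℕ × ℕ} :
    ν ∈ nodes N d ↔ (1 ≤ ν.1 ∧ ν.1 ≤ N) ∧ 1 ≤ ν.2 ∧ ν.2 ≤ d + 1 := by
  simp [nodes, Finset.mem_product]

lemma low_one (l : ℕ) : low N k ξ (1, l) = (0, k (N + l - 1)) := by simp [low]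

lemma low_first {r : ℕ} (hr : 2 ≤ r) : low N k ξ (r, 1) = (0, k (N - r + 1)) := by
  simp [low, show r ≠ 1 by omega]

lemma low_chain {r l : ℕ} (hr : 2 ≤ r) (hl : 2 ≤ l) : low N k ξ (r, l) = (r - 1, alpha ξ l) := by
  simp [low, show r ≠ 1 by omega, show l ≠ 1 by omega]

/-- The three kinds of double points. -/
lemma node_cases {ν : ℕ × ℕ} (h : ν ∈ nodes N d) :
    (∃ l, 1 ≤ l ∧ l ≤ d + 1 ∧ ν = (1, l)) ∨ (∃ r, 2 ≤ r ∧ r ≤ N ∧ ν = (r, 1)) ∨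
      ∃ r l, 2 ≤ r ∧ r ≤ N ∧ 2 ≤ l ∧ l ≤ d + 1 ∧ ν = (r, l) := by
  obtain ⟨r, l⟩ := ν
  obtain ⟨⟨h1, h2⟩, h3, h4⟩ := mem_nodes.1 h
  simp only at h1 h2 h3 h4
  rcases h1.eq_or_lt with rfl | h1
  · exact .inl ⟨l, h3, h4, rfl⟩
  · rcases h3.eq_or_lt with rfl | h3
    · exact .inr (.inl ⟨r, h1, h2, rfl⟩)
    · exact .inr (.inr ⟨r, l, h1, h2, h3, h4, rfl⟩)

lemma glue_iff {p q : ℕ × ℝ} (hN : 1 ≤ N) : Glue N (N + d) k ξ p q ↔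
    ∃ ν ∈ nodes N d, p = up ξ ν ∧ q = low N k ξ ν := by
  constructor
  · rintro (⟨l, h1, h2⟩ | ⟨r, h1, h2⟩ | ⟨r, l, h1, h2, h3, h4⟩)
    · exact ⟨(1, l), mem_nodes.2 ⟨⟨le_rfl, hN⟩, h1, by omega⟩, rfl, (low_one l).symm⟩
    · exact ⟨(r, 1), mem_nodes.2 ⟨⟨by omega, h2⟩, le_rfl, by omega⟩, rfl, (low_first h1).symm⟩
    · exact ⟨(r, l), mem_nodes.2 ⟨⟨by omega, h2⟩, by omega, by omega⟩, rfl, (low_chain h1 h3).symm⟩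
  · rintro ⟨ν, hν, rfl, rfl⟩
    obtain ⟨l, h1, h2, rfl⟩ | ⟨r, h1, h2, rfl⟩ | ⟨r, l, h1, h2, h3, h4, rfl⟩ := node_cases hν
    · rw [low_one]
      exact .base l h1 (by omega)
    · rw [low_first h1]
      exact .first r h1 h2
    · rw [low_chain h1 h3]
      exact .chain r l h1 h2 h3 (by omega)

lemma up_injOn (h : IsGeneric N d k ξ) : Set.InjOn (up ξ) (nodes N d : Set (ℕ × ℕ)) := by
  rintro ⟨r, l⟩ hν ⟨r', l'⟩ hν' heq
  obtain ⟨-, h3, h4⟩ := mem_nodes.1 hν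
  obtain ⟨-, h3', h4'⟩ := mem_nodes.1 hν'
  simp only [up, Prod.mk.injEq] at heq
  exact Prod.ext heq.1 ((decreasing_lam d h.one_lt).injOn ⟨h3, h4⟩ ⟨h3', h4'⟩ heq.2)

/-- The indices `N + l - 1 ≥ N` and `N - r + 1 < N` of the phases are disjoint, so each `k_j` is
used for one gluing only. -/
lemma low_injOn (h : IsGeneric N d k ξ) : Set.InjOn (low N k ξ) (nodes N d : Set (ℕ × ℕ)) := by
  have hk : ∀ {i j : ℕ}, 1 ≤ i → i ≤ N + d → 1 ≤ j → j ≤ N + d → k i = k j → i = j :=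
    fun h1 h2 h3 h4 => h.strictMonoOn.injOn ⟨h1, h2⟩ ⟨h3, h4⟩
  have hα : StrictMono (alpha ξ) := fun _ _ => alpha_lt h.one_lt
  have hN := h.one_le
  rintro ν hν ν' hν'
  obtain ⟨l, h1, h2, rfl⟩ | ⟨r, h1, h2, rfl⟩ | ⟨r, l, h1, h2, h3, h4, rfl⟩ := node_cases hν <;>
    obtain ⟨l', h1', h2', rfl⟩ | ⟨r', h1', h2', rfl⟩ | ⟨r', l', h1', h2', h3', h4', rfl⟩ :=
      node_cases hν'
  · rw [low_one, low_one]
    intro heq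
    have := hk (by omega) (by omega) (by omega) (by omega) (Prod.mk.inj heq).2
    rw [show l = l' by omega]
  · rw [low_one, low_first h1']
    intro heq
    have := hk (by omega) (by omega) (by omega) (by omega) (Prod.mk.inj heq).2
    omega
  · rw [low_one, low_chain h1' h3']
    intro heq
    have := (Prod.mk.inj heq).1
    omega
  · rw [low_one, low_first h1]
    intro heq
    have := hk (by omega) (by omega) (by omega) (by omega) (Prod.mk.inj heq).2
    omega
  · rw [low_first h1, low_first h1']
    intro heq
    have := hk (by omega) (by omega) (by omega) (by omega) (Prod.mk.inj heq).2
    rw [show r = r' by omega]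
  · rw [low_first h1, low_chain h1' h3']
    intro heq
    have := (Prod.mk.inj heq).1
    omega
  · rw [low_chain h1 h3, low_one]
    intro heq
    have := (Prod.mk.inj heq).1
    omega
  · rw [low_chain h1 h3, low_first h1']
    intro heq
    have := (Prod.mk.inj heq).1
    omega
  · rw [low_chain h1 h3, low_chain h1' h3']
    intro heq
    have h5 := (Prod.mk.inj heq).1
    rw [show r = r' by omega, hα.injective (Prod.mk.inj heq).2]

/-- On one sheet `λ_l ≤ 0 < α_l`. Hence no point takes part in two gluings. -/
lemma up_ne_low (h : IsGeneric N d k ξ) {ν ν' : ℕ × ℕ} (hν : ν ∈ nodes N d)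
    (hν' : ν' ∈ nodes N d) : up ξ ν ≠ low N k ξ ν' := by
  have h1 := (mem_nodes.1 hν).1.1
  intro heq
  obtain ⟨l', h1', h2', rfl⟩ | ⟨r', h1', h2', rfl⟩ | ⟨r', l', h1', h2', h3', h4', rfl⟩ :=
    node_cases hν'
  · rw [low_one] at heq
    have := (Prod.mk.inj heq).1
    omega
  · rw [low_first h1'] at heq
    have := (Prod.mk.inj heq).1
    omega
  · rw [low_chain h1' h3'] at heq
    have h2 : lam ξ ν.2 = alpha ξ l' := (Prod.mk.inj heq).2
    have h3 := lam_nonpos (zero_le_one.trans h.one_lt.le) ν.2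
    have h4 := alpha_pos (zero_lt_one.trans h.one_lt) l'
    linarith

lemma low_fst_lt {ν : ℕ × ℕ} (hν : ν ∈ nodes N d) : (low N k ξ ν).1 < ν.1 := by
  obtain ⟨l', h1', h2', rfl⟩ | ⟨r', h1', h2', rfl⟩ | ⟨r', l', h1', h2', h3', h4', rfl⟩ :=
    node_cases hν
  · rw [low_one]; exact one_pos
  · rw [low_first h1']; exact Nat.lt_of_lt_of_le two_pos h1'
  · rw [low_chain h1' h3']; exact Nat.sub_lt (by omega) one_pos

lemma glued_iff (hN : 1 ≤ N) {p q : ℕ × ℝ} : Glued N (N + d) k ξ p q ↔ ∃ ν ∈ nodes N d,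
    p = up ξ ν ∧ q = low N k ξ ν ∨ p = low N k ξ ν ∧ q = up ξ ν := by
  rw [Glued, glue_iff hN, glue_iff hN]
  constructor
  · rintro (⟨ν, hν, h1⟩ | ⟨ν, hν, h1, h2⟩)
    · exact ⟨ν, hν, .inl h1⟩
    · exact ⟨ν, hν, .inr ⟨h2, h1⟩⟩
  · rintro ⟨ν, hν, h1 | ⟨h1, h2⟩⟩
    · exact .inl ⟨ν, hν, h1⟩
    · exact .inr ⟨ν, hν, h2, h1⟩

lemma Glued.symm {M : ℕ} {p q : ℕ × ℝ} (hpq : Glued N M k ξ p q) : Glued N M k ξ q p :=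
  Or.symm hpq

lemma Glued.marked {M : ℕ} {p q : ℕ × ℝ} (hpq : Glued N M k ξ p q) : Marked N M k ξ p := ⟨q, hpq⟩

/-- A marked point is glued to one point only. -/
lemma Glued.unique (h : IsGeneric N d k ξ) {p q q' : ℕ × ℝ} (hq : Glued N (N + d) k ξ p q)
    (hq' : Glued N (N + d) k ξ p q') : q = q' := by
  obtain ⟨ν, hν, ⟨rfl, rfl⟩ | ⟨rfl, rfl⟩⟩ := (glued_iff h.one_le).1 hq <;>
    obtain ⟨ν', hν', ⟨h1, rfl⟩ | ⟨h1, rfl⟩⟩ := (glued_iff h.one_le).1 hq'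
  · rw [up_injOn h hν hν' h1]
  · exact absurd h1 (up_ne_low h hν hν')
  · exact absurd h1.symm (up_ne_low h hν' hν)
  · rw [low_injOn h hν hν' h1]

lemma Glued.fst_ne (hN : 1 ≤ N) {p q : ℕ × ℝ} (hpq : Glued N (N + d) k ξ p q) : p.1 ≠ q.1 := by
  obtain ⟨ν, hν, ⟨rfl, rfl⟩ | ⟨rfl, rfl⟩⟩ := (glued_iff hN).1 hpq
  · exact (low_fst_lt hν).ne'
  · exact (low_fst_lt hν).ne

lemma Marked.fst_le (hN : 1 ≤ N) {p : ℕ × ℝ} (hp : Marked N (N + d) k ξ p) : p.1 ≤ N := by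
  obtain ⟨q, hq⟩ := hp
  obtain ⟨ν, hν, ⟨rfl, rfl⟩ | ⟨rfl, rfl⟩⟩ := (glued_iff hN).1 hq
  · exact (mem_nodes.1 hν).1.2
  · exact (low_fst_lt hν).le.trans (mem_nodes.1 hν).1.2

lemma glued_base {l : ℕ} (h1 : 1 ≤ l) (h2 : l ≤ d + 1) :
    Glued N (N + d) k ξ (1, lam ξ l) (0, k (N + l - 1)) := .inl (.base l h1 (by omega))

lemma glued_first {r : ℕ} (h1 : 2 ≤ r) (h2 : r ≤ N) :
    Glued N (N + d) k ξ (r, lam ξ 1) (0, k (N - r + 1)) := .inl (.first r h1 h2)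

lemma glued_chain {r l : ℕ} (h1 : 2 ≤ r) (h2 : r ≤ N) (h3 : 2 ≤ l) (h4 : l ≤ d + 1) :
    Glued N (N + d) k ξ (r, lam ξ l) (r - 1, alpha ξ l) := .inl (.chain r l h1 h2 h3 (by omega))

/-! ### The order of the marked points -/

lemma mark_zero (j : ℕ) : mark d k ξ 0 j = k j := by simp [mark]

lemma mark_lam {s l : ℕ} (hs : 1 ≤ s) (h1 : 1 ≤ l) (h2 : l ≤ d + 1) :
    mark d k ξ s (d + 2 - l) = lam ξ l := by
  rw [mark, if_neg (by omega), if_pos (by omega), show d + 2 - (d + 2 - l) = l by omega]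

lemma mark_alpha {s l : ℕ} (hs : 1 ≤ s) (hl : 2 ≤ l) : mark d k ξ s (d + l) = alpha ξ l := by
  rw [mark, if_neg (by omega), if_neg (by omega), Nat.add_sub_cancel_left]

lemma two_le_markCount (h : IsGeneric N d k ξ) (s : ℕ) : 2 ≤ markCount N d s := by
  have := h.one_le
  have := h.one_le_sub
  rw [markCount]
  split_ifs <;> omega

/-- On `Γ_s` with `s ≥ 1` the list begins with `λ_{d+1} < … < λ_1 = 0` and continues with the
positive `α_2 < α_3 < …`. -/
lemma mark_strictMonoOn (h : IsGeneric N d k ξ) (s : ℕ) :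
    StrictMonoOn (mark d k ξ s) (Set.Icc 1 (markCount N d s)) := by
  rcases Nat.eq_zero_or_pos s with rfl | hs
  · intro i hi j hj hij
    rw [mark_zero, mark_zero]
    exact h.strictMonoOn hi hj hij
  · have key : StrictMonoOn (mark d k ξ s) (Set.Ici 1) := by
      intro i hi j hj hij
      have hi : 1 ≤ i := hi
      rw [mark, mark, if_neg hs.ne', if_neg hs.ne']
      split_ifs with h1 h2 h2
      · exact lam_lt h.one_lt (by omega) (by omega)
      · exact (lam_nonpos (zero_le_one.trans h.one_lt.le) _).trans_lt
          (alpha_pos (zero_lt_one.trans h.one_lt) _)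
      · omega
      · exact alpha_lt h.one_lt (by omega)
    exact key.mono fun i hi => hi.1

lemma marked_iff (h : IsGeneric N d k ξ) {s : ℕ} {c : ℝ} : Marked N (N + d) k ξ (s, c) ↔
    s ≤ N ∧ ∃ j ∈ Set.Icc 1 (markCount N d s), c = mark d k ξ s j := by
  have hN := h.one_le
  have hd := h.one_le_sub
  have e0 : markCount N d 0 = N + d := by simp [markCount]
  constructor
  · intro hm
    refine ⟨hm.fst_le hN, ?_⟩
    obtain ⟨q, hq⟩ := hm
    obtain ⟨ν, hν, ⟨h1, -⟩ | ⟨heq, -⟩⟩ := (glued_iff hN).1 hq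
    · obtain ⟨⟨h2, h3⟩, h4, h5⟩ := mem_nodes.1 hν
      obtain ⟨rfl, rfl⟩ := Prod.mk.inj h1
      refine ⟨d + 2 - ν.2, ⟨by omega, ?_⟩, (mark_lam h2 h4 h5).symm⟩
      rw [markCount, if_neg (by omega)]
      split_ifs <;> omega
    · obtain ⟨l, h1, h2, rfl⟩ | ⟨r, h1, h2, rfl⟩ | ⟨r, l, h1, h2, h3, h4, rfl⟩ := node_cases hν
      · rw [low_one] at heq
        obtain ⟨rfl, rfl⟩ := Prod.mk.inj heq
        exact ⟨N + l - 1, ⟨by omega, by omega⟩, (mark_zero _).symm⟩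
      · rw [low_first h1] at heq
        obtain ⟨rfl, rfl⟩ := Prod.mk.inj heq
        exact ⟨N - r + 1, ⟨by omega, by omega⟩, (mark_zero _).symm⟩
      · rw [low_chain h1 h3] at heq
        obtain ⟨rfl, rfl⟩ := Prod.mk.inj heq
        refine ⟨d + l, ⟨by omega, ?_⟩, (mark_alpha (by omega) h3).symm⟩
        rw [markCount, if_neg (by omega), if_pos (by omega)]
        omega
  · rintro ⟨hs, j, ⟨h1, h2⟩, rfl⟩
    rcases Nat.eq_zero_or_pos s with rfl | hs0
    · rw [mark_zero]
      rw [e0] at h2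
      -- The phase `k_j` is glued to `λ_1` of `Γ_{N+1-j}` for `j < N` and to `λ_{j+1-N}` of `Γ_1`
      -- for `j ≥ N`.
      rcases Nat.lt_or_ge j N with hj | hj
      · have := glued_first (k := k) (ξ := ξ) (d := d) (show 2 ≤ N + 1 - j by omega)
          (show N + 1 - j ≤ N by omega)
        rw [show N - (N + 1 - j) + 1 = j by omega] at this
        exact this.symm.marked
      · have := glued_base (N := N) (k := k) (ξ := ξ) (d := d) (show 1 ≤ j + 1 - N by omega) (by omega)
        rw [show N + (j + 1 - N) - 1 = j by omega] at this
        exact this.symm.marked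
    · rcases Nat.lt_or_ge (d + 1) j with hj | hj
      · rw [markCount, if_neg (by omega)] at h2
        split_ifs at h2
        · have := glued_chain (k := k) (ξ := ξ) (d := d) (show 2 ≤ s + 1 by omega)
            (show s + 1 ≤ N by omega) (show 2 ≤ j - d by omega) (by omega)
          rw [Nat.add_sub_cancel, ← mark_alpha hs0 (by omega : 2 ≤ j - d) (d := d) (k := k),
            show d + (j - d) = j by omega] at this
          exact this.symm.marked
        · omega
      · have hm : mark d k ξ s j = lam ξ (d + 2 - j) := by
          rw [mark, if_neg (by omega), if_pos hj]
        rw [hm]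
        have hν : (s, d + 2 - j) ∈ nodes N d := mem_nodes.2 ⟨⟨hs0, hs⟩, by
          show 1 ≤ d + 2 - j; omega, by show d + 2 - j ≤ d + 1; omega⟩
        exact ⟨_, (glued_iff hN).2 ⟨_, hν, .inl ⟨rfl, rfl⟩⟩⟩

lemma coe_mem_interval {a b x : ℝ} : ((x : ℂ) : OnePoint ℂ) ∈ interval a b ↔ x ∈ Set.Icc a b := by
  constructor
  · rintro ⟨y, hy, heq⟩
    rwa [← Complex.ofReal_injective (OnePoint.coe_injective heq)]
  · exact fun hx => ⟨x, hx, rfl⟩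

lemma coe_mem_arc {a b x : ℝ} : ((x : ℂ) : OnePoint ℂ) ∈ arc a b ↔
    if a < b then a ≤ x ∧ x ≤ b else a ≤ x ∨ x ≤ b := by
  rw [arc]
  split_ifs with hab
  · exact coe_mem_interval
  · constructor
    · rintro (heq | ⟨y, hy, heq⟩)
      · exact absurd heq (OnePoint.coe_ne_infty _)
      · rwa [← Complex.ofReal_injective (OnePoint.coe_injective heq)]
    · exact fun hx => .inr ⟨x, hx, rfl⟩

lemma infty_mem_arc {a b : ℝ} : OnePoint.infty ∈ arc a b ↔ b ≤ a := by
  rw [arc]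
  split_ifs with hab
  · exact iff_of_false (fun ⟨y, _, heq⟩ => OnePoint.coe_ne_infty _ heq) hab.not_ge
  · exact iff_of_true (Set.mem_insert _ _) (not_lt.1 hab)

lemma mem_arc_cases {a b : ℝ} {z : OnePoint ℂ} (hz : z ∈ arc a b) :
    z = OnePoint.infty ∨ ∃ x : ℝ, z = ((x : ℂ) : OnePoint ℂ) := by
  rw [arc] at hz
  split_ifs at hz
  · obtain ⟨y, _, rfl⟩ := hz
    exact .inr ⟨y, rfl⟩
  · rcases hz with rfl | ⟨y, _, rfl⟩
    · exact .inl rfl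
    · exact .inr ⟨y, rfl⟩

lemma left_mem_arc {a b : ℝ} : ((a : ℂ) : OnePoint ℂ) ∈ arc a b := by
  rw [coe_mem_arc]
  split_ifs with h
  · exact ⟨le_rfl, h.le⟩
  · exact .inl le_rfl

lemma right_mem_arc {a b : ℝ} : ((b : ℂ) : OnePoint ℂ) ∈ arc a b := by
  rw [coe_mem_arc]
  split_ifs with h
  · exact ⟨h.le, le_rfl⟩
  · exact .inr le_rfl

lemma consecutive_mark (h : IsGeneric N d k ξ) {s j : ℕ} (hs : s ≤ N) (h1 : 1 ≤ j)
    (h2 : j < markCount N d s) :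
    Consecutive N (N + d) k ξ s (mark d k ξ s j) (mark d k ξ s (j + 1)) := by
  have hm := mark_strictMonoOn h s
  have hlt := hm (⟨h1, h2.le⟩ : j ∈ Set.Icc 1 _) (⟨by omega, h2⟩ : j + 1 ∈ Set.Icc 1 _)
    (Nat.lt_succ_self j)
  refine ⟨(marked_iff h).2 ⟨hs, j, ⟨h1, h2.le⟩, rfl⟩,
    (marked_iff h).2 ⟨hs, j + 1, ⟨by omega, h2⟩, rfl⟩, hlt.ne, fun c hc hcm => ?_⟩
  obtain ⟨-, i, hi, rfl⟩ := (marked_iff h).1 hc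
  rw [coe_mem_arc, if_pos hlt, hm.le_iff_le ⟨h1, h2.le⟩ hi, hm.le_iff_le hi ⟨by omega, h2⟩] at hcm
  rcases (by omega : i = j ∨ i = j + 1) with rfl | rfl
  · exact .inl rfl
  · exact .inr rfl

lemma consecutive_mark_last (h : IsGeneric N d k ξ) {s : ℕ} (hs : s ≤ N) :
    Consecutive N (N + d) k ξ s (mark d k ξ s (markCount N d s)) (mark d k ξ s 1) := by
  have hm := mark_strictMonoOn h s
  have h2 := two_le_markCount h s
  have m1 : 1 ∈ Set.Icc 1 (markCount N d s) := ⟨le_rfl, by omega⟩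
  have m2 : markCount N d s ∈ Set.Icc 1 (markCount N d s) := ⟨by omega, le_rfl⟩
  have hlt := hm m1 m2 (by omega)
  refine ⟨(marked_iff h).2 ⟨hs, _, m2, rfl⟩, (marked_iff h).2 ⟨hs, _, m1, rfl⟩, hlt.ne',
    fun c hc hcm => ?_⟩
  obtain ⟨-, i, hi, rfl⟩ := (marked_iff h).1 hc
  rw [coe_mem_arc, if_neg hlt.not_gt, hm.le_iff_le m2 hi, hm.le_iff_le hi m1] at hcm
  rcases (show i = markCount N d s ∨ i = 1 by have := hi.1; have := hi.2; omega) with rfl | rfl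
  · exact .inl rfl
  · exact .inr rfl

/-- Each real point of a sheet lies on an arc between consecutive marked points. -/
lemma exists_consecutive_mem_arc (h : IsGeneric N d k ξ) {s : ℕ} (hs : s ≤ N) {z : OnePoint ℂ}
    (hz : z = OnePoint.infty ∨ ∃ x : ℝ, z = ((x : ℂ) : OnePoint ℂ)) :
    ∃ a b, Consecutive N (N + d) k ξ s a b ∧ z ∈ arc a b := by
  have hm := mark_strictMonoOn h s
  have h2 := two_le_markCount h s
  have m1 : 1 ∈ Set.Icc 1 (markCount N d s) := ⟨le_rfl, by omega⟩
  have m2 : markCount N d s ∈ Set.Icc 1 (markCount N d s) := ⟨by omega, le_rfl⟩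
  have hlt := hm m1 m2 (by omega)
  rcases hz with rfl | ⟨x, rfl⟩
  · exact ⟨_, _, consecutive_mark_last h hs, infty_mem_arc.2 hlt.le⟩
  by_cases hx : x < mark d k ξ s 1
  · exact ⟨_, _, consecutive_mark_last h hs, by
      rw [coe_mem_arc, if_neg hlt.not_gt]; exact .inr hx.le⟩
  have key : ∀ n, 1 ≤ n → n ≤ markCount N d s → mark d k ξ s n ≤ x ∨
      ∃ j, 1 ≤ j ∧ j < markCount N d s ∧ mark d k ξ s j ≤ x ∧ x ≤ mark d k ξ s (j + 1) := by
    intro n hn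
    induction n, hn using Nat.le_induction with
    | base => exact fun _ => .inl (not_lt.1 hx)
    | succ n hn ih =>
      intro hn'
      rcases ih (by omega) with h3 | h3
      · rcases le_total (mark d k ξ s (n + 1)) x with h4 | h4
        · exact .inl h4
        · exact .inr ⟨n, hn, hn', h3, h4⟩
      · exact .inr h3
  rcases key _ m2.1 le_rfl with h3 | ⟨j, h3, h4, h5, h6⟩
  · exact ⟨_, _, consecutive_mark_last h hs, by
      rw [coe_mem_arc, if_neg hlt.not_gt]; exact .inl h3⟩
  · refine ⟨_, _, consecutive_mark h hs h3 h4, ?_⟩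
    rw [coe_mem_arc, if_pos (hm ⟨h3, h4.le⟩ ⟨by omega, h4⟩ (Nat.lt_succ_self j))]
    exact ⟨h5, h6⟩

/-- Two arcs between consecutive marked points that have a point in common which is not marked
coincide. -/
lemma Consecutive.eq_of_mem_arc {M s : ℕ} {a b a' b' : ℝ} (hab : Consecutive N M k ξ s a b)
    (hab' : Consecutive N M k ξ s a' b') {z : OnePoint ℂ} (hz : z ∈ arc a b) (hz' : z ∈ arc a' b')
    (hm : ∀ x : ℝ, z = ((x : ℂ) : OnePoint ℂ) → ¬ Marked N M k ξ (s, x)) : a = a' := by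
  obtain ⟨ma, mb, hne, hc⟩ := hab
  obtain ⟨ma', mb', hne', hc'⟩ := hab'
  have c1 := hc a' ma'
  have c2 := hc' a ma
  have c3 := hc b' mb'
  have c4 := hc' b mb
  rw [coe_mem_arc] at c1 c2 c3 c4
  rcases mem_arc_cases hz with rfl | ⟨x, rfl⟩
  · rw [infty_mem_arc] at hz hz'
    rw [if_neg hz.not_gt] at c1 c3
    rw [if_neg hz'.not_gt] at c2 c4
    rcases le_total a a' with h | h
    · rcases c1 (.inl h) with h1 | h1
      · exact h1.symm
      · exact absurd (h1 ▸ h) (fun h2 => hne (le_antisymm h2 hz))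
    · rcases c2 (.inl h) with h1 | h1
      · exact h1
      · exact absurd (h1 ▸ h) (fun h2 => hne' (le_antisymm h2 hz'))
  · have hx := hm x rfl
    have n1 : x ≠ a := fun h => hx (h ▸ ma)
    have n2 : x ≠ b := fun h => hx (h ▸ mb)
    have n3 : x ≠ a' := fun h => hx (h ▸ ma')
    have n4 : x ≠ b' := fun h => hx (h ▸ mb')
    rw [coe_mem_arc] at hz hz'
    split_ifs at hz hz' c1 c2 c3 c4 <;> grind

lemma Consecutive.unique {M s : ℕ} {a b b' : ℝ} (hb : Consecutive N M k ξ s a b)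
    (hb' : Consecutive N M k ξ s a b') : b = b' := by
  obtain ⟨ma, mb, hne, hc⟩ := hb
  obtain ⟨-, mb', hne', hc'⟩ := hb'
  have c1 := hc b' mb'
  have c2 := hc' b mb
  rw [coe_mem_arc] at c1 c2
  split_ifs at c1 c2 <;> grind

end

end

section

/-! ### The points of the curve -/

section

variable {N d : ℕ} {k : ℕ → ℝ} {ξ : ℝ}

/-- The point of the curve that is represented by a point of the sheets. -/
def toCurve (N M : ℕ) (k : ℕ → ℝ) (ξ : ℝ) : Sheets N → Curve N M k ξ := Quot.mk _

/-- The points `x` and `y` of the sheets represent the same point of the curve. -/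
def SamePoint (N M : ℕ) (k : ℕ → ℝ) (ξ : ℝ) (x y : Sheets N) : Prop :=
  x = y ∨ ∃ a b : ℝ, Glued N M k ξ (x.1, a) (y.1, b) ∧ x.2 = ((a : ℂ) : OnePoint ℂ) ∧
    y.2 = ((b : ℂ) : OnePoint ℂ)

lemma coe_ofReal_injective : Function.Injective fun x : ℝ => ((x : ℂ) : OnePoint ℂ) :=
  OnePoint.coe_injective.comp Complex.ofReal_injective

lemma mem_fiber {M : ℕ} {P : Curve N M k ξ} {x : Sheets N} :
    x ∈ fiber N M k ξ P ↔ toCurve N M k ξ x = P := Iff.rfl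

/-- Transitivity holds because a marked point has a single partner: two consecutive gluings lead
back to the first point. The relation is therefore already the equivalence relation generated by the
gluings. -/
lemma samePoint_equivalence (h : IsGeneric N d k ξ) : Equivalence (SamePoint N (N + d) k ξ) where
  refl x := .inl rfl
  symm := by
    rintro x y (rfl | ⟨a, b, h1, h2, h3⟩)
    · exact .inl rfl
    · exact .inr ⟨b, a, h1.symm, h3, h2⟩
  trans := by
    rintro x y z (rfl | ⟨a, b, h1, h2, h3⟩) hyz
    · exact hyz
    · rcases hyz with rfl | ⟨b', c, h4, h5, h6⟩
      · exact .inr ⟨a, b, h1, h2, h3⟩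
      · obtain rfl : b = b' := coe_ofReal_injective (h3.symm.trans h5)
        have := Prod.mk.inj (h1.symm.unique h h4)
        exact .inl (Prod.ext (Fin.ext this.1) (by rw [h2, h6, this.2]))

lemma mk_eq_mk_iff (h : IsGeneric N d k ξ) {x y : Sheets N} :
    toCurve N (N + d) k ξ x = toCurve N (N + d) k ξ y ↔ SamePoint N (N + d) k ξ x y := by
  constructor
  · intro heq
    have := Quot.eqvGen_exact heq
    have he := samePoint_equivalence h
    induction this with
    | rel x y hxy =>
      obtain ⟨a, b, h1, h2, h3⟩ := hxy
      exact .inr ⟨a, b, .inl h1, h2, h3⟩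
    | refl x => exact he.refl x
    | symm x y _ ih => exact he.symm (ih (Quot.eqvGen_sound ‹_›))
    | trans x y z _ _ ih ih' =>
      exact he.trans (ih (Quot.eqvGen_sound ‹_›)) (ih' (Quot.eqvGen_sound ‹_›))
  · rintro (rfl | ⟨a, b, h1 | h1, h2, h3⟩)
    · rfl
    · exact Quot.sound ⟨a, b, h1, h2, h3⟩
    · exact (Quot.sound ⟨b, a, h1, h3, h2⟩).symm

lemma val_ofNat {s : ℕ} (hs : s ≤ N) : ((Fin.ofNat (N + 1) s : Fin (N + 1)) : ℕ) = s :=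
  Nat.mod_eq_of_lt (Nat.lt_succ_of_le hs)

lemma pt_eq_pt_iff (h : IsGeneric N d k ξ) {s s' : ℕ} (hs : s ≤ N) (hs' : s' ≤ N)
    {z z' : OnePoint ℂ} : pt N (N + d) k ξ s z = pt N (N + d) k ξ s' z' ↔
      s = s' ∧ z = z' ∨ ∃ a b : ℝ, Glued N (N + d) k ξ (s, a) (s', b) ∧
        z = ((a : ℂ) : OnePoint ℂ) ∧ z' = ((b : ℂ) : OnePoint ℂ) := by
  refine (mk_eq_mk_iff h).trans ?_
  rw [SamePoint, Prod.mk.injEq, Fin.ext_iff, val_ofNat hs, val_ofNat hs']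

lemma pt_injective (h : IsGeneric N d k ξ) {s : ℕ} (hs : s ≤ N) :
    Function.Injective (pt N (N + d) k ξ s) := by
  intro z z' heq
  rcases (pt_eq_pt_iff h hs hs).1 heq with h1 | ⟨a, b, h1, -⟩
  · exact h1.2
  · exact absurd rfl (h1.fst_ne h.one_le)

lemma exists_eq_pt {M : ℕ} (P : Curve N M k ξ) : ∃ s ≤ N, ∃ z, P = pt N M k ξ s z := by
  obtain ⟨⟨i, z⟩, rfl⟩ := Quot.exists_rep P
  refine ⟨i, Nat.le_of_lt_succ i.2, z, ?_⟩
  rw [pt]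
  congr 2
  exact Fin.ext (Nat.mod_eq_of_lt i.2).symm

lemma Glued.pt_eq (h : IsGeneric N d k ξ) {p q : ℕ × ℝ} (hpq : Glued N (N + d) k ξ p q) :
    pt N (N + d) k ξ p.1 ((p.2 : ℂ) : OnePoint ℂ) = pt N (N + d) k ξ q.1 ((q.2 : ℂ) : OnePoint ℂ) :=
  (pt_eq_pt_iff h (hpq.marked.fst_le h.one_le) (hpq.symm.marked.fst_le h.one_le)).2
    (.inr ⟨_, _, hpq, rfl, rfl⟩)

/-- The point of the sheets with real coordinate `p.2` on `Γ_{p.1}`. -/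
def realPt (N : ℕ) (p : ℕ × ℝ) : Sheets N := (Fin.ofNat (N + 1) p.1, ((p.2 : ℂ) : OnePoint ℂ))

lemma realPt_inj {p q : ℕ × ℝ} (hp : p.1 ≤ N) (hq : q.1 ≤ N) (heq : realPt N p = realPt N q) :
    p = q := by
  obtain ⟨h1, h2⟩ := Prod.mk.inj heq
  rw [Fin.ext_iff, val_ofNat hp, val_ofNat hq] at h1
  exact Prod.ext h1 (coe_ofReal_injective h2)

lemma fiber_of_glued (h : IsGeneric N d k ξ) {p q : ℕ × ℝ} (hpq : Glued N (N + d) k ξ p q) :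
    fiber N (N + d) k ξ (toCurve N (N + d) k ξ (realPt N p)) = {realPt N p, realPt N q} := by
  have hp := hpq.marked.fst_le h.one_le
  have hq := hpq.symm.marked.fst_le h.one_le
  ext x
  rw [mem_fiber, mk_eq_mk_iff h, Set.mem_insert_iff, Set.mem_singleton_iff]
  constructor
  · rintro (rfl | ⟨a, b, h1, h2, h3⟩)
    · exact .inl rfl
    · right
      simp only [realPt, val_ofNat hp] at h1 h3
      have h4 : b = p.2 := coe_ofReal_injective h3.symm
      subst h4
      have h5 := hpq.unique h h1.symm
      refine Prod.ext (Fin.ext ?_) ?_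
      · rw [realPt, val_ofNat hq, h5]
      · rw [realPt, h5, h2]
  · rintro (rfl | rfl)
    · exact .inl rfl
    · refine .inr ⟨q.2, p.2, ?_, rfl, rfl⟩
      simp only [realPt, val_ofNat hp, val_ofNat hq]
      exact hpq.symm

lemma fiber_of_not_marked (h : IsGeneric N d k ξ) {x : Sheets N}
    (hx : ∀ a : ℝ, x.2 = ((a : ℂ) : OnePoint ℂ) → ¬ Marked N (N + d) k ξ (x.1, a)) :
    fiber N (N + d) k ξ (toCurve N (N + d) k ξ x) = {x} := by
  ext y
  rw [mem_fiber, mk_eq_mk_iff h, Set.mem_singleton_iff]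
  constructor
  · rintro (rfl | ⟨a, b, h1, h2, h3⟩)
    · rfl
    · exact absurd h1.symm.marked (hx b h3)
  · rintro rfl
    exact .inl rfl

/-- A point of the curve is either a double point or represented by an unmarked point. -/
lemma fiber_cases (h : IsGeneric N d k ξ) (P : Curve N (N + d) k ξ) :
    (∃ p q, Glued N (N + d) k ξ p q ∧ P = toCurve N (N + d) k ξ (realPt N p) ∧
      (fiber N (N + d) k ξ P).encard = 2) ∨
    ∃ x : Sheets N, P = toCurve N (N + d) k ξ x ∧ (fiber N (N + d) k ξ P).encard = 1 ∧
      ∀ a : ℝ, x.2 = ((a : ℂ) : OnePoint ℂ) → ¬ Marked N (N + d) k ξ (x.1, a) := by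
  obtain ⟨x, rfl⟩ : ∃ x, toCurve N (N + d) k ξ x = P := Quot.exists_rep P
  by_cases hx : ∀ a : ℝ, x.2 = ((a : ℂ) : OnePoint ℂ) → ¬ Marked N (N + d) k ξ (x.1, a)
  · exact .inr ⟨x, rfl, by rw [fiber_of_not_marked h hx, Set.encard_singleton], hx⟩
  · push Not at hx
    obtain ⟨a, h1, q, hq⟩ := hx
    have hx' : x = realPt N (x.1, a) :=
      Prod.ext (Fin.ext (val_ofNat (Nat.le_of_lt_succ x.1.2)).symm) h1
    refine .inl ⟨_, q, hq, congrArg _ hx', ?_⟩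
    rw [congrArg (toCurve N (N + d) k ξ) hx', fiber_of_glued h hq, Set.encard_pair]
    intro heq
    have := realPt_inj (hq.marked.fst_le h.one_le) (hq.symm.marked.fst_le h.one_le) heq
    exact hq.fst_ne h.one_le (congrArg Prod.fst this)

lemma encard_fiber_le (h : IsGeneric N d k ξ) (P : Curve N (N + d) k ξ) :
    (fiber N (N + d) k ξ P).encard ≤ 2 := by
  rcases fiber_cases h P with ⟨_, _, _, _, h1⟩ | ⟨_, _, h1, _⟩ <;> rw [h1]
  exact one_le_two

lemma mem_doublePoints_iff (h : IsGeneric N d k ξ) {P : Curve N (N + d) k ξ} :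
    P ∈ doublePoints N (N + d) k ξ ↔
      ∃ p q, Glued N (N + d) k ξ p q ∧ P = toCurve N (N + d) k ξ (realPt N p) := by
  constructor
  · intro hP
    rcases fiber_cases h P with ⟨p, q, h1, h2, _⟩ | ⟨_, _, h1, _⟩
    · exact ⟨p, q, h1, h2⟩
    · have : (fiber N (N + d) k ξ P).encard = 2 := hP
      rw [h1] at this
      norm_num at this
  · rintro ⟨p, q, h1, rfl⟩
    show (fiber N (N + d) k ξ _).encard = 2
    rw [fiber_of_glued h h1, Set.encard_pair]
    intro heq
    have := realPt_inj (h1.marked.fst_le h.one_le) (h1.symm.marked.fst_le h.one_le) heq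
    exact h1.fst_ne h.one_le (congrArg Prod.fst this)

/-- The points `λ_l ∈ Γ_r` represent each double point once, so there are `N (d + 1)` of them, and
`N (d + 1) - (N + 1) + 1 = N d`. -/
lemma arithmeticGenus_eq (h : IsGeneric N d k ξ) :
    arithmeticGenus N (N + d) k ξ = (N * d : ℕ) := by
  have hset : doublePoints N (N + d) k ξ =
      (fun ν => toCurve N (N + d) k ξ (realPt N (up ξ ν))) '' (nodes N d : Set _) := by
    ext P
    rw [mem_doublePoints_iff h]
    constructor
    · rintro ⟨p, q, h1, rfl⟩
      obtain ⟨ν, hν, ⟨rfl, rfl⟩ | ⟨rfl, rfl⟩⟩ := (glued_iff h.one_le).1 h1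
      · exact ⟨ν, hν, rfl⟩
      · exact ⟨ν, hν, h1.symm.pt_eq h⟩
    · rintro ⟨ν, hν, rfl⟩
      exact ⟨_, _, (glued_iff h.one_le).2 ⟨ν, hν, .inl ⟨rfl, rfl⟩⟩, rfl⟩
  have hinj : Set.InjOn (fun ν => toCurve N (N + d) k ξ (realPt N (up ξ ν)))
      (nodes N d : Set _) := by
    intro ν hν ν' hν' heq
    have hs := (mem_nodes.1 hν).1.2
    have hs' := (mem_nodes.1 hν').1.2
    rcases (pt_eq_pt_iff h (s := ν.1) (s' := ν'.1) hs hs').1 heq with ⟨h1, h2⟩ | ⟨a, b, h1, h2, h3⟩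
    · exact up_injOn h hν hν' (Prod.ext h1 (coe_ofReal_injective h2))
    · obtain rfl := coe_ofReal_injective h2
      obtain rfl := coe_ofReal_injective h3
      obtain ⟨μ, hμ, ⟨-, h4⟩ | ⟨h4, -⟩⟩ := (glued_iff h.one_le).1 h1
      · exact absurd h4 (up_ne_low h hν' hμ)
      · exact absurd h4 (up_ne_low h hν hμ)
  rw [arithmeticGenus, hset, hinj.ncard_image, Set.ncard_coe_finset, nodes,
    Finset.card_product, Nat.card_Icc, Nat.card_Icc, Nat.add_sub_cancel, Nat.add_sub_cancel]
  push_cast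
  ring

/-! ### The topology of the curve -/

lemma continuous_pt {M : ℕ} (s : ℕ) : Continuous (pt N M k ξ s) :=
  continuous_quot_mk.comp (Continuous.prodMk_right _)

/-- Every sheet `Γ_s` with `s ≥ 1` meets `Γ_0` in the point `λ_1`. -/
lemma connectedSpace_curve (h : IsGeneric N d k ξ) : ConnectedSpace (Curve N (N + d) k ξ) := by
  have hc : ∀ s, IsPreconnected (sheet N (N + d) k ξ s) := fun s =>
    isPreconnected_range (continuous_pt s)
  refine { toPreconnectedSpace := ⟨?_⟩, toNonempty := ⟨pt N (N + d) k ξ 0 OnePoint.infty⟩ }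
  refine isPreconnected_of_forall (pt N (N + d) k ξ 0 OnePoint.infty) fun P _ => ?_
  obtain ⟨s, hs, z, rfl⟩ := exists_eq_pt P
  refine ⟨sheet N (N + d) k ξ 0 ∪ sheet N (N + d) k ξ s, Set.subset_univ _, .inl ⟨_, rfl⟩,
    .inr ⟨_, rfl⟩, ?_⟩
  rcases Nat.eq_zero_or_pos s with rfl | hs0
  · rw [Set.union_self]
    exact hc 0
  · have hg : Glued N (N + d) k ξ (s, lam ξ 1) (0, k (N - s + 1)) := by
      rcases (Nat.succ_le_of_lt hs0).eq_or_lt with rfl | h1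
      · have := glued_base (N := N) (k := k) (ξ := ξ) (d := d) le_rfl (by omega)
        rwa [show N + 1 - 1 = N - 1 + 1 by omega] at this
      · exact glued_first h1 hs
    exact IsPreconnected.union (pt N (N + d) k ξ s ((lam ξ 1 : ℂ) : OnePoint ℂ))
      ⟨_, (hg.pt_eq h).symm⟩ ⟨_, rfl⟩ (hc 0) (hc s)

lemma finite_setOf_marked (h : IsGeneric N d k ξ) : {p | Marked N (N + d) k ξ p}.Finite := by
  refine (((nodes N d).finite_toSet.image (up ξ)).union
    ((nodes N d).finite_toSet.image (low N k ξ))).subset ?_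
  rintro p ⟨q, hq⟩
  obtain ⟨ν, hν, ⟨rfl, -⟩ | ⟨rfl, -⟩⟩ := (glued_iff h.one_le).1 hq
  · exact .inl ⟨ν, hν, rfl⟩
  · exact .inr ⟨ν, hν, rfl⟩

/-- Saturating a closed set adds marked points only, hence finitely many. -/
lemma isClosedMap_mk (h : IsGeneric N d k ξ) :
    IsClosedMap (toCurve N (N + d) k ξ) := by
  intro C hC
  have hq : IsQuotientMap (toCurve N (N + d) k ξ) := isQuotientMap_quot_mk
  rw [← hq.isClosed_preimage]
  have hfin : ((toCurve N (N + d) k ξ ⁻¹' (toCurve N (N + d) k ξ '' C)) \ C).Finite := by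
    refine ((finite_setOf_marked h).image (realPt N)).subset ?_
    rintro x ⟨⟨y, hy, hxy⟩, hx⟩
    rcases (mk_eq_mk_iff h).1 hxy with rfl | ⟨a, b, h1, h2, h3⟩
    · exact absurd hy hx
    · exact ⟨_, h1.symm.marked,
        Prod.ext (Fin.ext (val_ofNat (Nat.le_of_lt_succ x.1.2))) h3.symm⟩
  have hsub := Set.subset_preimage_image (toCurve N (N + d) k ξ) C
  rw [← Set.sdiff_union_of_subset hsub]
  exact hfin.isClosed.union hC

lemma finite_fiber (h : IsGeneric N d k ξ) (P : Curve N (N + d) k ξ) :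
    (fiber N (N + d) k ξ P).Finite :=
  Set.finite_of_encard_le_coe (k := 2) (encard_fiber_le h P)

/-- Two fibres are disjoint finite sets in a normal space. They are separated there, and the closed
quotient map transports the separation to the curve. -/
lemma t2Space_curve (h : IsGeneric N d k ξ) : T2Space (Curve N (N + d) k ξ) := by
  refine ⟨fun P Q hPQ => ?_⟩
  have hdisj : Disjoint (fiber N (N + d) k ξ P) (fiber N (N + d) k ξ Q) := by
    rw [Set.disjoint_left]
    intro x hx hx'
    exact hPQ (hx.symm.trans hx')
  obtain ⟨U, V, hU, hV, hPU, hQV, hUV⟩ := normal_separation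
    (finite_fiber h P).isClosed (finite_fiber h Q).isClosed hdisj
  have hcl := isClosedMap_mk h
  refine ⟨(toCurve N (N + d) k ξ '' Uᶜ)ᶜ,
    (toCurve N (N + d) k ξ '' Vᶜ)ᶜ,
    (hcl _ hU.isClosed_compl).isOpen_compl, (hcl _ hV.isClosed_compl).isOpen_compl, ?_, ?_, ?_⟩
  · rintro ⟨x, hx, hxP⟩
    exact hx (hPU hxP)
  · rintro ⟨x, hx, hxQ⟩
    exact hx (hQV hxQ)
  · rw [Set.disjoint_left]
    intro R hR hR'
    obtain ⟨x, rfl⟩ : ∃ x, toCurve N (N + d) k ξ x = R := Quot.exists_rep R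
    have h1 : x ∈ U := by
      by_contra hx
      exact hR ⟨x, hx, rfl⟩
    have h2 : x ∈ V := by
      by_contra hx
      exact hR' ⟨x, hx, rfl⟩
    exact Set.disjoint_left.1 hUV h1 h2

lemma map_conj_eq_self_iff {z : OnePoint ℂ} : OnePoint.map (starRingEnd ℂ) z = z ↔
    z = OnePoint.infty ∨ ∃ x : ℝ, z = ((x : ℂ) : OnePoint ℂ) := by
  induction z using OnePoint.rec with
  | infty => simp
  | coe z =>
    rw [OnePoint.map_some, OnePoint.coe_injective.eq_iff, Complex.conj_eq_iff_real]
    simp only [OnePoint.coe_ne_infty, false_or, OnePoint.coe_injective.eq_iff]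

lemma pt_mem_realPart_iff (h : IsGeneric N d k ξ) {s : ℕ} (hs : s ≤ N) {z : OnePoint ℂ} :
    pt N (N + d) k ξ s z ∈ realPart N (N + d) k ξ ↔
      z = OnePoint.infty ∨ ∃ x : ℝ, z = ((x : ℂ) : OnePoint ℂ) := by
  rw [← map_conj_eq_self_iff]
  exact (pt_injective h hs).eq_iff

end

end

section

/-! ### Simple arcs and simple closed curves -/

section
variable {X Y : Type*} [TopologicalSpace X] [TopologicalSpace Y]

/-- `S` is the image of an injective path from `x` to `y`. -/
def SimpleArc (x y : X) (S : Set X) : Prop :=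
  ∃ γ : Path x y, Function.Injective γ ∧ Set.range γ = S

lemma SimpleArc.image {x y : X} {S : Set X} (h : SimpleArc x y S) {f : X → Y}
    (hf : Continuous f) (hinj : Function.Injective f) : SimpleArc (f x) (f y) (f '' S) := by
  obtain ⟨γ, hγ, rfl⟩ := h
  exact ⟨γ.map hf, hinj.comp hγ, Set.range_comp f γ⟩

lemma simpleArc_image_uIcc {G : ℝ → X} (hG : Continuous G) (hinj : Function.Injective G) {u v : ℝ}
    (huv : u ≠ v) : SimpleArc (G u) (G v) (G '' Set.uIcc u v) := by
  refine ⟨⟨⟨fun t => G (AffineMap.lineMap u v (t : ℝ)), by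
      simp only [AffineMap.lineMap_apply_module]
      fun_prop⟩, by simp, by simp⟩, ?_, ?_⟩
  · intro s t hst
    have h1 : AffineMap.lineMap u v (s : ℝ) = AffineMap.lineMap u v (t : ℝ) := hinj hst
    exact Subtype.ext (AffineMap.lineMap_injective ℝ huv h1)
  · show Set.range (fun t : unitInterval => G (AffineMap.lineMap u v (t : ℝ))) = _
    rw [← segment_eq_uIcc, segment_eq_image_lineMap, ← Set.image_comp]
    ext z
    constructor
    · rintro ⟨t, rfl⟩
      exact ⟨t, t.2, rfl⟩
    · rintro ⟨t, ht, rfl⟩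
      exact ⟨⟨t, ht⟩, rfl⟩

/-- The coincidences on the concatenation of two injective paths. -/
lemma trans_eq_trans {x y z : X} {γ : Path x y} {δ : Path y z} (hγ : Function.Injective γ)
    (hδ : Function.Injective δ) (hxz : Set.range γ ∩ Set.range δ ⊆ {y} ∪ ({x} ∩ {z}))
    {s t : unitInterval} (hst : s < t) (heq : γ.trans δ s = γ.trans δ t) : s = 0 ∧ t = 1 := by
  have hst' : (s : ℝ) < t := hst
  rw [Path.trans_apply, Path.trans_apply] at heq
  split_ifs at heq with h1 h2 h2
  · have := congrArg Subtype.val (hγ heq)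
    simp only at this
    linarith
  -- A coincidence between the two halves is the midpoint, excluded by the order of the parameters,
  -- or the closing point of a loop.
  · have hmem : γ ⟨2 * s, (unitInterval.mul_pos_mem_iff zero_lt_two).2 ⟨s.2.1, h1⟩⟩ ∈
        Set.range γ ∩ Set.range δ := ⟨⟨_, rfl⟩, ⟨_, heq.symm⟩⟩
    rcases hxz hmem with h3 | ⟨h3, h4⟩
    · have h5 := congrArg Subtype.val (hδ ((heq.symm.trans h3).trans δ.source.symm))
      change 2 * (t : ℝ) - 1 = 0 at h5
      linarith
    · have h5 := congrArg Subtype.val (hγ (h3.trans γ.source.symm))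
      have h6 := congrArg Subtype.val (hδ ((heq.symm.trans h4).trans δ.target.symm))
      change 2 * (s : ℝ) = 0 at h5
      change 2 * (t : ℝ) - 1 = 1 at h6
      exact ⟨Subtype.ext (show (s : ℝ) = 0 by linarith),
        Subtype.ext (show (t : ℝ) = 1 by linarith)⟩
  · linarith
  · have := congrArg Subtype.val (hδ heq)
    simp only at this
    linarith

lemma SimpleArc.trans {x y z : X} {S T : Set X} (hS : SimpleArc x y S) (hT : SimpleArc y z T)
    (hST : S ∩ T ⊆ {y}) : SimpleArc x z (S ∪ T) := by
  obtain ⟨γ, hγ, rfl⟩ := hS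
  obtain ⟨δ, hδ, rfl⟩ := hT
  have key : ∀ {s t : unitInterval}, s < t → γ.trans δ s ≠ γ.trans δ t := by
    intro s t hst heq
    obtain ⟨rfl, rfl⟩ := trans_eq_trans hγ hδ (hST.trans Set.subset_union_left) hst heq
    rw [Path.source, Path.target] at heq
    have h1 : x = y := hST ⟨⟨0, γ.source⟩, ⟨1, δ.target.trans heq.symm⟩⟩
    have h2 := hγ ((γ.source.trans h1).trans γ.target.symm)
    exact zero_ne_one h2
  refine ⟨γ.trans δ, fun s t hst => ?_, Path.trans_range γ δ⟩
  rcases lt_trichotomy s t with h | h | h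
  · exact absurd hst (key h)
  · exact h
  · exact absurd hst.symm (key h)

/-- Two simple arcs with the same end points that are otherwise disjoint form a simple closed
curve. -/
lemma SimpleArc.nonempty_homeomorph_circle [T2Space X] {x y : X} {S T : Set X}
    (hS : SimpleArc x y S) (hT : SimpleArc y x T) (hST : S ∩ T ⊆ {x, y}) :
    Nonempty (↥(S ∪ T) ≃ₜ Circle) := by
  obtain ⟨γ, hγ, rfl⟩ := hS
  obtain ⟨δ, hδ, rfl⟩ := hT
  have hsub : Set.range γ ∩ Set.range δ ⊆ {y} ∪ ({x} ∩ {x}) := fun p hp =>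
    (hST hp).elim (fun h => .inr ⟨h, h⟩) .inl
  have : Fact ((0 : ℝ) < 1) := ⟨one_pos⟩
  -- The closed path descends to the circle, where it is injective; a continuous injection of a
  -- compact space into a Hausdorff space is an embedding.
  set f : AddCircle (1 : ℝ) → X := AddCircle.liftIco 1 0 (γ.trans δ).extend with hf
  have hval : ∀ t : ℝ, (ht : t ∈ Set.Ico (0 : ℝ) 1) →
      f (t : AddCircle (1 : ℝ)) = γ.trans δ ⟨t, ht.1, ht.2.le⟩ := by
    intro t ht
    rw [hf, AddCircle.liftIco_coe_apply (by rwa [zero_add]),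
      Path.extend_apply _ ⟨ht.1, ht.2.le⟩]
  have hsurj : ∀ p : AddCircle (1 : ℝ), ∃ t ∈ Set.Ico (0 : ℝ) 1, (t : AddCircle (1 : ℝ)) = p := by
    intro p
    have h1 := (AddCircle.equivIco (1 : ℝ) 0 p).2
    exact ⟨_, ⟨h1.1, h1.2.trans_eq (zero_add 1)⟩, (AddCircle.equivIco (1 : ℝ) 0).symm_apply_apply p⟩
  have hcont : Continuous f := AddCircle.liftIco_zero_continuous
    (by rw [Path.extend_zero, Path.extend_one]) (Path.continuous_extend _).continuousOn
  have key : ∀ {s t : ℝ}, s ∈ Set.Ico (0 : ℝ) 1 → t ∈ Set.Ico (0 : ℝ) 1 → s < t →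
      f (s : AddCircle (1 : ℝ)) ≠ f (t : AddCircle (1 : ℝ)) := by
    intro s t hs ht hst heq
    rw [hval s hs, hval t ht] at heq
    have h1 := congrArg Subtype.val (trans_eq_trans hγ hδ hsub (show (⟨s, _⟩ : unitInterval) <
      ⟨t, _⟩ from hst) heq).2
    exact ht.2.ne h1
  have hinj : Function.Injective f := by
    intro p q hpq
    obtain ⟨s, hs, rfl⟩ := hsurj p
    obtain ⟨t, ht, rfl⟩ := hsurj q
    rcases lt_trichotomy s t with h | h | h
    · exact absurd hpq (key hs ht h)
    · rw [h]
    · exact absurd hpq.symm (key ht hs h)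
  have hrange : Set.range f = Set.range γ ∪ Set.range δ := by
    rw [← Path.trans_range]
    ext p
    constructor
    · rintro ⟨q, rfl⟩
      obtain ⟨t, ht, rfl⟩ := hsurj q
      exact ⟨_, (hval t ht).symm⟩
    · rintro ⟨t, rfl⟩
      rcases t.2.2.eq_or_lt with h1 | h1
      · refine ⟨((0 : ℝ) : AddCircle (1 : ℝ)), ?_⟩
        rw [hval 0 ⟨le_rfl, one_pos⟩, show t = 1 from Subtype.ext h1, Path.target]
        exact Path.source _
      · exact ⟨((t : ℝ) : AddCircle (1 : ℝ)), hval t ⟨t.2.1, h1⟩⟩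
  rw [← hrange]
  exact ⟨(hcont.isClosedEmbedding hinj).isEmbedding.toHomeomorph.symm.trans
    (AddCircle.homeomorphCircle one_ne_zero)⟩

/-- Successive concatenation: arcs may meet only if they are neighbours, and then only in the common
end point. -/
lemma simpleArc_iUnion {x : ℕ → X} {S : ℕ → Set X} {n : ℕ}
    (hS : ∀ i ≤ n, SimpleArc (x i) (x (i + 1)) (S i))
    (h : ∀ i j, i < j → j ≤ n → ∀ p ∈ S i, p ∈ S j → j = i + 1 ∧ p = x j) :
    SimpleArc (x 0) (x (n + 1)) {p | ∃ i ≤ n, p ∈ S i} := by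
  induction n with
  | zero =>
    convert hS 0 le_rfl using 1
    ext p
    exact ⟨fun ⟨i, hi, hp⟩ => by rwa [Nat.le_zero.1 hi] at hp, fun hp => ⟨0, le_rfl, hp⟩⟩
  | succ n ih =>
    have h1 := (ih (fun i hi => hS i (by omega)) fun i j hij hj => h i j hij (by omega)).trans
      (hS (n + 1) le_rfl) (by
        rintro p ⟨⟨i, hi, hp⟩, hp'⟩
        exact (h i (n + 1) (by omega) le_rfl p hp hp').2)
    convert h1 using 1
    ext p
    constructor
    · rintro ⟨i, hi, hp⟩
      rcases Nat.le_succ_iff.1 hi with hi | rfl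
      · exact .inl ⟨i, hi, hp⟩
      · exact .inr hp
    · rintro (⟨i, hi, hp⟩ | hp)
      · exact ⟨i, by omega, hp⟩
      · exact ⟨n + 1, le_rfl, hp⟩

end

/-- The real circle `ℝ ∪ {∞}` near `∞`. -/
def nearInfty (c u : ℝ) : OnePoint ℂ :=
  if u = 0 then OnePoint.infty else (((c + u⁻¹ : ℝ) : ℂ) : OnePoint ℂ)

lemma continuous_nearInfty (c : ℝ) : Continuous (nearInfty c) := by
  rw [continuous_iff_continuousAt]
  intro u
  rcases eq_or_ne u 0 with rfl | hu
  · rw [continuousAt_iff_punctured_nhds, show nearInfty c 0 = OnePoint.infty by simp [nearInfty]]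
    have h1 : Tendsto (fun u : ℝ => ((c + u⁻¹ : ℝ) : ℂ)) (𝓝[≠] 0) (cocompact ℂ) := by
      rw [← Metric.cobounded_eq_cocompact, ← tendsto_norm_atTop_iff_cobounded]
      have h2 : Tendsto (fun u : ℝ => c + u⁻¹) (𝓝[≠] 0) (Bornology.cobounded ℝ) :=
        (tendsto_const_add_cobounded c).comp tendsto_inv₀_nhdsNE_zero
      refine (tendsto_norm_atTop_iff_cobounded.2 h2).congr fun u => ?_
      rw [Complex.norm_real]
    rw [← coclosedCompact_eq_cocompact] at h1
    refine (OnePoint.tendsto_coe_infty.comp h1).congr' ?_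
    filter_upwards [self_mem_nhdsWithin] with u hu
    rw [nearInfty, if_neg (show u ≠ 0 from hu), Function.comp_apply]
  · have h1 : ContinuousAt (fun u : ℝ => (((c + u⁻¹ : ℝ) : ℂ) : OnePoint ℂ)) u :=
      (OnePoint.continuous_coe.comp Complex.continuous_ofReal).continuousAt.comp
        (continuousAt_const.add (continuousAt_inv₀ hu))
    refine h1.congr ?_
    filter_upwards [isOpen_ne.mem_nhds hu] with v hv
    rw [nearInfty, if_neg hv]

lemma nearInfty_injective (c : ℝ) : Function.Injective (nearInfty c) := by
  intro u v huv
  rw [nearInfty, nearInfty] at huv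
  split_ifs at huv with h1 h2 h2
  · rw [h1, h2]
  · exact absurd huv.symm (OnePoint.coe_ne_infty _)
  · exact absurd huv (OnePoint.coe_ne_infty _)
  · exact inv_injective (add_left_cancel (coe_ofReal_injective huv))

lemma simpleArc_arc {a b : ℝ} (hab : a ≠ b) :
    SimpleArc ((a : ℂ) : OnePoint ℂ) ((b : ℂ) : OnePoint ℂ) (arc a b) := by
  rw [arc]
  split_ifs with h
  · have := simpleArc_image_uIcc (OnePoint.continuous_coe.comp Complex.continuous_ofReal)
      coe_ofReal_injective hab
    rwa [Set.uIcc_of_le h.le] at this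
  · have hba : b < a := lt_of_le_of_ne (not_lt.1 h) hab.symm
    -- In the coordinate `u = 1 / (x - c)`, with `c` the midpoint of the omitted interval and `e`
    -- half its length, the arc through infinity becomes the segment from `1 / e` to `-1 / e`.
    set c := (a + b) / 2 with hc
    set e := (a - b) / 2 with he
    have he0 : 0 < e := by rw [he]; linarith
    have hei : 0 < e⁻¹ := inv_pos.2 he0
    have h1 := simpleArc_image_uIcc (continuous_nearInfty c) (nearInfty_injective c)
      (show e⁻¹ ≠ -e⁻¹ by linarith)
    have ea : nearInfty c e⁻¹ = ((a : ℂ) : OnePoint ℂ) := by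
      rw [nearInfty, if_neg hei.ne', inv_inv, show c + e = a by rw [hc, he]; ring]
    have eb : nearInfty c (-e⁻¹) = ((b : ℂ) : OnePoint ℂ) := by
      rw [nearInfty, if_neg (neg_ne_zero.2 hei.ne'), inv_neg, inv_inv,
        show c + -e = b by rw [hc, he]; ring]
    rw [ea, eb, Set.uIcc_of_ge (by linarith)] at h1
    convert h1 using 1
    ext z
    simp only [Set.mem_insert_iff, Set.mem_image, Set.mem_union, Set.mem_Ici, Set.mem_Iic]
    constructor
    · rintro (rfl | ⟨x, hx, rfl⟩)
      · exact ⟨0, ⟨by linarith, hei.le⟩, by simp [nearInfty]⟩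
      · have hxe : e ≤ |x - c| := by
          rw [le_abs, hc, he]
          rcases hx with hx | hx
          · left; linarith
          · right; linarith
        have hne : x - c ≠ 0 := abs_pos.1 (he0.trans_le hxe)
        refine ⟨(x - c)⁻¹, abs_le.1 ?_, ?_⟩
        · rw [abs_inv]
          exact inv_anti₀ he0 hxe
        · rw [nearInfty, if_neg (inv_ne_zero hne), inv_inv, add_sub_cancel]
    · rintro ⟨u, hu, rfl⟩
      rw [nearInfty]
      split_ifs with h2
      · exact .inl rfl
      · right
        refine ⟨c + u⁻¹, ?_, rfl⟩
        have h3 : |u| ≤ e⁻¹ := abs_le.2 hu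
        have h4 : e ≤ |u⁻¹| := by
          rw [abs_inv]
          exact (le_inv_comm₀ he0 (abs_pos.2 h2)).2 h3
        rw [le_abs] at h4
        rcases h4 with h4 | h4
        · left; rw [hc]; linarith
        · right; rw [hc]; linarith

end

section

/-! ### Closed sequences of arcs -/

section

variable {N d : ℕ} {k : ℕ → ℝ} {ξ : ℝ}

lemma Consecutive.fst_le (h : IsGeneric N d k ξ) {s : ℕ} {a b : ℝ}
    (hab : Consecutive N (N + d) k ξ s a b) : s ≤ N := hab.1.fst_le h.one_le

lemma Consecutive.exists_mem_arc {M s : ℕ} {a b : ℝ} (hab : Consecutive N M k ξ s a b) :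
    ∃ z ∈ arc a b, ∀ x : ℝ, z = ((x : ℂ) : OnePoint ℂ) → ¬ Marked N M k ξ (s, x) := by
  rcases lt_or_ge a b with hlt | hle
  · have hmem : ((((a + b) / 2 : ℝ) : ℂ) : OnePoint ℂ) ∈ arc a b := by
      rw [coe_mem_arc, if_pos hlt]
      constructor <;> linarith
    refine ⟨_, hmem, fun x hx hm => ?_⟩
    obtain rfl := coe_ofReal_injective hx
    rcases hab.2.2.2 _ hm hmem with h | h <;> linarith
  · exact ⟨OnePoint.infty, infty_mem_arc.2 hle, fun x hx => absurd hx.symm (OnePoint.coe_ne_infty _)⟩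

/-- An unmarked point of an arc lies on the oval through that arc only. -/
lemma pt_mem_ovalFrom_iff (h : IsGeneric N d k ξ) {s : ℕ} {a b : ℝ}
    (hab : Consecutive N (N + d) k ξ s a b) {z : OnePoint ℂ} (hz : z ∈ arc a b)
    (hm : ∀ x : ℝ, z = ((x : ℂ) : OnePoint ℂ) → ¬ Marked N (N + d) k ξ (s, x)) {p : ℕ × ℝ} :
    pt N (N + d) k ξ s z ∈ ovalFrom N (N + d) k ξ p ↔
      Relation.ReflTransGen (Step N (N + d) k ξ) p (s, a) := by
  constructor
  · rintro ⟨q, b', hpq, hq, z', hz', heq⟩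
    rcases (pt_eq_pt_iff h (hq.fst_le h) (hab.fst_le h)).1 heq with ⟨h1, rfl⟩ | ⟨x, y, h1, h2, h3⟩
    · obtain ⟨q1, q2⟩ := q
      simp only at h1 hq hz'
      subst h1
      rwa [hab.eq_of_mem_arc hq hz hz' hm]
    · exact absurd h1.symm.marked (hm y h3)
  · exact fun hp => ⟨_, b, hp, hab, z, hz, rfl⟩

/-- An interior point of the arc that starts at `p` belongs only to ovals whose chain runs through
this arc. Thus ovals can be compared as chains of arcs instead of as sets. -/
lemma reflTransGen_of_ovalFrom_eq (h : IsGeneric N d k ξ) {p q : ℕ × ℝ} {b : ℝ}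
    (hb : Consecutive N (N + d) k ξ p.1 p.2 b)
    (heq : ovalFrom N (N + d) k ξ p = ovalFrom N (N + d) k ξ q) :
    Relation.ReflTransGen (Step N (N + d) k ξ) q p := by
  obtain ⟨z, hz, hm⟩ := hb.exists_mem_arc
  rw [← pt_mem_ovalFrom_iff h hb hz hm, ← heq, pt_mem_ovalFrom_iff h hb hz hm]

/-- The arcs from `a i` to `b i` on the sheets `s i`, `i ≤ m`, which are all different, form a
closed sequence. -/
structure IsOvalCycle (N d : ℕ) (k : ℕ → ℝ) (ξ : ℝ) (m : ℕ) (s : ℕ → ℕ) (a b : ℕ → ℝ) : Prop where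
  pos : 0 < m
  consecutive : ∀ i ≤ m, Consecutive N (N + d) k ξ (s i) (a i) (b i)
  glued : ∀ i < m, Glued N (N + d) k ξ (s i, b i) (s (i + 1), a (i + 1))
  close : Glued N (N + d) k ξ (s m, b m) (s 0, a 0)
  injOn : ∀ i ≤ m, ∀ j ≤ m, s i = s j → i = j

/-- The cyclic successor. -/
def cyclicSucc (m i : ℕ) : ℕ := if i = m then 0 else i + 1

variable {m : ℕ} {s : ℕ → ℕ} {a b : ℕ → ℝ}

lemma cyclicSucc_le {i : ℕ} (hi : i ≤ m) : cyclicSucc m i ≤ m := by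
  rw [cyclicSucc]
  split_ifs <;> omega

lemma exists_cyclicSucc_eq {i : ℕ} (hi : i ≤ m) : ∃ j ≤ m, cyclicSucc m j = i := by
  rcases Nat.eq_zero_or_pos i with rfl | h
  · exact ⟨m, le_rfl, if_pos rfl⟩
  · exact ⟨i - 1, by omega, by rw [cyclicSucc, if_neg (by omega)]; omega⟩

namespace IsOvalCycle

lemma glued_cyclicSucc (H : IsOvalCycle N d k ξ m s a b) {i : ℕ} (hi : i ≤ m) :
    Glued N (N + d) k ξ (s i, b i) (s (cyclicSucc m i), a (cyclicSucc m i)) := by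
  rw [cyclicSucc]
  split_ifs with h
  · rw [h]
    exact H.close
  · exact H.glued i (by omega)

lemma step_iff (h : IsGeneric N d k ξ) (H : IsOvalCycle N d k ξ m s a b) {i : ℕ} (hi : i ≤ m)
    {q : ℕ × ℝ} : Step N (N + d) k ξ (s i, a i) q ↔
      q = (s (cyclicSucc m i), a (cyclicSucc m i)) := by
  constructor
  · rintro ⟨c, h1, h2⟩
    obtain rfl := h1.unique (H.consecutive i hi)
    exact h2.unique h (H.glued_cyclicSucc hi)
  · rintro rfl
    exact ⟨b i, H.consecutive i hi, H.glued_cyclicSucc hi⟩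

/-- On a cycle the step is single-valued and equals the cyclic successor, so every starting point
leads to the whole cycle. -/
lemma reflTransGen_iff (h : IsGeneric N d k ξ) (H : IsOvalCycle N d k ξ m s a b) {i : ℕ}
    (hi : i ≤ m) {q : ℕ × ℝ} : Relation.ReflTransGen (Step N (N + d) k ξ) (s i, a i) q ↔
      ∃ j ≤ m, q = (s j, a j) := by
  constructor
  · intro hq
    induction hq with
    | refl => exact ⟨i, hi, rfl⟩
    | tail _ hst ih =>
      obtain ⟨j, hj, rfl⟩ := ih
      exact ⟨_, cyclicSucc_le hj, (H.step_iff h hj).1 hst⟩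
  · have hup : ∀ i j, i ≤ j → j ≤ m →
        Relation.ReflTransGen (Step N (N + d) k ξ) (s i, a i) (s j, a j) := by
      intro i j hij
      induction j, hij using Nat.le_induction with
      | base => exact fun _ => .refl
      | succ j _ ih =>
        intro hj
        refine (ih (by omega)).tail ((H.step_iff h (by omega)).2 ?_)
        rw [cyclicSucc, if_neg (by omega)]
    rintro ⟨j, hj, rfl⟩
    refine ((hup i m hi le_rfl).tail ((H.step_iff h le_rfl).2 rfl)).trans ?_
    rw [cyclicSucc, if_pos rfl]
    exact hup 0 j (Nat.zero_le j) hj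

lemma ovalFrom_eq (h : IsGeneric N d k ξ) (H : IsOvalCycle N d k ξ m s a b) {i : ℕ} (hi : i ≤ m) :
    ovalFrom N (N + d) k ξ (s i, a i) =
      {P | ∃ j ≤ m, P ∈ pt N (N + d) k ξ (s j) '' arc (a j) (b j)} := by
  ext P
  constructor
  · rintro ⟨q, c, h1, h2, h3⟩
    obtain ⟨j, hj, rfl⟩ := (H.reflTransGen_iff h hi).1 h1
    obtain rfl := h2.unique (H.consecutive j hj)
    exact ⟨j, hj, h3⟩
  · rintro ⟨j, hj, h3⟩
    exact ⟨_, _, (H.reflTransGen_iff h hi).2 ⟨j, hj, rfl⟩, H.consecutive j hj, h3⟩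

lemma glued_cases (h : IsGeneric N d k ξ) (H : IsOvalCycle N d k ξ m s a b) {j : ℕ} (hj : j ≤ m)
    {x : ℝ} (hx : ((x : ℂ) : OnePoint ℂ) ∈ arc (a j) (b j)) {q : ℕ × ℝ}
    (hq : Glued N (N + d) k ξ (s j, x) q) : ∃ i ≤ m,
      (i = cyclicSucc m j ∧ x = b j ∧ q = (s i, a i)) ∨
      (j = cyclicSucc m i ∧ x = a j ∧ q = (s i, b i)) := by
  rcases (H.consecutive j hj).2.2.2 x hq.marked hx with rfl | rfl
  · obtain ⟨i, hi, rfl⟩ := exists_cyclicSucc_eq hj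
    exact ⟨i, hi, .inr ⟨rfl, rfl, hq.unique h (H.glued_cyclicSucc hi).symm⟩⟩
  · exact ⟨_, cyclicSucc_le hj, .inl ⟨rfl, rfl, hq.unique h (H.glued_cyclicSucc hj)⟩⟩

/-- Different arcs of a cycle meet at the glued end points only. -/
lemma eq_of_mem_of_mem (h : IsGeneric N d k ξ) (H : IsOvalCycle N d k ξ m s a b) {i j : ℕ}
    (hi : i ≤ m) (hj : j ≤ m) (hij : i ≠ j) {P : Curve N (N + d) k ξ}
    (hP : P ∈ pt N (N + d) k ξ (s i) '' arc (a i) (b i))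
    (hP' : P ∈ pt N (N + d) k ξ (s j) '' arc (a j) (b j)) :
    (j = cyclicSucc m i ∧ P = pt N (N + d) k ξ (s j) ((a j : ℂ) : OnePoint ℂ)) ∨
      (i = cyclicSucc m j ∧ P = pt N (N + d) k ξ (s i) ((a i : ℂ) : OnePoint ℂ)) := by
  obtain ⟨z, hz, rfl⟩ := hP
  obtain ⟨z', hz', heq⟩ := hP'
  rcases (pt_eq_pt_iff h ((H.consecutive j hj).fst_le h) ((H.consecutive i hi).fst_le h)).1 heq with
    ⟨h1, -⟩ | ⟨x, y, h1, rfl, rfl⟩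
  · exact absurd (H.injOn j hj i hi h1).symm hij
  · obtain ⟨l, hl, ⟨h2, h3, h4⟩ | ⟨h2, h3, h4⟩⟩ := H.glued_cases h hj hz' h1
    · obtain rfl := H.injOn _ hl _ hi (Prod.mk.inj h4).1.symm
      exact .inr ⟨h2, by rw [(Prod.mk.inj h4).2]⟩
    · obtain rfl := H.injOn _ hl _ hi (Prod.mk.inj h4).1.symm
      refine .inl ⟨h2, ?_⟩
      rw [← heq, h3]

/-- The cycle has one arc on the sheet. Its other arcs can touch the sheet only in glued points,
which are end points of that arc. -/
lemma ovalFrom_inter_sheet (h : IsGeneric N d k ξ) (H : IsOvalCycle N d k ξ m s a b) {i j : ℕ}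
    (hi : i ≤ m) (hj : j ≤ m) : ovalFrom N (N + d) k ξ (s i, a i) ∩ sheet N (N + d) k ξ (s j) =
      pt N (N + d) k ξ (s j) '' arc (a j) (b j) := by
  rw [H.ovalFrom_eq h hi]
  refine Set.Subset.antisymm ?_ fun P hP => ⟨⟨j, hj, hP⟩, Set.image_subset_range _ _ hP⟩
  rintro P ⟨⟨l, hl, hP⟩, z', rfl⟩
  by_cases hlj : l = j
  · rwa [hlj] at hP
  obtain ⟨z, hz, heq⟩ := hP
  rcases (pt_eq_pt_iff h ((H.consecutive l hl).fst_le h) ((H.consecutive j hj).fst_le h)).1 heq with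
    ⟨h1, -⟩ | ⟨x, y, h1, rfl, rfl⟩
  · exact absurd (H.injOn l hl j hj h1) hlj
  · refine ⟨_, ?_, rfl⟩
    obtain ⟨n, hn, ⟨-, -, h4⟩ | ⟨-, -, h4⟩⟩ := H.glued_cases h hl hz h1
    · obtain rfl := H.injOn _ hn _ hj (Prod.mk.inj h4).1.symm
      rw [(Prod.mk.inj h4).2]
      exact left_mem_arc
    · obtain rfl := H.injOn _ hn _ hj (Prod.mk.inj h4).1.symm
      rw [(Prod.mk.inj h4).2]
      exact right_mem_arc

lemma ovalFrom_inter_sheet_eq_empty (h : IsGeneric N d k ξ) (H : IsOvalCycle N d k ξ m s a b)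
    {i t : ℕ} (hi : i ≤ m) (ht : t ≤ N) (hne : ∀ j ≤ m, t ≠ s j) :
    ovalFrom N (N + d) k ξ (s i, a i) ∩ sheet N (N + d) k ξ t = ∅ := by
  rw [H.ovalFrom_eq h hi, Set.eq_empty_iff_forall_notMem]
  rintro P ⟨⟨l, hl, z, hz, heq⟩, z', rfl⟩
  rcases (pt_eq_pt_iff h ((H.consecutive l hl).fst_le h) ht).1 heq with ⟨h1, -⟩ | ⟨x, y, h1, rfl, rfl⟩
  · exact hne l hl h1.symm
  · obtain ⟨n, hn, ⟨-, -, h4⟩ | ⟨-, -, h4⟩⟩ := H.glued_cases h hl hz h1 <;>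
      exact hne n hn (Prod.mk.inj h4).1

lemma nonempty_homeomorph_circle (h : IsGeneric N d k ξ) (H : IsOvalCycle N d k ξ m s a b) {i : ℕ}
    (hi : i ≤ m) : Nonempty (ovalFrom N (N + d) k ξ (s i, a i) ≃ₜ Circle) := by
  have := t2Space_curve h
  set x : ℕ → Curve N (N + d) k ξ := fun i => pt N (N + d) k ξ (s i) ((a i : ℂ) : OnePoint ℂ)
    with hx
  set S : ℕ → Set (Curve N (N + d) k ξ) := fun i => pt N (N + d) k ξ (s i) '' arc (a i) (b i)
    with hS
  have harc : ∀ j ≤ m, SimpleArc (x j) (x (cyclicSucc m j)) (S j) := by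
    intro j hj
    have hc := H.consecutive j hj
    have h1 := (simpleArc_arc hc.2.2.1).image (continuous_pt (N := N) (M := N + d) (k := k) (ξ := ξ)
      (s j)) (pt_injective h (hc.fst_le h))
    have h2 := (H.glued_cyclicSucc hj).pt_eq h
    simp only at h2
    rwa [h2] at h1
  -- All arcs but the last form one simple arc, and the last one closes it up.
  obtain ⟨n, rfl⟩ : ∃ n, m = n + 1 := ⟨m - 1, by have := H.pos; omega⟩
  have hsucc : ∀ i ≤ n, cyclicSucc (n + 1) i = i + 1 := fun i hi => if_neg (by omega)
  have h1 : SimpleArc (x 0) (x (n + 1)) {p | ∃ i ≤ n, p ∈ S i} := by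
    refine simpleArc_iUnion (fun i hi => ?_) fun i j hij hj p hp hp' => ?_
    · have := harc i (by omega)
      rwa [hsucc i hi] at this
    · rcases H.eq_of_mem_of_mem h (by omega) (by omega) hij.ne hp hp' with ⟨h2, h3⟩ | ⟨h2, -⟩
      · rw [hsucc i (by omega)] at h2
        exact ⟨h2, h3⟩
      · rw [hsucc j hj] at h2
        omega
  have h2 : SimpleArc (x (n + 1)) (x 0) (S (n + 1)) := by
    have := harc (n + 1) le_rfl
    rwa [cyclicSucc, if_pos rfl] at this
  have hU : ovalFrom N (N + d) k ξ (s i, a i) = {p | ∃ i ≤ n, p ∈ S i} ∪ S (n + 1) := by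
    rw [H.ovalFrom_eq h hi]
    ext P
    constructor
    · rintro ⟨j, hj, hP⟩
      rcases Nat.le_succ_iff.1 hj with hj | rfl
      · exact .inl ⟨j, hj, hP⟩
      · exact .inr hP
    · rintro (⟨j, hj, hP⟩ | hP)
      · exact ⟨j, by omega, hP⟩
      · exact ⟨n + 1, le_rfl, hP⟩
  rw [hU]
  refine h1.nonempty_homeomorph_circle h2 ?_
  rintro p ⟨⟨j, hj, hp⟩, hp'⟩
  rcases H.eq_of_mem_of_mem h (by omega) le_rfl (by omega) hp hp' with ⟨-, h3⟩ | ⟨h3, h4⟩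
  · exact .inr h3
  · rw [cyclicSucc, if_pos rfl] at h3
    subst h3
    exact .inl h4

end IsOvalCycle

/-- The marked point `p` starts one of the arcs of a closed sequence. -/
def InCycle (N d : ℕ) (k : ℕ → ℝ) (ξ : ℝ) (p : ℕ × ℝ) : Prop :=
  ∃ m s a b, IsOvalCycle N d k ξ m s a b ∧ ∃ i ≤ m, p = (s i, a i)

namespace InCycle

variable {p q : ℕ × ℝ}

lemma exists_consecutive (hp : InCycle N d k ξ p) : ∃ b, Consecutive N (N + d) k ξ p.1 p.2 b := by
  obtain ⟨m, s, a, b, H, i, hi, rfl⟩ := hp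
  exact ⟨_, H.consecutive i hi⟩

lemma ovalFrom_eq_of_reflTransGen (h : IsGeneric N d k ξ) (hp : InCycle N d k ξ p)
    (hpq : Relation.ReflTransGen (Step N (N + d) k ξ) p q) :
    ovalFrom N (N + d) k ξ p = ovalFrom N (N + d) k ξ q := by
  obtain ⟨m, s, a, b, H, i, hi, rfl⟩ := hp
  obtain ⟨j, hj, rfl⟩ := (H.reflTransGen_iff h hi).1 hpq
  rw [H.ovalFrom_eq h hi, H.ovalFrom_eq h hj]

/-- The partner of the starting point of an arc is the end point of the preceding arc. If it also
started an arc of the same cycle, that arc, being the only one on its sheet, would have equal end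
points. -/
lemma ovalFrom_ne_of_glued (h : IsGeneric N d k ξ) (hp : InCycle N d k ξ p)
    (hq : InCycle N d k ξ q) (hpq : Glued N (N + d) k ξ p q) :
    ovalFrom N (N + d) k ξ p ≠ ovalFrom N (N + d) k ξ q := by
  intro heq
  obtain ⟨c, hc⟩ := hq.exists_consecutive
  have hr := reflTransGen_of_ovalFrom_eq h hc heq.symm
  obtain ⟨m, s, a, b, H, i, hi, rfl⟩ := hp
  obtain ⟨j, hj, rfl⟩ := (H.reflTransGen_iff h hi).1 hr
  obtain ⟨l, hl, rfl⟩ := exists_cyclicSucc_eq hi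
  have h1 := Prod.mk.inj (hpq.unique h (H.glued_cyclicSucc hl).symm)
  obtain rfl := H.injOn j hj l hl h1.1
  exact (H.consecutive j hj).2.2.1 h1.2

end InCycle

lemma sUnion_ovals (h : IsGeneric N d k ξ) : ⋃₀ ovals N (N + d) k ξ = realPart N (N + d) k ξ := by
  ext P
  constructor
  · rintro ⟨S, ⟨p, -, rfl⟩, q, b, -, hq, z, hz, rfl⟩
    exact (pt_mem_realPart_iff h (hq.fst_le h)).2 (mem_arc_cases hz)
  · intro hP
    obtain ⟨s, hs, z, rfl⟩ := exists_eq_pt P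
    obtain ⟨a, b, hab, hz⟩ := exists_consecutive_mem_arc h hs ((pt_mem_realPart_iff h hs).1 hP)
    exact ⟨_, ⟨(s, a), hab.1, rfl⟩, _, b, .refl, hab, z, hz, rfl⟩

lemma encard_ovals_of_mem_doublePoints (h : IsGeneric N d k ξ)
    (hall : ∀ p, Marked N (N + d) k ξ p → InCycle N d k ξ p) {P : Curve N (N + d) k ξ}
    (hP : P ∈ doublePoints N (N + d) k ξ) : {S ∈ ovals N (N + d) k ξ | P ∈ S}.encard = 2 := by
  obtain ⟨p, q, hpq, rfl⟩ := (mem_doublePoints_iff h).1 hP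
  have hself : ∀ {p}, InCycle N d k ξ p →
      pt N (N + d) k ξ p.1 ((p.2 : ℂ) : OnePoint ℂ) ∈ ovalFrom N (N + d) k ξ p := by
    intro p hp
    obtain ⟨c, hc⟩ := hp.exists_consecutive
    exact ⟨p, c, .refl, hc, _, left_mem_arc, rfl⟩
  have hp := hall p hpq.marked
  have hq := hall q hpq.symm.marked
  have hset : {S ∈ ovals N (N + d) k ξ | toCurve N (N + d) k ξ (realPt N p) ∈ S} =
      {ovalFrom N (N + d) k ξ p, ovalFrom N (N + d) k ξ q} := by
    ext S
    constructor
    · rintro ⟨⟨p₀, hp₀, rfl⟩, q₀, c, h1, h2, z, hz, heq⟩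
      have hin := hall p₀ hp₀
      -- A marked point of an arc is its start, or its end; in the second case the next arc starts
      -- at the partner.
      have key : ∀ x : ℝ, ∀ p' q', Glued N (N + d) k ξ p' q' → z = ((x : ℂ) : OnePoint ℂ) →
          (q₀.1, x) = p' → ovalFrom N (N + d) k ξ p₀ = ovalFrom N (N + d) k ξ p' ∨
            ovalFrom N (N + d) k ξ p₀ = ovalFrom N (N + d) k ξ q' := by
        rintro x p' q' hg rfl rfl
        rcases h2.2.2.2 x hg.marked hz with rfl | rfl
        · exact .inl (hin.ovalFrom_eq_of_reflTransGen h h1)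
        · exact .inr (hin.ovalFrom_eq_of_reflTransGen h (h1.tail ⟨_, h2, hg⟩))
      rcases (pt_eq_pt_iff h (h2.fst_le h) (hpq.marked.fst_le h.one_le)).1 heq with
        ⟨h3, h4⟩ | ⟨x, y, h3, h4, h5⟩
      · exact key p.2 p q hpq h4 (Prod.ext h3 rfl)
      · obtain rfl := coe_ofReal_injective h5
        exact (key x q p hpq.symm h4 (h3.symm.unique h hpq)).symm
    · rintro (rfl | rfl)
      · exact ⟨⟨p, hpq.marked, rfl⟩, hself hp⟩
      · refine ⟨⟨q, hpq.symm.marked, rfl⟩, ?_⟩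
        have := hself hq
        rwa [← hpq.pt_eq h] at this
  rw [hset, Set.encard_pair (hp.ovalFrom_ne_of_glued h hq hpq)]

lemma existsUnique_oval (h : IsGeneric N d k ξ)
    (hall : ∀ p, Marked N (N + d) k ξ p → InCycle N d k ξ p) {P : Curve N (N + d) k ξ}
    (hP : P ∈ realPart N (N + d) k ξ) (hP' : P ∉ doublePoints N (N + d) k ξ) :
    ∃! S, S ∈ ovals N (N + d) k ξ ∧ P ∈ S := by
  obtain ⟨s, hs, z, rfl⟩ := exists_eq_pt P
  obtain ⟨a, b, hab, hz⟩ := exists_consecutive_mem_arc h hs ((pt_mem_realPart_iff h hs).1 hP)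
  have hm : ∀ x : ℝ, z = ((x : ℂ) : OnePoint ℂ) → ¬ Marked N (N + d) k ξ (s, x) := by
    rintro x rfl ⟨q, hq⟩
    exact hP' ((mem_doublePoints_iff h).2 ⟨_, q, hq, rfl⟩)
  refine ⟨ovalFrom N (N + d) k ξ (s, a), ⟨⟨_, hab.1, rfl⟩, _, b, .refl, hab, z, hz, rfl⟩, ?_⟩
  rintro S ⟨⟨p, hp, rfl⟩, hS⟩
  exact (hall p hp).ovalFrom_eq_of_reflTransGen h ((pt_mem_ovalFrom_iff h hab hz hm).1 hS)

lemma isCircle_of_mem_ovals (h : IsGeneric N d k ξ)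
    (hall : ∀ p, Marked N (N + d) k ξ p → InCycle N d k ξ p) {S : Set (Curve N (N + d) k ξ)}
    (hS : S ∈ ovals N (N + d) k ξ) : Nonempty (S ≃ₜ Circle) := by
  obtain ⟨p, hp, rfl⟩ := hS
  obtain ⟨m, s, a, b, H, i, hi, rfl⟩ := hall p hp
  exact H.nonempty_homeomorph_circle h hi

end

end

section

/-! ### The ovals -/

section

variable {N d : ℕ} {k : ℕ → ℝ} {ξ : ℝ}

lemma consecutive_k (h : IsGeneric N d k ξ) {j : ℕ} (h1 : 1 ≤ j) (h2 : j < N + d) :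
    Consecutive N (N + d) k ξ 0 (k j) (k (j + 1)) := by
  have := consecutive_mark h (Nat.zero_le N) h1 (by rwa [markCount, if_pos rfl])
  rwa [mark_zero, mark_zero] at this

lemma consecutive_k_last (h : IsGeneric N d k ξ) :
    Consecutive N (N + d) k ξ 0 (k (N + d)) (k 1) := by
  have := consecutive_mark_last h (Nat.zero_le N)
  rwa [mark_zero, mark_zero, markCount, if_pos rfl] at this

lemma lt_markCount (hd : 1 ≤ d) {r : ℕ} (hr : 1 ≤ r) : d + 1 ≤ markCount N d r := by
  rw [markCount, if_neg (by omega)]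
  split_ifs <;> omega

lemma consecutive_lam (h : IsGeneric N d k ξ) {r n : ℕ} (hr : 1 ≤ r) (hrN : r ≤ N) (hn : 1 ≤ n)
    (hnd : n ≤ d) : Consecutive N (N + d) k ξ r (lam ξ (n + 1)) (lam ξ n) := by
  have := lt_markCount (N := N) h.one_le_sub hr
  have := consecutive_mark h hrN (show 1 ≤ d + 2 - (n + 1) by omega) (by omega)
  rwa [mark_lam hr (by omega) (by omega), show d + 2 - (n + 1) + 1 = d + 2 - n by omega,
    mark_lam hr hn (by omega)] at this

lemma consecutive_lam_alpha (h : IsGeneric N d k ξ) {r : ℕ} (hr : 1 ≤ r) (hrN : r < N) :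
    Consecutive N (N + d) k ξ r (lam ξ 1) (alpha ξ 2) := by
  have hd := h.one_le_sub
  have := consecutive_mark h hrN.le (show 1 ≤ d + 2 - 1 by omega) (by
    rw [markCount, if_neg (by omega), if_pos hrN]; omega)
  rwa [mark_lam hr le_rfl (by omega), show d + 2 - 1 + 1 = d + 2 by omega, mark_alpha hr le_rfl]
    at this

lemma consecutive_alpha (h : IsGeneric N d k ξ) {r n : ℕ} (hr : 1 ≤ r) (hrN : r < N) (hn : 2 ≤ n)
    (hnd : n ≤ d) : Consecutive N (N + d) k ξ r (alpha ξ n) (alpha ξ (n + 1)) := by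
  have := consecutive_mark h hrN.le (show 1 ≤ d + n by omega) (by
    rw [markCount, if_neg (by omega), if_pos hrN]; omega)
  rwa [mark_alpha hr hn, show d + n + 1 = d + (n + 1) by omega, mark_alpha hr (by omega)] at this

lemma consecutive_alpha_lam (h : IsGeneric N d k ξ) {r : ℕ} (hr : 1 ≤ r) (hrN : r < N) :
    Consecutive N (N + d) k ξ r (alpha ξ (d + 1)) (lam ξ (d + 1)) := by
  have hd := h.one_le_sub
  have := consecutive_mark_last h hrN.le
  rw [markCount, if_neg (by omega), if_pos hrN, show 2 * d + 1 = d + (d + 1) by omega,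
    mark_alpha hr (by omega)] at this
  have h1 := mark_lam (d := d) (k := k) (ξ := ξ) hr (show 1 ≤ d + 1 by omega) le_rfl
  rw [show d + 2 - (d + 1) = 1 by omega] at h1
  rwa [h1] at this

lemma consecutive_lam_last (h : IsGeneric N d k ξ) :
    Consecutive N (N + d) k ξ N (lam ξ 1) (lam ξ (d + 1)) := by
  have hN := h.one_le
  have := consecutive_mark_last h (le_refl N)
  rw [markCount, if_neg (by omega), if_neg (lt_irrefl N)] at this
  have h1 := mark_lam (d := d) (k := k) (ξ := ξ) hN (show 1 ≤ d + 1 by omega) le_rfl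
  have h2 := mark_lam (d := d) (k := k) (ξ := ξ) hN le_rfl (show 1 ≤ d + 1 by omega)
  rw [show d + 2 - (d + 1) = 1 by omega] at h1
  rw [show d + 2 - 1 = d + 1 by omega] at h2
  rwa [h1, h2] at this

lemma glued_lam_one {r : ℕ} (hr : 1 ≤ r) (hrN : r ≤ N) :
    Glued N (N + d) k ξ (r, lam ξ 1) (0, k (N - r + 1)) := by
  rcases hr.eq_or_lt with rfl | h1
  · have := glued_base (N := N) (k := k) (ξ := ξ) (d := d) le_rfl (by omega)
    rwa [show N + 1 - 1 = N - 1 + 1 by omega] at this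
  · exact glued_first h1 hrN

/-- A function on the first three indices. -/
def seq3 {α : Type*} (x y z : α) (i : ℕ) : α := if i = 0 then x else if i = 1 then y else z

@[simp] lemma seq3_zero {α : Type*} (x y z : α) : seq3 x y z 0 = x := rfl
@[simp] lemma seq3_one {α : Type*} (x y z : α) : seq3 x y z 1 = y := rfl
@[simp] lemma seq3_two {α : Type*} (x y z : α) : seq3 x y z 2 = z := rfl

lemma isOvalCycle_pair {s₀ s₁ : ℕ} {a₀ a₁ b₀ b₁ : ℝ} (hs : s₀ ≠ s₁)
    (h₀ : Consecutive N (N + d) k ξ s₀ a₀ b₀) (h₁ : Consecutive N (N + d) k ξ s₁ a₁ b₁)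
    (g₀ : Glued N (N + d) k ξ (s₀, b₀) (s₁, a₁)) (g₁ : Glued N (N + d) k ξ (s₁, b₁) (s₀, a₀)) :
    IsOvalCycle N d k ξ 1 (seq3 s₀ s₁ s₁) (seq3 a₀ a₁ a₁) (seq3 b₀ b₁ b₁) where
  pos := one_pos
  consecutive i hi := by interval_cases i <;> simpa
  glued i hi := by interval_cases i; simpa
  close := by simpa
  injOn i hi j hj := by
    interval_cases i <;> interval_cases j <;> simp [hs, hs.symm]

/-- The oval `Ω_{1,n}`. -/
lemma isOvalCycle_base (h : IsGeneric N d k ξ) {n : ℕ} (hn : 1 ≤ n) (hnd : n ≤ d) :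
    IsOvalCycle N d k ξ 1 (seq3 0 1 1) (seq3 (k (N + n - 1)) (lam ξ (n + 1)) (lam ξ (n + 1)))
      (seq3 (k (N + n)) (lam ξ n) (lam ξ n)) := by
  have hN := h.one_le
  have h1 := consecutive_k h (show 1 ≤ N + n - 1 by omega) (by omega)
  rw [show N + n - 1 + 1 = N + n by omega] at h1
  have h2 := glued_base (N := N) (d := d) (k := k) (ξ := ξ) (show 1 ≤ n + 1 by omega) (by omega)
  rw [show N + (n + 1) - 1 = N + n by omega] at h2
  exact isOvalCycle_pair zero_ne_one h1 (consecutive_lam h le_rfl hN hn hnd) h2.symm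
    (glued_base hn (by omega))

/-- The oval `Ω_{r,1}`, `r ≥ 2`. -/
lemma isOvalCycle_first (h : IsGeneric N d k ξ) {r : ℕ} (hr : 2 ≤ r) (hrN : r ≤ N) :
    IsOvalCycle N d k ξ 2 (seq3 0 (r - 1) r) (seq3 (k (N - r + 1)) (lam ξ 1) (lam ξ 2))
      (seq3 (k (N - r + 2)) (alpha ξ 2) (lam ξ 1)) where
  pos := two_pos
  consecutive i hi := by
    have hd := h.one_le_sub
    interval_cases i
    · exact consecutive_k h (by omega) (by omega)
    · exact consecutive_lam_alpha h (show 1 ≤ r - 1 by omega) (show r - 1 < N by omega)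
    · exact consecutive_lam h (show 1 ≤ r by omega) hrN le_rfl hd
  glued i hi := by
    have hd := h.one_le_sub
    interval_cases i
    · have := glued_lam_one (d := d) (k := k) (ξ := ξ) (show 1 ≤ r - 1 by omega)
        (show r - 1 ≤ N by omega)
      rw [show N - (r - 1) + 1 = N - r + 2 by omega] at this
      exact this.symm
    · exact (glued_chain hr hrN le_rfl (by omega)).symm
  close := glued_first hr hrN
  injOn i hi j hj := by
    interval_cases i <;> interval_cases j <;> simp <;> omega

/-- The oval `Ω_{r,n}`, `r, n ≥ 2`. -/
lemma isOvalCycle_chain (h : IsGeneric N d k ξ) {r n : ℕ} (hr : 2 ≤ r) (hrN : r ≤ N) (hn : 2 ≤ n)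
    (hnd : n ≤ d) :
    IsOvalCycle N d k ξ 1 (seq3 (r - 1) r r) (seq3 (alpha ξ n) (lam ξ (n + 1)) (lam ξ (n + 1)))
      (seq3 (alpha ξ (n + 1)) (lam ξ n) (lam ξ n)) :=
  isOvalCycle_pair (by omega) (consecutive_alpha h (by omega) (by omega) hn hnd)
    (consecutive_lam h (by omega) hrN (by omega) hnd)
    (glued_chain hr hrN (by omega) (by omega)).symm (glued_chain hr hrN hn (by omega))

/-- The oval `Ω_0`. -/
lemma isOvalCycle_zero (h : IsGeneric N d k ξ) :
    IsOvalCycle N d k ξ N (fun i => if i = 0 then 0 else N + 1 - i)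
      (seq3 (k (N + d)) (lam ξ 1) (alpha ξ (d + 1)))
      (seq3 (k 1) (lam ξ (d + 1)) (lam ξ (d + 1))) where
  pos := h.one_le
  -- The oval passes through infinity on `Γ_0`, then on `Γ_N`, and then descends through `Γ_{N-1},
  -- …, Γ_1`. On `Γ_N` there are no points `α_l`, so the arc starts at `λ_1` there.
  consecutive i hi := by
    rcases (by omega : i = 0 ∨ i = 1 ∨ 2 ≤ i) with rfl | rfl | h2
    · exact consecutive_k_last h
    · exact consecutive_lam_last h
    · simp only [seq3, show i ≠ 0 by omega, show i ≠ 1 by omega, if_false]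
      exact consecutive_alpha_lam h (by omega) (by omega)
  glued i hi := by
    have hd := h.one_le_sub
    rcases Nat.eq_zero_or_pos i with rfl | h2
    · have := glued_lam_one (d := d) (k := k) (ξ := ξ) h.one_le le_rfl
      rw [Nat.sub_self] at this
      exact this.symm
    · have h3 : seq3 (k 1) (lam ξ (d + 1)) (lam ξ (d + 1)) i = lam ξ (d + 1) := by
        simp [seq3, show i ≠ 0 by omega]
      simp only [h3]
      simp only [seq3, show i ≠ 0 by omega, show i + 1 ≠ 0 by omega, show i + 1 ≠ 1 by omega,
        if_false]
      have := glued_chain (k := k) (ξ := ξ) (show 2 ≤ N + 1 - i by omega)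
        (show N + 1 - i ≤ N by omega) (show 2 ≤ d + 1 by omega) le_rfl
      rwa [show N + 1 - i - 1 = N + 1 - (i + 1) by omega] at this
  close := by
    have hN := h.one_le
    have h3 : seq3 (k 1) (lam ξ (d + 1)) (lam ξ (d + 1)) N = lam ξ (d + 1) := by
      simp [seq3, show N ≠ 0 by omega]
    rw [h3]
    simp only [show N ≠ 0 by omega, if_false, if_true, seq3_zero]
    have := glued_base (N := N) (d := d) (k := k) (ξ := ξ) (show 1 ≤ d + 1 by omega) le_rfl
    rw [show N + (d + 1) - 1 = N + d by omega] at this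
    rwa [show N + 1 - N = 1 by omega]
  injOn i hi j hj := by
    split_ifs <;> omega

/-- The oval `Ω_{r,n}`. -/
def oval (N M : ℕ) (k : ℕ → ℝ) (ξ : ℝ) (r n : ℕ) : Set (Curve N M k ξ) :=
  ovalFrom N M k ξ (r, lam ξ (n + 1))

/-- Each marked point starts an arc of `Ω_0` or of some `Ω_{r,n}`. -/
lemma marked_cases (h : IsGeneric N d k ξ) {p : ℕ × ℝ} (hp : Marked N (N + d) k ξ p) :
    InCycle N d k ξ p ∧ (Relation.ReflTransGen (Step N (N + d) k ξ) (0, k (N + d)) p ∨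
      ∃ r ∈ Finset.Icc 1 N, ∃ n ∈ Finset.Icc 1 d,
        Relation.ReflTransGen (Step N (N + d) k ξ) (r, lam ξ (n + 1)) p) := by
  have hN := h.one_le
  have hd := h.one_le_sub
  have H0 := isOvalCycle_zero h
  obtain ⟨s, c⟩ := p
  obtain ⟨hs, j, ⟨h1, h2⟩, rfl⟩ := (marked_iff h).1 hp
  rcases Nat.eq_zero_or_pos s with rfl | hs0
  · rw [mark_zero]
    rw [markCount, if_pos rfl] at h2
    rcases (by omega : j = N + d ∨ (N ≤ j ∧ j < N + d) ∨ j < N) with rfl | h3 | h3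
    · exact ⟨⟨_, _, _, _, H0, 0, Nat.zero_le _, rfl⟩, .inl .refl⟩
    · have H := isOvalCycle_base h (show 1 ≤ j + 1 - N by omega) (show j + 1 - N ≤ d by omega)
      rw [show N + (j + 1 - N) - 1 = j by omega] at H
      exact ⟨⟨_, _, _, _, H, 0, Nat.zero_le _, rfl⟩, .inr ⟨1, Finset.mem_Icc.2 ⟨le_rfl, hN⟩,
        j + 1 - N, Finset.mem_Icc.2 (by omega),
        (H.reflTransGen_iff h (i := 1) le_rfl).2 ⟨0, Nat.zero_le _, rfl⟩⟩⟩
    · have H := isOvalCycle_first h (show 2 ≤ N + 1 - j by omega) (show N + 1 - j ≤ N by omega)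
      rw [show N - (N + 1 - j) + 1 = j by omega] at H
      exact ⟨⟨_, _, _, _, H, 0, Nat.zero_le _, rfl⟩, .inr ⟨N + 1 - j, Finset.mem_Icc.2 (by omega),
        1, Finset.mem_Icc.2 ⟨le_rfl, hd⟩,
        (H.reflTransGen_iff h (i := 2) le_rfl).2 ⟨0, Nat.zero_le _, rfl⟩⟩⟩
  rcases (by omega : j ≤ d ∨ j = d + 1 ∨ d + 1 < j) with h3 | rfl | h3
  · have e : mark d k ξ s j = lam ξ (d + 1 - j + 1) := by
      rw [mark, if_neg (by omega), if_pos (by omega)]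
      congr 1
      omega
    rw [e]
    refine ⟨?_, .inr ⟨s, Finset.mem_Icc.2 ⟨hs0, hs⟩, d + 1 - j, Finset.mem_Icc.2 (by omega), .refl⟩⟩
    rcases (by omega : s = 1 ∨ 2 ≤ s) with rfl | hs2
    · exact ⟨_, _, _, _, isOvalCycle_base h (n := d + 1 - j) (by omega) (by omega), 1, le_rfl, rfl⟩
    · rcases (by omega : d + 1 - j = 1 ∨ 2 ≤ d + 1 - j) with h4 | h4
      · rw [h4]
        exact ⟨_, _, _, _, isOvalCycle_first h hs2 hs, 2, le_rfl, rfl⟩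
      · exact ⟨_, _, _, _, isOvalCycle_chain h hs2 hs h4 (by omega), 1, le_rfl, rfl⟩
  · have e := mark_lam (d := d) (k := k) (ξ := ξ) hs0 le_rfl (show 1 ≤ d + 1 by omega)
    rw [show d + 2 - 1 = d + 1 by omega] at e
    rw [e]
    rcases hs.eq_or_lt with rfl | hs1
    · exact ⟨⟨_, _, _, _, H0, 1, hN, by simp⟩,
        .inl ((H0.reflTransGen_iff h (i := 0) (Nat.zero_le _)).2 ⟨1, hN, by simp⟩)⟩
    · have H := isOvalCycle_first h (show 2 ≤ s + 1 by omega) hs1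
      exact ⟨⟨_, _, _, _, H, 1, by omega, rfl⟩, .inr ⟨s + 1, Finset.mem_Icc.2 (by omega), 1,
        Finset.mem_Icc.2 ⟨le_rfl, hd⟩,
        (H.reflTransGen_iff h (i := 2) le_rfl).2 ⟨1, by omega, rfl⟩⟩⟩
  · rw [markCount, if_neg (by omega)] at h2
    split_ifs at h2 with hs1
    · have e := mark_alpha (d := d) (k := k) (ξ := ξ) hs0 (show 2 ≤ j - d by omega)
      rw [show d + (j - d) = j by omega] at e
      rw [e]
      rcases (by omega : j - d = d + 1 ∨ j - d ≤ d) with h4 | h4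
      · have hi : (s, alpha ξ (j - d)) = ((fun i => if i = 0 then 0 else N + 1 - i) (N + 1 - s),
            seq3 (k (N + d)) (lam ξ 1) (alpha ξ (d + 1)) (N + 1 - s)) := by
          simp only [seq3, show N + 1 - s ≠ 0 by omega, show N + 1 - s ≠ 1 by omega, if_false]
          rw [h4, show N + 1 - (N + 1 - s) = s by omega]
        exact ⟨⟨_, _, _, _, H0, N + 1 - s, by omega, hi⟩,
          .inl ((H0.reflTransGen_iff h (i := 0) (Nat.zero_le _)).2 ⟨N + 1 - s, by omega, hi⟩)⟩
      · have H := isOvalCycle_chain h (show 2 ≤ s + 1 by omega) hs1 (show 2 ≤ j - d by omega) h4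
        exact ⟨⟨_, _, _, _, H, 0, Nat.zero_le _, rfl⟩, .inr ⟨s + 1, Finset.mem_Icc.2 (by omega),
          j - d, Finset.mem_Icc.2 (by omega),
          (H.reflTransGen_iff h (i := 1) le_rfl).2 ⟨0, Nat.zero_le _, rfl⟩⟩⟩
    · omega

lemma inCycle_of_marked (h : IsGeneric N d k ξ) (p : ℕ × ℝ) (hp : Marked N (N + d) k ξ p) :
    InCycle N d k ξ p := (marked_cases h hp).1

lemma marked_lam (h : IsGeneric N d k ξ) {r n : ℕ} (hr : r ∈ Finset.Icc 1 N)
    (hn : n ∈ Finset.Icc 1 d) : Marked N (N + d) k ξ (r, lam ξ (n + 1)) := by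
  rw [Finset.mem_Icc] at hr hn
  exact (consecutive_lam h hr.1 hr.2 hn.1 hn.2).1

lemma ovals_eq (h : IsGeneric N d k ξ) : ovals N (N + d) k ξ =
    insert (ovalFrom N (N + d) k ξ (0, k (N + d)))
      {S | ∃ r ∈ Finset.Icc 1 N, ∃ n ∈ Finset.Icc 1 d, S = oval N (N + d) k ξ r n} := by
  ext S
  constructor
  · rintro ⟨p, hp, rfl⟩
    rcases (marked_cases h hp).2 with h1 | ⟨r, hr, n, hn, h1⟩
    · exact .inl ((inCycle_of_marked h _
        (consecutive_k_last h).1).ovalFrom_eq_of_reflTransGen h h1).symm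
    · exact .inr ⟨r, hr, n, hn, ((inCycle_of_marked h _
        (marked_lam h hr hn)).ovalFrom_eq_of_reflTransGen h h1).symm⟩
  · rintro (rfl | ⟨r, hr, n, hn, rfl⟩)
    · exact ⟨_, (consecutive_k_last h).1, rfl⟩
    · exact ⟨_, marked_lam h hr hn, rfl⟩

lemma lam_neg (hξ : 1 < ξ) {n : ℕ} (hn : 2 ≤ n) : lam ξ n < 0 := by
  have := lam_lt hξ le_rfl (show 1 < n by omega)
  rwa [lam_one] at this

/-- The arcs of `Ω_{r,n}` are distinguished from those of all other ovals by one starting point. -/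
lemma eq_of_reflTransGen_lam (h : IsGeneric N d k ξ) {r n : ℕ} (hr : r ∈ Finset.Icc 1 N)
    (hn : n ∈ Finset.Icc 1 d) {q : ℕ × ℝ}
    (hq : Relation.ReflTransGen (Step N (N + d) k ξ) (r, lam ξ (n + 1)) q) (hq1 : q.1 ≠ 0)
    (hq2 : q.2 < 0) : q = (r, lam ξ (n + 1)) := by
  rw [Finset.mem_Icc] at hr hn
  have hξ0 : 0 < ξ := zero_lt_one.trans h.one_lt
  rcases hr.1.eq_or_lt with rfl | hr2
  · obtain ⟨j, hj, rfl⟩ := ((isOvalCycle_base h hn.1 hn.2).reflTransGen_iff h (i := 1) le_rfl).1 hq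
    interval_cases j
    · exact absurd rfl hq1
    · rfl
  · rcases hn.1.eq_or_lt with rfl | hn2
    · obtain ⟨j, hj, rfl⟩ := ((isOvalCycle_first h hr2 hr.2).reflTransGen_iff h (i := 2) le_rfl).1 hq
      interval_cases j
      · exact absurd rfl hq1
      · rw [seq3_one, seq3_one, lam_one] at hq2
        exact absurd hq2 (lt_irrefl _)
      · rfl
    · obtain ⟨j, hj, rfl⟩ :=
        ((isOvalCycle_chain h hr2 hr.2 hn2 hn.2).reflTransGen_iff h (i := 1) le_rfl).1 hq
      interval_cases j
      · exact absurd hq2 (alpha_pos hξ0 _).not_gt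
      · rfl

/-- Each `Ω_{r,n}` has exactly one arc that starts at a negative point of a sheet other than `Γ_0`,
and this starting point determines `r` and `n`. -/
lemma oval_injOn (h : IsGeneric N d k ξ) :
    Set.InjOn (fun ν : ℕ × ℕ => oval N (N + d) k ξ ν.1 ν.2)
      (Finset.Icc 1 N ×ˢ Finset.Icc 1 d : Finset (ℕ × ℕ)) := by
  rintro ⟨r, n⟩ hν ⟨r', n'⟩ hν' heq
  obtain ⟨hr, hn⟩ := Finset.mem_product.1 (Finset.mem_coe.1 hν)
  obtain ⟨hr', hn'⟩ := Finset.mem_product.1 (Finset.mem_coe.1 hν')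
  have hr1 := Finset.mem_Icc.1 hr
  have hn1 := Finset.mem_Icc.1 hn
  have hn1' := Finset.mem_Icc.1 hn'
  obtain ⟨c, hc⟩ := (inCycle_of_marked h _ (marked_lam h hr hn)).exists_consecutive
  have h1 := Prod.mk.inj (eq_of_reflTransGen_lam h hr' hn' (reflTransGen_of_ovalFrom_eq h hc heq)
    (show r ≠ 0 by omega) (lam_neg h.one_lt (by omega)))
  have h2 := (decreasing_lam d h.one_lt).injOn (show n + 1 ∈ Set.Icc 1 (d + 1) from ⟨by omega, by omega⟩)
    (show n' + 1 ∈ Set.Icc 1 (d + 1) from ⟨by omega, by omega⟩) h1.2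
  exact Prod.ext h1.1 (by simpa using h2)

/-- Outside `Γ_0` the arcs of `Ω_0` start at `λ_1 = 0` or at some `α_{d+1} > 0`, never at a negative
point. -/
lemma ovalFrom_zero_ne_oval (h : IsGeneric N d k ξ) {r n : ℕ} (hr : r ∈ Finset.Icc 1 N)
    (hn : n ∈ Finset.Icc 1 d) : ovalFrom N (N + d) k ξ (0, k (N + d)) ≠ oval N (N + d) k ξ r n := by
  intro heq
  have hr1 := Finset.mem_Icc.1 hr
  have hn1 := Finset.mem_Icc.1 hn
  have hneg : lam ξ (n + 1) < 0 := lam_neg h.one_lt (by omega)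
  have hξ0 : 0 < ξ := zero_lt_one.trans h.one_lt
  obtain ⟨c, hc⟩ := (inCycle_of_marked h _ (marked_lam h hr hn)).exists_consecutive
  obtain ⟨j, -, hj⟩ := ((isOvalCycle_zero h).reflTransGen_iff h (i := 0) (Nat.zero_le _)).1
    (reflTransGen_of_ovalFrom_eq h hc heq.symm)
  obtain ⟨h1, h2⟩ := Prod.mk.inj hj
  rcases (by omega : j = 0 ∨ j = 1 ∨ 2 ≤ j) with rfl | rfl | h3
  · simp only [if_true] at h1
    omega
  · rw [seq3_one, lam_one] at h2
    exact hneg.ne h2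
  · simp only [seq3, show j ≠ 0 by omega, show j ≠ 1 by omega, if_false] at h2
    have := alpha_pos hξ0 (d + 1)
    linarith

lemma encard_ovals (h : IsGeneric N d k ξ) :
    (ovals N (N + d) k ξ).encard = ((N * d : ℕ) : ℕ∞) + 1 := by
  have hset : {S | ∃ r ∈ Finset.Icc 1 N, ∃ n ∈ Finset.Icc 1 d, S = oval N (N + d) k ξ r n} =
      (fun ν : ℕ × ℕ => oval N (N + d) k ξ ν.1 ν.2) ''
        (Finset.Icc 1 N ×ˢ Finset.Icc 1 d : Finset (ℕ × ℕ)) := by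
    ext S
    constructor
    · rintro ⟨r, hr, n, hn, rfl⟩
      exact ⟨(r, n), Finset.mem_coe.2 (Finset.mem_product.2 ⟨hr, hn⟩), rfl⟩
    · rintro ⟨⟨r, n⟩, hν, rfl⟩
      obtain ⟨hr, hn⟩ := Finset.mem_product.1 (Finset.mem_coe.1 hν)
      exact ⟨r, hr, n, hn, rfl⟩
  rw [ovals_eq h, Set.encard_insert_of_notMem, hset, (oval_injOn h).encard_image,
    Set.encard_coe_eq_coe_finsetCard, Finset.card_product, Nat.card_Icc, Nat.card_Icc,
    Nat.add_sub_cancel, Nat.add_sub_cancel]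
  rintro ⟨r, hr, n, hn, heq⟩
  exact ovalFrom_zero_ne_oval h hr hn heq

theorem isRationalMCurve (h : IsGeneric N d k ξ) : IsRationalMCurve N (N + d) k ξ (N * d) where
  connected := connectedSpace_curve h
  nodal := encard_fiber_le h
  genus := arithmeticGenus_eq h
  real := sUnion_ovals h
  card := encard_ovals h
  circle _ hS := isCircle_of_mem_ovals h (inCycle_of_marked h) hS

/-! ### The intersections of the ovals with the sheets -/

lemma arc_of_lt {a b : ℝ} (hab : a < b) : arc a b = interval a b := if_pos hab

/-- On each sheet `Ω_0` runs from the largest marked point to the smallest one, hence through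
infinity. -/
lemma infty_mem_ovalFrom_zero (h : IsGeneric N d k ξ) {r : ℕ} (hr : r ≤ N) :
    pt N (N + d) k ξ r OnePoint.infty ∈ ovalFrom N (N + d) k ξ (0, k (N + d)) := by
  have H := isOvalCycle_zero h
  have hd := h.one_le_sub
  have hN := h.one_le
  have key : ∀ j ≤ N, (if j = 0 then 0 else N + 1 - j) = r →
      seq3 (k 1) (lam ξ (d + 1)) (lam ξ (d + 1)) j ≤
        seq3 (k (N + d)) (lam ξ 1) (alpha ξ (d + 1)) j →
      pt N (N + d) k ξ r OnePoint.infty ∈ ovalFrom N (N + d) k ξ (0, k (N + d)) := by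
    rintro j hj rfl hle
    have h1 := H.ovalFrom_eq h (Nat.zero_le N)
    simp only [if_true, seq3_zero] at h1
    rw [h1]
    exact ⟨j, hj, _, infty_mem_arc.2 hle, rfl⟩
  have hlam : lam ξ (d + 1) < 0 := lam_neg h.one_lt (by omega)
  rcases Nat.eq_zero_or_pos r with rfl | hr0
  · refine key 0 (Nat.zero_le _) rfl ?_
    exact h.strictMonoOn.monotoneOn ⟨le_rfl, by omega⟩ ⟨by omega, le_rfl⟩ (by omega)
  · refine key (N + 1 - r) (by omega) ?_ ?_
    · rw [if_neg (by omega)]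
      omega
    · rcases hr.eq_or_lt with rfl | hrN
      · rw [show r + 1 - r = 1 by omega, seq3_one, seq3_one, lam_one]
        exact hlam.le
      · simp only [seq3, show N + 1 - r ≠ 0 by omega, show N + 1 - r ≠ 1 by omega, if_false]
        exact hlam.le.trans (alpha_pos (zero_lt_one.trans h.one_lt) _).le

lemma lam_succ_lt (hξ : 1 < ξ) {n : ℕ} (hn : 1 ≤ n) : lam ξ (n + 1) < lam ξ n :=
  lam_lt hξ hn (Nat.lt_succ_self n)

lemma k_lt (h : IsGeneric N d k ξ) {i j : ℕ} (hi : 1 ≤ i) (hij : i < j) (hj : j ≤ N + d) :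
    k i < k j := h.strictMonoOn ⟨hi, by omega⟩ ⟨by omega, hj⟩ hij

lemma oval_base_inter (h : IsGeneric N d k ξ) {n : ℕ} (hn : n ∈ Finset.Icc 1 d) :
    oval N (N + d) k ξ 1 n ∩ sheet N (N + d) k ξ 0 =
        pt N (N + d) k ξ 0 '' interval (k (N + n - 1)) (k (N + n)) ∧
      oval N (N + d) k ξ 1 n ∩ sheet N (N + d) k ξ 1 =
        pt N (N + d) k ξ 1 '' interval (lam ξ (n + 1)) (lam ξ n) ∧
      ∀ j ∈ Finset.Icc 2 N, oval N (N + d) k ξ 1 n ∩ sheet N (N + d) k ξ j = ∅ := by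
  have hN := h.one_le
  rw [Finset.mem_Icc] at hn
  have H := isOvalCycle_base h hn.1 hn.2
  refine ⟨?_, ?_, fun j hj => ?_⟩
  · have := H.ovalFrom_inter_sheet h (i := 1) (j := 0) le_rfl (Nat.zero_le _)
    simp only [seq3_zero, seq3_one] at this
    rwa [arc_of_lt (k_lt h (by omega) (by omega) (by omega))] at this
  · have := H.ovalFrom_inter_sheet h (i := 1) (j := 1) le_rfl le_rfl
    simp only [seq3_one] at this
    rwa [arc_of_lt (lam_succ_lt h.one_lt hn.1)] at this
  · rw [Finset.mem_Icc] at hj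
    refine H.ovalFrom_inter_sheet_eq_empty h (i := 1) le_rfl hj.2 fun i hi => ?_
    interval_cases i <;> simp <;> omega

lemma oval_first_inter (h : IsGeneric N d k ξ) {r : ℕ} (hr : r ∈ Finset.Icc 2 N) :
    oval N (N + d) k ξ r 1 ∩ sheet N (N + d) k ξ 0 =
        pt N (N + d) k ξ 0 '' interval (k (N - r + 1)) (k (N - r + 2)) ∧
      oval N (N + d) k ξ r 1 ∩ sheet N (N + d) k ξ (r - 1) =
        pt N (N + d) k ξ (r - 1) '' interval (lam ξ 1) (alpha ξ 2) ∧
      oval N (N + d) k ξ r 1 ∩ sheet N (N + d) k ξ r =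
        pt N (N + d) k ξ r '' interval (lam ξ 2) (lam ξ 1) ∧
      ∀ j ∈ Finset.Icc 1 N, j ≠ r - 1 → j ≠ r →
        oval N (N + d) k ξ r 1 ∩ sheet N (N + d) k ξ j = ∅ := by
  rw [Finset.mem_Icc] at hr
  have H := isOvalCycle_first h hr.1 hr.2
  refine ⟨?_, ?_, ?_, fun j hj h1 h2 => ?_⟩
  · have := H.ovalFrom_inter_sheet h (i := 2) (j := 0) le_rfl (Nat.zero_le _)
    simp only [seq3_zero, seq3_two] at this
    rwa [arc_of_lt (k_lt h (by omega) (by omega) (by omega))] at this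
  · have := H.ovalFrom_inter_sheet h (i := 2) (j := 1) le_rfl one_le_two
    simp only [seq3_one, seq3_two] at this
    rwa [arc_of_lt (by rw [lam_one]; exact alpha_pos (zero_lt_one.trans h.one_lt) 2)] at this
  · have := H.ovalFrom_inter_sheet h (i := 2) (j := 2) le_rfl le_rfl
    simp only [seq3_two] at this
    rwa [arc_of_lt (lam_succ_lt h.one_lt le_rfl)] at this
  · rw [Finset.mem_Icc] at hj
    refine H.ovalFrom_inter_sheet_eq_empty h (i := 2) le_rfl hj.2 fun i hi => ?_
    interval_cases i <;> simp <;> omega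

lemma oval_chain_inter (h : IsGeneric N d k ξ) {r n : ℕ} (hr : r ∈ Finset.Icc 2 N)
    (hn : n ∈ Finset.Icc 2 d) :
    oval N (N + d) k ξ r n ∩ sheet N (N + d) k ξ (r - 1) =
        pt N (N + d) k ξ (r - 1) '' interval (alpha ξ n) (alpha ξ (n + 1)) ∧
      oval N (N + d) k ξ r n ∩ sheet N (N + d) k ξ r =
        pt N (N + d) k ξ r '' interval (lam ξ (n + 1)) (lam ξ n) ∧
      ∀ j ≤ N, j ≠ r - 1 → j ≠ r → oval N (N + d) k ξ r n ∩ sheet N (N + d) k ξ j = ∅ := by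
  rw [Finset.mem_Icc] at hr hn
  have H := isOvalCycle_chain h hr.1 hr.2 hn.1 hn.2
  refine ⟨?_, ?_, fun j hj h1 h2 => ?_⟩
  · have := H.ovalFrom_inter_sheet h (i := 1) (j := 0) le_rfl (Nat.zero_le _)
    simp only [seq3_zero, seq3_one] at this
    rwa [arc_of_lt (alpha_lt h.one_lt (Nat.lt_succ_self n))] at this
  · have := H.ovalFrom_inter_sheet h (i := 1) (j := 1) le_rfl le_rfl
    simp only [seq3_one] at this
    rwa [arc_of_lt (lam_succ_lt h.one_lt (by omega))] at this
  · refine H.ovalFrom_inter_sheet_eq_empty h (i := 1) le_rfl hj fun i hi => ?_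
    interval_cases i <;> simp <;> omega

/-- A finite point of the sheet `Γ_s` that lies on `Ω_{r,n}` is a point of `Γ_0`, a nonnegative
point of `Γ_{r - 1}`, or a point of the gap of `Γ_r` between `λ_{n+1}` and `λ_n`. -/
lemma pt_mem_oval_cases (h : IsGeneric N d k ξ) {r n s : ℕ} (hr : r ∈ Finset.Icc 1 N)
    (hn : n ∈ Finset.Icc 1 d) (hs : s ≤ N) {z : ℂ}
    (hz : pt N (N + d) k ξ s (z : OnePoint ℂ) ∈ oval N (N + d) k ξ r n) :
    s = 0 ∨ (1 ≤ s ∧ s = r - 1 ∧ ∃ x : ℝ, 0 ≤ x ∧ z = x) ∨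
      s = r ∧ ∃ x ∈ Set.Icc (lam ξ (n + 1)) (lam ξ n), z = x := by
  have hmem : pt N (N + d) k ξ s (z : OnePoint ℂ) ∈
      oval N (N + d) k ξ r n ∩ sheet N (N + d) k ξ s := ⟨hz, _, rfl⟩
  have key : ∀ {a b : ℝ}, oval N (N + d) k ξ r n ∩ sheet N (N + d) k ξ s =
      pt N (N + d) k ξ s '' interval a b → ∃ x ∈ Set.Icc a b, z = x := by
    intro a b heq
    rw [heq] at hmem
    obtain ⟨_, ⟨x, hx, rfl⟩, h2⟩ := hmem
    exact ⟨x, hx, (OnePoint.coe_injective (pt_injective h hs h2)).symm⟩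
  have hr1 := Finset.mem_Icc.1 hr
  have hn1 := Finset.mem_Icc.1 hn
  have hξ0 : 0 < ξ := zero_lt_one.trans h.one_lt
  rcases Nat.eq_zero_or_pos s with hs0 | hs0
  · exact .inl hs0
  right
  by_cases hsr : s = r
  · subst hsr
    refine .inr ⟨rfl, ?_⟩
    rcases hr1.1.eq_or_lt with rfl | hr2
    · exact key (oval_base_inter h hn).2.1
    · rcases hn1.1.eq_or_lt with rfl | hn2
      · exact key (oval_first_inter h (Finset.mem_Icc.2 ⟨hr2, hr1.2⟩)).2.2.1
      · exact key (oval_chain_inter h (Finset.mem_Icc.2 ⟨hr2, hr1.2⟩)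
          (Finset.mem_Icc.2 ⟨hn2, hn1.2⟩)).2.1
  rcases hr1.1.eq_or_lt with rfl | hr2
  · rw [(oval_base_inter h hn).2.2 s (Finset.mem_Icc.2 (by omega))] at hmem
    exact hmem.elim
  have hr' := Finset.mem_Icc.2 ⟨hr2, hr1.2⟩
  by_cases hsr1 : s = r - 1
  · refine .inl ⟨hs0, hsr1, ?_⟩
    rcases hn1.1.eq_or_lt with rfl | hn2
    · have h1 := (oval_first_inter h hr').2.1
      rw [← hsr1] at h1
      obtain ⟨x, hx, hzx⟩ := key h1
      rw [lam_one] at hx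
      exact ⟨x, hx.1, hzx⟩
    · have h1 := (oval_chain_inter h hr' (Finset.mem_Icc.2 ⟨hn2, hn1.2⟩)).1
      rw [← hsr1] at h1
      obtain ⟨x, hx, hzx⟩ := key h1
      exact ⟨x, (alpha_pos hξ0 n).le.trans hx.1, hzx⟩
  · exfalso
    rcases hn1.1.eq_or_lt with rfl | hn2
    · rw [(oval_first_inter h hr').2.2.2 s (Finset.mem_Icc.2 (by omega)) hsr1 hsr] at hmem
      exact hmem
    · rw [(oval_chain_inter h hr' (Finset.mem_Icc.2 ⟨hn2, hn1.2⟩)).2.2 s hs hsr1 hsr] at hmem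
      exact hmem

end

end

/-! ### The threshold for `ξ` and the divisor on the finite ovals -/

section

/-- From some `ξ₀` on, the parameters are regular and `ε^{(r)}_j = O(ξ ^ (-j))`. -/
lemma exists_threshold {N d : ℕ} {A : ℕ → ℕ → ℝ} (hA : IsNormalizedBandedTP N (N + d) A)
    (hd : 1 ≤ d) : ∃ ξ₀ : ℝ, 1 < ξ₀ ∧ (∀ ξ > ξ₀, IsRegular N d A ξ) ∧
      ∀ r ∈ Finset.Icc 1 N, ∀ j ∈ Finset.Icc 1 (r - 1),
        ∃ C : ℝ, ∀ ξ > ξ₀, coefEps N d A ξ r j ≤ C * (ξ ^ j)⁻¹ := by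
  have h1 : ∀ r ∈ Finset.Icc 1 N, ∀ j ∈ Finset.Icc 1 (r - 1),
      ∃ C : ℝ, ∀ᶠ ξ in atTop, ξ ^ j * coefEps N d A ξ r j ≤ C := by
    intro r hr j hj
    rw [Finset.mem_Icc] at hr
    obtain ⟨c, -, hc⟩ := asy_pow_mul_coefEps hA hd hr.1 hr.2 hj
    exact ⟨c + 1, (hc.tendsto.eventually_lt_const (lt_add_one c)).mono fun _ => le_of_lt⟩
  choose! C hC using h1
  have h2 : ∀ᶠ ξ in atTop, ∀ r ∈ Finset.Icc 1 N, ∀ j ∈ Finset.Icc 1 (r - 1),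
      ξ ^ j * coefEps N d A ξ r j ≤ C r j :=
    (eventually_all_finset _).2 fun r hr => (eventually_all_finset _).2 fun j hj => hC r hr j hj
  obtain ⟨ξ₁, hξ₁⟩ := eventually_atTop.1 (h2.and (eventually_isRegular hA hd))
  have hlt : ∀ ξ > max ξ₁ 2, ξ₁ ≤ ξ ∧ 0 < ξ := fun ξ hξ =>
    ⟨(le_max_left _ _).trans (le_of_lt hξ), two_pos.trans_le ((le_max_right _ _).trans (le_of_lt hξ))⟩
  refine ⟨max ξ₁ 2, one_lt_two.trans_le (le_max_right _ _), fun ξ hξ => (hξ₁ ξ (hlt ξ hξ).1).2,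
    fun r hr j hj => ⟨C r j, fun ξ hξ => ?_⟩⟩
  have h3 := (hξ₁ ξ (hlt ξ hξ).1).1 r hr j hj
  rwa [← div_eq_mul_inv, le_div_iff₀ (pow_pos (hlt ξ hξ).2 j), mul_comm]

/-- The divisor of the wave function on the oval `Ω_{r,n}`. -/
lemma meromorphicOrderAt_psi_of_mem_oval {N d : ℕ} {A : ℕ → ℕ → ℝ} {k : ℕ → ℝ} {ξ : ℝ}
    (hA : IsNormalizedBandedTP N (N + d) A) (h : IsRegular N d A ξ) (hg : IsGeneric N d k ξ)
    {r n s : ℕ} (hr : r ∈ Finset.Icc 1 N) (hn : n ∈ Finset.Icc 1 d) (hs : s ≤ N) {t : ℕ → ℝ}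
    (ht : Admissible t) {z : ℂ} (hz : pt N (N + d) k ξ s z ∈ oval N (N + d) k ξ r n) :
    meromorphicOrderAt (psi N (N + d) k ξ (vacuumData N d A ξ) s t) z =
      (((if s = r ∧ z = (zeros N d A k ξ r n t : ℂ) then 1 else 0) -
        (if s = r ∧ z = ((vacuumData N d A ξ).b r n : ℂ) then 1 else 0) : ℤ) : WithTop ℤ) := by
  have hr1 := Finset.mem_Icc.1 hr
  -- On `Γ_0` the wave function is an exponential, and on `Γ_{r-1}` the oval stays in the region `λ
  -- ≥ 0`; so only the gap on `Γ_r` carries zeros or poles.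
  rcases pt_mem_oval_cases hg hr hn hs hz with rfl | ⟨hs1, hsr, x, hx, rfl⟩ | ⟨rfl, x, hx, rfl⟩
  · rw [meromorphicOrderAt_psi_zero ht]
    simp [show (0 : ℕ) ≠ r by omega]
  · rw [meromorphicOrderAt_psi_of_nonneg hA h hg.one_le_sub (Finset.mem_Icc.2 ⟨hs1, hs⟩) hx]
    simp [show s ≠ r by omega]
  · rw [meromorphicOrderAt_psi_of_mem_gap hA h hr hn hx]
    simp only [true_and]

end

end KPVacuum

end

theorem mainTheorem3 (N M : ℕ) (hN : 1 ≤ N) (hNM : N < M) (A : ℕ → ℕ → ℝ)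
    (hA : KPVacuum.IsNormalizedBandedTP N M A) :
    ∃ (ξ₀ : ℝ) (W : ℝ → KPVacuum.Data), 1 < ξ₀ ∧
      -- the parameters `ε`: `ε^{(r)}_j = O(ξ ^ (-j))`
      (∀ r ∈ Finset.Icc 1 N, ∀ j ∈ Finset.Icc 1 (r - 1),
        ∃ C : ℝ, ∀ ξ > ξ₀, (W ξ).ε r j ≤ C * (ξ ^ j)⁻¹) ∧
      ∀ k : ℕ → ℝ, StrictMonoOn k (Set.Icc 1 M) →
        -- for fixed `ξ`, `W ξ` gives the unique vacuum wave function
        (∀ ξ > ξ₀, KPVacuum.IsVacuum N M k ξ (W ξ) A ∧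
          ∀ W', KPVacuum.IsVacuum N M k ξ W' A → KPVacuum.Data.Agree N M W' (W ξ)) ∧
        ∃ χ : ℝ → ℕ → ℕ → (ℕ → ℝ) → ℝ,
          (∀ ξ > ξ₀,
            KPVacuum.IsRationalMCurve N M k ξ (N * (M - N)) ∧
            -- each double point is common to exactly two ovals, other real points lie on one oval
            (∀ P ∈ KPVacuum.doublePoints N M k ξ,
              {S ∈ KPVacuum.ovals N M k ξ | P ∈ S}.encard = 2) ∧
            (∀ P ∈ KPVacuum.realPart N M k ξ, P ∉ KPVacuum.doublePoints N M k ξ →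
              ∃! S, S ∈ KPVacuum.ovals N M k ξ ∧ P ∈ S) ∧
            ∃ (Ω₀ : Set (KPVacuum.Curve N M k ξ)) (Ω : ℕ → ℕ → Set (KPVacuum.Curve N M k ξ)),
              -- the ovals
              (KPVacuum.ovals N M k ξ =
                insert Ω₀ {S | ∃ r ∈ Finset.Icc 1 N, ∃ n ∈ Finset.Icc 1 (M - N), S = Ω r n}) ∧
              KPVacuum.pt N M k ξ 0 OnePoint.infty ∈ Ω₀ ∧
              (∀ r ∈ Finset.Icc 1 N, KPVacuum.pt N M k ξ r OnePoint.infty ∈ Ω₀) ∧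
              -- the ovals `Ω_{1,n}`
              (∀ n ∈ Finset.Icc 1 (M - N),
                Ω 1 n ∩ KPVacuum.sheet N M k ξ 0 =
                  KPVacuum.pt N M k ξ 0 '' KPVacuum.interval (k (N + n - 1)) (k (N + n)) ∧
                Ω 1 n ∩ KPVacuum.sheet N M k ξ 1 =
                  KPVacuum.pt N M k ξ 1 ''
                    KPVacuum.interval (KPVacuum.lam ξ (n + 1)) (KPVacuum.lam ξ n) ∧
                ∀ j ∈ Finset.Icc 2 N, Ω 1 n ∩ KPVacuum.sheet N M k ξ j = ∅) ∧
              -- the ovals `Ω_{r,1}`, `r ≥ 2`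
              (∀ r ∈ Finset.Icc 2 N,
                Ω r 1 ∩ KPVacuum.sheet N M k ξ 0 =
                  KPVacuum.pt N M k ξ 0 '' KPVacuum.interval (k (N - r + 1)) (k (N - r + 2)) ∧
                Ω r 1 ∩ KPVacuum.sheet N M k ξ (r - 1) =
                  KPVacuum.pt N M k ξ (r - 1) ''
                    KPVacuum.interval (KPVacuum.lam ξ 1) (KPVacuum.alpha ξ 2) ∧
                Ω r 1 ∩ KPVacuum.sheet N M k ξ r =
                  KPVacuum.pt N M k ξ r ''
                    KPVacuum.interval (KPVacuum.lam ξ 2) (KPVacuum.lam ξ 1) ∧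
                ∀ j ∈ Finset.Icc 1 N, j ≠ r - 1 → j ≠ r →
                  Ω r 1 ∩ KPVacuum.sheet N M k ξ j = ∅) ∧
              -- the ovals `Ω_{r,n}`, `r ≥ 2`, `n ≥ 2`
              (∀ r ∈ Finset.Icc 2 N, ∀ n ∈ Finset.Icc 2 (M - N),
                Ω r n ∩ KPVacuum.sheet N M k ξ (r - 1) =
                  KPVacuum.pt N M k ξ (r - 1) ''
                    KPVacuum.interval (KPVacuum.alpha ξ n) (KPVacuum.alpha ξ (n + 1)) ∧
                Ω r n ∩ KPVacuum.sheet N M k ξ r =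
                  KPVacuum.pt N M k ξ r ''
                    KPVacuum.interval (KPVacuum.lam ξ (n + 1)) (KPVacuum.lam ξ n) ∧
                ∀ j ≤ N, j ≠ r - 1 → j ≠ r → Ω r n ∩ KPVacuum.sheet N M k ξ j = ∅) ∧
              -- `Ψ(P, 0) = 1` for all `P ∈ Γ`
              (∀ r ≤ N, ∀ z : OnePoint ℂ,
                KPVacuum.HasValueAt (KPVacuum.psi N M k ξ (W ξ) r 0) z 1) ∧
              -- the essential singularity at `P_0`
              (∀ t, KPVacuum.Admissible t →
                (∀ z, KPVacuum.psi N M k ξ (W ξ) 0 t z = Complex.exp (KPVacuum.thetaC z t)) ∧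
                (t ≠ 0 → ¬ MeromorphicAt (fun w => KPVacuum.psi N M k ξ (W ξ) 0 t w⁻¹) 0)) ∧
              -- poles and zeros in the finite ovals
              (∀ r ∈ Finset.Icc 1 N, ∀ n ∈ Finset.Icc 1 (M - N),
                (W ξ).b r n ∈ Set.Ioo (KPVacuum.lam ξ (n + 1)) (KPVacuum.lam ξ n) ∧
                χ ξ r n 0 = (W ξ).b r n ∧
                (∃ t, KPVacuum.Admissible t ∧
                  meromorphicOrderAt (KPVacuum.psi N M k ξ (W ξ) r t) ((W ξ).b r n : ℂ) = -1) ∧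
                ∀ t, KPVacuum.Admissible t →
                  χ ξ r n t ∈ Set.Ioo (KPVacuum.lam ξ (n + 1)) (KPVacuum.lam ξ n) ∧
                  -- on the oval, the divisor of `Ψ(·, t)` is (zero `χ`) minus (pole `b`)
                  ∀ s ≤ N, ∀ z : ℂ, KPVacuum.pt N M k ξ s z ∈ Ω r n →
                    meromorphicOrderAt (KPVacuum.psi N M k ξ (W ξ) s t) z =
                      (((if s = r ∧ z = (χ ξ r n t : ℂ) then 1 else 0) -
                        (if s = r ∧ z = ((W ξ).b r n : ℂ) then 1 else 0) : ℤ) : WithTop ℤ))) ∧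
          -- the asymptotics of the zeros, uniform for `(t_1, …, t_{j₀})` in a compact set
          ∀ r ∈ Finset.Icc 1 N, ∀ n ∈ Finset.Icc 1 (M - N), ∀ (j₀ : ℕ) (K₀ : Set (Fin j₀ → ℝ)),
            IsCompact K₀ → ∃ C ξ₁ : ℝ, ξ₀ ≤ ξ₁ ∧ ∀ ξ > ξ₁, ∀ τ ∈ K₀, ∃ δ δ' : ℝ,
              |δ| ≤ C * ξ⁻¹ ∧ |δ'| ≤ C * ξ⁻¹ ∧
              χ ξ r n (KPVacuum.extendTimes τ) =
                -((∑ l ∈ Finset.Icc 1 n, KPVacuum.Bhat N A r l *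
                      KPVacuum.V N M k ξ (W ξ) r l (KPVacuum.extendTimes τ)) /
                    ∑ l ∈ Finset.Icc 1 (n + 1), KPVacuum.Bhat N A r l *
                      KPVacuum.V N M k ξ (W ξ) r l (KPVacuum.extendTimes τ)) *
                  ξ ^ (2 * (n - 1)) * (1 + δ) ∧
              χ ξ r n (KPVacuum.extendTimes τ) =
                -(KPVacuum.minorSum N A k r n (KPVacuum.extendTimes τ) /
                    KPVacuum.minorSum N A k r (n + 1) (KPVacuum.extendTimes τ)) *
                  ξ ^ (2 * (n - 1)) * (1 + δ') := by
  obtain ⟨d, rfl⟩ := Nat.exists_eq_add_of_le hNM.le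
  have hd : 1 ≤ d := by omega
  obtain ⟨ξ₀, hξ₀, hreg, heps⟩ := KPVacuum.exists_threshold hA hd
  -- The threshold and the parameters are chosen before the phases, which is their independence of
  -- `k`; the zeros are chosen afterwards.
  refine ⟨ξ₀, KPVacuum.vacuumData N d A, hξ₀, heps, fun k hk => ⟨fun ξ hξ =>
    ⟨KPVacuum.isVacuum_vacuumData hN hA (hreg ξ hξ), fun W' hW' => hW'.agree hA (hreg ξ hξ) hk⟩,
    fun ξ r n t => KPVacuum.zeros N d A k ξ r n t, fun ξ hξ => ?_, ?_⟩⟩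
  · have h := hreg ξ hξ
    have hg : KPVacuum.IsGeneric N d k ξ := ⟨hN, hd, hk, h.one_lt⟩
    have hall := KPVacuum.inCycle_of_marked hg
    simp only [Nat.add_sub_cancel_left]
    refine ⟨KPVacuum.isRationalMCurve hg,
      fun P hP => KPVacuum.encard_ovals_of_mem_doublePoints hg hall hP,
      fun P hP hP' => KPVacuum.existsUnique_oval hg hall hP hP',
      KPVacuum.ovalFrom N (N + d) k ξ (0, k (N + d)), KPVacuum.oval N (N + d) k ξ,
      KPVacuum.ovals_eq hg, KPVacuum.infty_mem_ovalFrom_zero hg (Nat.zero_le N),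
      fun r hr => KPVacuum.infty_mem_ovalFrom_zero hg (Finset.mem_Icc.1 hr).2,
      fun n hn => KPVacuum.oval_base_inter hg hn, fun r hr => KPVacuum.oval_first_inter hg hr,
      fun r hr n hn => KPVacuum.oval_chain_inter hg hr hn,
      fun r hr z => KPVacuum.hasValueAt_psi hA h hr z, fun t ht => ⟨fun z => ?_, fun h0 => ?_⟩,
      fun r hr n hn => ⟨KPVacuum.interlaced_b h hr n hn, KPVacuum.zeros_zero hA h hr n,
        KPVacuum.exists_meromorphicOrderAt_eq_neg_one hA h hk hr hn, fun t ht =>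
          ⟨KPVacuum.interlaced_zeros hA h hr n hn, fun s hs z hz =>
            KPVacuum.meromorphicOrderAt_psi_of_mem_oval hA h hg hr hn hs ht hz⟩⟩⟩
    · rw [KPVacuum.psi_zero]
    · simp only [KPVacuum.psi_zero]
      exact KPVacuum.not_meromorphicAt_exp_thetaC_inv ht h0
  · intro r hr n hn j₀ K₀ hK
    rw [Nat.add_sub_cancel_left] at hn
    obtain ⟨C, hC⟩ := KPVacuum.zeros_asymptotics (k := k) hA hd hr hn hK
    -- The range of validity of the error bound depends on the phases and the compact set, so a
    -- second threshold is needed.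
    obtain ⟨ξ₁, hξ₁⟩ := eventually_atTop.1 hC
    exact ⟨C, max ξ₀ ξ₁, le_max_left _ _, fun ξ hξ => hξ₁ ξ ((le_max_right _ _).trans hξ.le)⟩
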